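/- Let $\Sigma$ be a closed (compact, without boundary, possibly disconnected) oriented smooth surface. An immersion $f:\Sigma\to\mathbb R^3$ is \emph{generic} if its only multiple points are transverse double and triple points; it is cooriented by the orientations of $\Sigma$ and $\mathbb R^3$. Its \emph{Alexander numbering} is the function on the regions (components) of $\mathbb R^3\setminus f(\Sigma)$ that equals $-\tfrac32$ on the unbounded region and increases by $1$ whenever a sheet is crossed in the direction of its coorientation. The \emph{index} $\operatorname{ind}(t)$ of a triple point $t$ is the average of the Alexander numbering over the eight regions locally adjacent to $t$, and $$St_{(2)}(f)=\sum_{t\in T(f)}\operatorname{ind}(t),$$ where $T(f)$ is the set of triple points of $f$. Let $(f_t)_{t\in(a,b)}$ be a smooth regular homotopy of immersions $\Sigma\to\mathbb R^3$ such that $f_t$ is generic for $t\neq t_0$ and that undergoes at $t_0\in(a,b)$ a \emph{quadruple-point event} $\mathrm Q$: exactly four sheets of $f_{t_0}$ pass through one point, any three of them in general position, each sheet crosses the triple point of the other three with nonzero speed, and $f_{t_0}$ has only transverse double and triple points elsewhere. Just before and just after $t_0$ the four sheets bound a small curved tetrahedron, which shrinks to the quadruple point as $t\to t_0$. Let $j$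 be the number of its four faces whose coorientation points out of the tetrahedron at times just before $t_0$ (the number of outward coorientations before the event). The event is of type $\mathrm Q^{m}$ when $4-m$ is the smaller of the numbers of outward cooriented faces just before and just after $t_0$. \textbf{Theorem (Strangeness slice formula).} For every $t\in(a,b)\setminus\{t_0\}$ the Alexander numbering of $f_t$ exists and is unique and $T(f_t)$ is finite, so that $St_{(2)}(f_t)$ is well defined, and for all $a<s<t_0<t<b$ $$St_{(2)}(f_t)-St_{(2)}(f_s)=2j-4 .$$ If $j\le 2$, the event is of type $\mathrm Q^{4-j}$. If the event is of type $\mathrm Q^{2}$, then $St_{(2)}(f_t)-St_{(2)}(f_s)=0$. -/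

import Mathlib

open Set Filter Topology
open scoped Manifold ContDiff

noncomputable section

namespace SurfaceStrangeness

/-- The Euclidean plane, on which surfaces are modelled. -/
abbrev E2 : Type := EuclideanSpace ℝ (Fin 2)

/-- The ambient Euclidean space, with its standard orientation. -/
abbrev E3 : Type := EuclideanSpace ℝ (Fin 3)

/-- The charted space `M` is an oriented surface: all changes of charts of its atlas have positive
Jacobian determinant. The orientation of `M` is the one for which all the charts of the atlas
preserve orientation. -/
def IsOrientedAtlas (M : Type*) [TopologicalSpace M] [ChartedSpace E2 M] : Prop :=
  ∀ e ∈ atlas E2 M, ∀ e' ∈ atlas E2 M, ∀ x ∈ (e.symm.trans e').source,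
    0 < (fderiv ℝ (e.symm.trans e') x).det

section Surface

variable {M : Type*} [TopologicalSpace M] [ChartedSpace E2 M]

/-- The differential of `f : M → ℝ³` at `q`. The tangent space of `M` at `q` is identified with
`ℝ²` through the preferred chart at `q`, which belongs to the atlas. -/
def differential (f : M → E3) (q : M) : E2 →L[ℝ] E3 :=
  mfderiv (𝓡 2) 𝓘(ℝ, E3) f q

/-- A smooth immersion of the surface `M` in `ℝ³`. -/
def IsSmoothImmersion (f : M → E3) : Prop :=
  ContMDiff (𝓡 2) 𝓘(ℝ, E3) ∞ f ∧ ∀ q, Function.Injective (differential f q)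

/-- The vector normal to the sheet of `f` at `q` that gives the coorientation induced by the
orientations of `M` and of `ℝ³`: the cross product of the images of a positively oriented basis of
the tangent plane of `M` at `q`. Only its direction is ever used. -/
def conormal (f : M → E3) (q : M) : E3 :=
  WithLp.toLp 2 (crossProduct
    (WithLp.ofLp (differential f q (EuclideanSpace.single 0 1)))
    (WithLp.ofLp (differential f q (EuclideanSpace.single 1 1))))

/-- The sheets of `f` through the point `p` are in general position: their normals are linearly
independent. In `ℝ³` this forces `p` to have at most three preimages; two sheets then cross
transversally, and three sheets cross like three coordinate planes. -/
def IsTransverseAt (f : M → E3) (p : E3) : Prop :=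
  LinearIndependent ℝ (fun q : f ⁻¹' {p} => conormal f q)

/-- A generic immersion: its only multiple points are transverse double and triple points. -/
def IsGenericImmersion (f : M → E3) : Prop :=
  IsSmoothImmersion f ∧ ∀ p, IsTransverseAt f p

/-- The set of triple points of `f`. -/
def triplePoints (f : M → E3) : Set E3 :=
  {p | (f ⁻¹' {p}).encard = 3}

/-- `A` is the Alexander numbering of `f`: it is constant on each region (component of the
complement of the image), it is `-3/2` on the region of the point at infinity, and it increases by
`1` when a sheet is crossed, at a point with a single preimage, in the direction of the
coorientation. The value on the image, where there is no region, is set to `0`. -/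
structure IsAlexanderNumbering (f : M → E3) (A : E3 → ℚ) : Prop where
  locallyConstant : ∀ x ∉ range f, ∀ᶠ y in 𝓝 x, A y = A x
  infinity : ∀ᶠ x in Bornology.cobounded E3, A x = -3 / 2
  crossing : ∀ q : M, f ⁻¹' {f q} = {q} → ∀ᶠ s : ℝ in 𝓝[>] 0,
    A (f q + s • conormal f q) = A (f q - s • conormal f q) + 1
  image : ∀ x ∈ range f, A x = 0

/-- The Alexander numbering of `f`. -/
def alexanderNumbering (f : M → E3) : E3 → ℚ :=
  Classical.epsilon (IsAlexanderNumbering f)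

/-- The index of the region that is adjacent to the point `p` in the local octant given by a choice
`ε` of a side of each sheet through `p` (`1` for the side to which the coorientation points): the
value of the Alexander numbering near `p` along all the rays from `p` into that octant. -/
def octantIndex (f : M → E3) (p : E3) (ε : f ⁻¹' {p} → ℤˣ) : ℚ :=
  Classical.epsilon fun c : ℚ =>
    ∀ v : E3, (∀ q : f ⁻¹' {p}, 0 < ((ε q : ℤ) : ℝ) * inner ℝ (conormal f q) v) →
      ∀ᶠ s : ℝ in 𝓝[>] 0, alexanderNumbering f (p + s • v) = c

/-- The index of a triple point: the mean of the indices of the eight adjacent local regions. -/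
def tripleIndex (f : M → E3) (p : E3) : ℚ :=
  (∑ᶠ ε : f ⁻¹' {p} → ℤˣ, octantIndex f p ε) / 8

/-- The invariant `St₍₂₎`: the sum of the indices of the triple points. -/
def St2 (f : M → E3) : ℚ :=
  ∑ᶠ p ∈ triplePoints f, tripleIndex f p

/-- `F` is a regular homotopy over the time interval `(a, b)`. -/
def IsRegularHomotopy (F : ℝ → M → E3) (a b : ℝ) : Prop :=
  ContMDiffOn (𝓘(ℝ, ℝ).prod (𝓡 2)) 𝓘(ℝ, E3) ∞ (fun x : ℝ × M => F x.1 x.2)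
      (Ioo a b ×ˢ (univ : Set M)) ∧
    ∀ t ∈ Ioo a b, IsSmoothImmersion (F t)

/-- The homotopy `F` undergoes a quadruple-point event (an event `Q`) at the time `t₀`; the four
sheets that take part in it are those at `q 0`, `q 1`, `q 2`, `q 3`.

The four sheets, and no others, pass through one point, any three of them in general position, and
each sheet crosses with nonzero speed the triple point of the three others. The last condition is
that the four sheets of the track `(t, x) ↦ (t, F t x)` in space-time, whose conormals are listed
in `crossing`, are in general position. At all other points of `ℝ³` the immersion `F t₀` is
generic. -/
structure IsQuadrupleEvent (F : ℝ → M → E3) (t₀ : ℝ) (q : Fin 4 → M) : Prop where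
  injective : Function.Injective q
  fiber : F t₀ ⁻¹' {F t₀ (q 0)} = range q
  generalPosition : ∀ i, LinearIndependent ℝ
    (fun k : {k : Fin 4 // k ≠ i} => conormal (F t₀) (q k))
  crossing : LinearIndependent ℝ (fun i : Fin 4 =>
    ((conormal (F t₀) (q i),
      -inner ℝ (conormal (F t₀) (q i)) (deriv (fun t => F t (q i)) t₀)) : E3 × ℝ))
  elsewhere : ∀ p, p ≠ F t₀ (q 0) → IsTransverseAt (F t₀) p

/-- The `i`-th sheet of a quadruple-point event has outward coorientation, at the times close to the
event selected by `l` (`𝓝[<] t₀` before the event, `𝓝[>] t₀` after it).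

At such a time `t` the four sheets near the event bound a small curved tetrahedron. The common
value of `F t (r k)` for `k ≠ i` is the vertex where the three sheets other than the `i`-th meet,
and `F t (r i)` is the foot on the `i`-th sheet of the normal from this vertex, which is opposite to
the face on that sheet. The coorientation of the face is outward when it points away from the
opposite vertex, that is, when it is the direction from the vertex to the foot. All
the points `r k` are close to the points `q k` of the event. -/
def IsOutward (F : ℝ → M → E3) (l : Filter ℝ) (q : Fin 4 → M) (i : Fin 4) : Prop :=
  ∀ U ∈ 𝓝 q, ∀ᶠ t in l, ∃ r ∈ U, ∃ s : ℝ, 0 < s ∧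
    ∀ k, k ≠ i → F t (r k) + s • conormal (F t) (r i) = F t (r i)

/-- The number of sheets with outward coorientation. -/
def outwardCount (F : ℝ → M → E3) (l : Filter ℝ) (q : Fin 4 → M) : ℕ :=
  {i : Fin 4 | IsOutward F l q i}.ncard

/-- The number `m` for which a quadruple-point event at the time `t₀` is of type `Q^m`: the number
`4 - m` is the smaller of the numbers of outward cooriented faces of the tetrahedron that
vanishes and of the tetrahedron that appears. -/
def quadrupleType (F : ℝ → M → E3) (t₀ : ℝ) (q : Fin 4 → M) : ℕ :=
  4 - min (outwardCount F (𝓝[<] t₀) q) (outwardCount F (𝓝[>] t₀) q)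

end Surface

end SurfaceStrangeness

end

/-!
The proof takes place in space-time `ℝ × E3`, where the track of the homotopy is a hypersurface with
cooriented sheets. Near each point of it the sheets are the zero sets of finitely many functions
whose spatial gradients are positive multiples of the conormals (`IsLocalModel`), and the number of
sheets of which a point is on the positive side (`sideCount`) is a local numbering with the right
jumps. Two local numberings differ by a constant where both are defined
(`IsLocalModel.eventually_sideCount_eq`). Since `Ioo a b ×ˢ univ` is convex they are glued into one
function `A` on space-time (`exists_hasJumpsOn_of_convex`), which can be normalized to `-3 / 2` at
infinity (`exists_spacetime_numbering`). At a time `t` at which the surface is generic, `A (t, ·)` is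
an Alexander numbering off the image, and the only one: the difference of two numberings is constant
across simple points of the image, hence across all points, as double and triple points can be
avoided (`IsAlexanderNumbering.unique`). The mean over the eight octants at a triple point is
`3 / 2` more than the value in the octant on the negative side of the three sheets
(`tripleIndex_eq`).

By the implicit function theorem three sheets in general position meet along a curve of triple
points in space-time. Near a point where the sheets are transverse at most three sheets are present,
so the triple points and their indices persist (`exists_hasLocalSum_of_isTransverseAt`). By
compactness `St2` is the sum of finitely many local contributions (`eventually_St2_eq`), so that it
is constant before and after the event, and its jump comes from the quadruple point.

Near the quadruple point each of the four triples of sheets has its curve of triple points. Since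
the four sheets of the track are in general position in space-time, the curve opposite to the `i`-th
sheet crosses this sheet with speed `d i ≠ 0` (`IsQuadrupleEvent.exists_speeds`). If `d i > 0` the
vertex opposite to the `i`-th face goes from the negative to the positive side: its index increases
by `1`, and the face is cooriented outwards before the event and inwards after it. If `d i < 0` its
index decreases by `1`, and the face is cooriented inwards before the event and outwards after it.
With `j` indices of the first kind and `4 - j` of the second, the jump is `2 * j - 4`, and `4 - j`
faces are cooriented outwards after the event.

To compare this with the description of outward faces by normals dropped from the opposite vertex
(`isOutward_iff`), one needs that such a normal exists, its foot being a closest point of the sheet,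
and that its direction is given by the sign of the equation of the sheet at the vertex.
-/

noncomputable section

namespace SurfaceStrangeness

/-! ### Gluing functions with prescribed jumps -/

theorem eq_of_isPreconnected_of_eventually_eq {X Y : Type*} [TopologicalSpace X] {s : Set X}
    (hs : IsPreconnected s) {f : X → Y} (h : ∀ x ∈ s, ∀ᶠ y in 𝓝[s] x, f y = f x) {x y : X}
    (hx : x ∈ s) (hy : y ∈ s) : f x = f y := by
  have := isPreconnected_iff_preconnectedSpace.1 hs
  have hf : IsLocallyConstant (fun z : s => f z) := by
    rw [IsLocallyConstant.iff_eventually_eq]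
    rintro ⟨z, hz⟩
    have := h z hz
    rw [nhdsWithin_eq_map_subtype_coe hz, eventually_map] at this
    exact this
  exact hf.apply_eq_of_preconnectedSpace ⟨x, hx⟩ ⟨y, hy⟩

section Gluing

variable {E G : Type*} [AddCommGroup G]

/-- The function `A` has, near every point `p` of `U`, the jumps of the local function `α p`. -/
def HasJumpsOn [TopologicalSpace E] (α : E → E → G) (U : Set E) (A : E → G) : Prop :=
  ∀ p ∈ U, ∃ c, ∀ᶠ x in 𝓝 p, A x = α p x + c

theorem HasJumpsOn.exists_eq_add [TopologicalSpace E] {α : E → E → G} {U V W : Set E} {A B : E → G}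
    (hA : HasJumpsOn α U A) (hB : HasJumpsOn α V B) (hWU : W ⊆ U) (hWV : W ⊆ V)
    (hW : IsPreconnected W) {o : E} (ho : o ∈ W) :
    ∀ x ∈ W, A x = B x + (A o - B o) := by
  intro x hx
  have hxo : A x - B x = A o - B o := by
    refine eq_of_isPreconnected_of_eventually_eq (f := fun x => A x - B x) hW ?_ hx ho
    intro y hy
    obtain ⟨c, hc⟩ := hA y (hWU hy)
    obtain ⟨d, hd⟩ := hB y (hWV hy)
    apply mem_nhdsWithin_of_mem_nhds
    filter_upwards [hc, hd] with z hz hz'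
    simp only [hz, hz', hc.self_of_nhds, hd.self_of_nhds]
    abel
  rw [← hxo]; abel

theorem HasJumpsOn.union [TopologicalSpace E] {α : E → E → G} {U V : Set E} {A B : E → G}
    (hA : HasJumpsOn α U A) (hB : HasJumpsOn α V B) (hU : IsOpen U) (hV : IsOpen V)
    (hUV : IsPreconnected (U ∩ V)) {o : E} (ho : o ∈ U ∩ V) :
    ∃ A', HasJumpsOn α (U ∪ V) A' := by
  classical
  have key := hA.exists_eq_add hB inter_subset_left inter_subset_right hUV ho
  refine ⟨fun x => if x ∈ U then A x else B x + (A o - B o), ?_⟩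
  rintro p (hp | hp)
  · obtain ⟨c, hc⟩ := hA p hp
    refine ⟨c, ?_⟩
    filter_upwards [hc, hU.mem_nhds hp] with x hx hxU
    simp [hxU, hx]
  · obtain ⟨c, hc⟩ := hB p hp
    refine ⟨c + (A o - B o), ?_⟩
    filter_upwards [hc, hV.mem_nhds hp] with x hx hxV
    by_cases hxU : x ∈ U
    · simp [hxU, key x ⟨hxU, hxV⟩, hx]; abel
    · simp [hxU, hx]; abel

variable [NormedAddCommGroup E] [NormedSpace ℝ E]

/-- The segment is cut into pieces shorter than a Lebesgue number of the cover by the domains of the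
local functions; ball after ball is added to a convex neighbourhood of the initial part. -/
theorem exists_hasJumpsOn_segment {α : E → E → G} {o p : E}
    (h : ∀ y ∈ segment ℝ o p, ∀ᶠ p' in 𝓝 y, ∃ c, ∀ᶠ x in 𝓝 p', α y x = α p' x + c) :
    ∃ δ > 0, ∃ A, HasJumpsOn α (Metric.thickening δ (segment ℝ o p)) A := by
  have hcomp : IsCompact (segment ℝ o p) := by
    rw [segment_eq_image_lineMap]
    exact isCompact_Icc.image AffineMap.lineMap_continuous
  have hloc : ∀ y ∈ segment ℝ o p, ∃ U : Set E, IsOpen U ∧ y ∈ U ∧ HasJumpsOn α U (α y) := by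
    intro y hy
    obtain ⟨U, hU, hUo, hyU⟩ := eventually_nhds_iff.1 (h y hy)
    exact ⟨U, hUo, hyU, fun p' hp' => hU p' hp'⟩
  choose! U hUo hyU hU using hloc
  obtain ⟨ε, hε, hleb⟩ := lebesgue_number_lemma_of_metric hcomp
    (c := fun y : segment ℝ o p => U y) (fun y => hUo y y.2)
    (fun y hy => mem_iUnion.2 ⟨⟨y, hy⟩, hyU y hy⟩)
  obtain ⟨N, hN⟩ := exists_nat_gt (dist o p / ε)
  have hN0 : (0 : ℝ) < N := lt_of_le_of_lt (by positivity) hN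
  set γ : ℝ → E := fun s => AffineMap.lineMap o p s with hγ
  have hγc : Continuous γ := AffineMap.lineMap_continuous
  have hK : ∀ s : ℝ, Convex ℝ (γ '' Icc 0 s) := fun s =>
    (convex_Icc 0 s).affine_image (AffineMap.lineMap o p)
  have hKc : ∀ s : ℝ, IsCompact (γ '' Icc 0 s) := fun s => isCompact_Icc.image hγc
  have hmem : ∀ s ∈ Icc (0 : ℝ) 1, γ s ∈ segment ℝ o p := by
    intro s hs
    rw [segment_eq_image_lineMap]
    exact ⟨s, hs, rfl⟩
  have ind : ∀ k : ℕ, k ≤ N → ∃ δ > 0, ∃ A,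
      HasJumpsOn α (Metric.thickening δ (γ '' Icc 0 (k / N : ℝ))) A := by
    intro k
    induction k with
    | zero =>
      intro _
      obtain ⟨i, hi⟩ := hleb (γ 0) (hmem 0 (by simp))
      refine ⟨ε, hε, α i, fun x hx => hU i i.2 x (hi ?_)⟩
      simpa using hx
    | succ k ih =>
      intro hk
      obtain ⟨δ, hδ, A, hA⟩ := ih (by omega)
      have hk1 : (k : ℝ) + 1 ≤ N := by exact_mod_cast hk
      have hs0 : (0 : ℝ) ≤ k / N := by positivity
      have hs : (k / N : ℝ) ∈ Icc (0 : ℝ) 1 := ⟨hs0, by rw [div_le_one hN0]; linarith⟩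
      obtain ⟨i, hi⟩ := hleb (γ (k / N)) (hmem _ hs)
      have hB : HasJumpsOn α (Metric.ball (γ (k / N)) ε) (α i) := fun x hx => hU i i.2 x (hi hx)
      obtain ⟨A', hA'⟩ := hA.union hB Metric.isOpen_thickening Metric.isOpen_ball
        (((hK _).thickening δ).inter (convex_ball _ _)).isPreconnected (o := γ (k / N))
        ⟨Metric.self_subset_thickening hδ _ (mem_image_of_mem γ ⟨hs0, le_rfl⟩),
          Metric.mem_ball_self hε⟩
      obtain ⟨δ', hδ', hsub⟩ := (hKc ((k + 1 : ℕ) / N)).exists_thickening_subset_open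
        (Metric.isOpen_thickening.union Metric.isOpen_ball) (by
          rintro _ ⟨s, ⟨hs0', hs1⟩, rfl⟩
          rcases le_or_gt s (k / N) with hle | hlt
          · exact Or.inl (Metric.self_subset_thickening hδ _
              (mem_image_of_mem γ (show s ∈ Icc 0 (k / N : ℝ) from ⟨hs0', hle⟩)))
          · right
            push_cast at hs1
            have : s - k / N ≤ 1 / N := by rw [add_div] at hs1; linarith
            calc dist (γ s) (γ (k / N)) = (s - k / N) * dist o p := by
                  simp only [hγ]
                  rw [dist_lineMap_lineMap, Real.dist_eq, abs_of_pos (sub_pos.2 hlt)]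
              _ ≤ 1 / N * dist o p := by gcongr
              _ < ε := by
                rw [div_lt_iff₀ hε] at hN
                rw [one_div, inv_mul_lt_iff₀ hN0]
                linarith)
      exact ⟨δ', hδ', A', fun x hx => hA' x (hsub hx)⟩
  have := ind N le_rfl
  rw [div_self hN0.ne'] at this
  rwa [segment_eq_image_lineMap]

/-- Over a convex open set, compatible local jumps are the jumps of a global function. Its value at
`x` is found by continuation along the segment from a base point to `x`. -/
theorem exists_hasJumpsOn_of_convex {α : E → E → G} {C : Set E} (hC : Convex ℝ C) (hCo : IsOpen C)
    (h : ∀ y ∈ C, ∀ᶠ p' in 𝓝 y, ∃ c, ∀ᶠ x in 𝓝 p', α y x = α p' x + c) :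
    ∃ A, HasJumpsOn α C A := by
  rcases C.eq_empty_or_nonempty with rfl | ⟨o, ho⟩
  · exact ⟨0, fun p hp => hp.elim⟩
  have hseg : ∀ p ∈ C, ∃ δ > 0, ∃ A, HasJumpsOn α (Metric.thickening δ (segment ℝ o p)) A :=
    fun p hp => exists_hasJumpsOn_segment fun y hy => h y (hC.segment_subset ho hp hy)
  choose! δ hδ A hA using hseg
  have hmem : ∀ p ∈ C, segment ℝ o p ⊆ Metric.thickening (δ p) (segment ℝ o p) := fun p hp =>
    Metric.self_subset_thickening (hδ p hp) _
  refine ⟨fun x => A x x - A x o, fun p hp => ?_⟩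
  obtain ⟨c, hc⟩ := hA p hp p (hmem p hp (right_mem_segment ℝ o p))
  refine ⟨c - A p o, ?_⟩
  filter_upwards [hc, hCo.mem_nhds hp, Metric.isOpen_thickening.mem_nhds
    (hmem p hp (right_mem_segment ℝ o p))] with x hx hxC hxp
  -- both thickened segments are convex and contain `o` and `x`
  have key := (hA x hxC).exists_eq_add (hA p hp) (W := Metric.thickening (δ x) (segment ℝ o x) ∩
      Metric.thickening (δ p) (segment ℝ o p)) inter_subset_left inter_subset_right
    (((convex_segment o x).thickening _).inter ((convex_segment o p).thickening _)).isPreconnected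
    (o := o) ⟨hmem x hxC (left_mem_segment ℝ o x), hmem p hp (left_mem_segment ℝ o p)⟩ x
    ⟨hmem x hxC (right_mem_segment ℝ o x), hxp⟩
  simp only [key, hx]
  abel

end Gluing

/-! ### Sheets as zero sets -/

/-- The cross product of `ℝ³`. -/
def cross (v w : E3) : E3 := WithLp.toLp 2 (crossProduct (WithLp.ofLp v) (WithLp.ofLp w))

/-- The image under `cross` of the standard basis of the plane: the oriented normal of the plane
parametrized by `L`. -/
def planeNormal (L : E2 →L[ℝ] E3) : E3 :=
  cross (L (EuclideanSpace.single 0 1)) (L (EuclideanSpace.single 1 1))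

theorem apply_eq_basis (L : E2 →L[ℝ] E3) (u : E2) :
    L u = u 0 • L (EuclideanSpace.single 0 1) + u 1 • L (EuclideanSpace.single 1 1) := by
  rw [← map_smul, ← map_smul, ← map_add]
  congr 1
  ext i
  fin_cases i <;> simp

theorem inner_planeNormal (L : E2 →L[ℝ] E3) (u : E2) : inner ℝ (planeNormal L) (L u) = 0 := by
  rw [apply_eq_basis L u, planeNormal, cross]
  generalize L (EuclideanSpace.single 0 1) = v
  generalize L (EuclideanSpace.single 1 1) = w
  simp only [EuclideanSpace.inner_eq_star_dotProduct, cross_apply]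
  simp [dotProduct, Fin.sum_univ_three]
  ring

theorem planeNormal_comp (L : E2 →L[ℝ] E3) (T : E2 →L[ℝ] E2) :
    planeNormal (L.comp T) = T.det • planeNormal L := by
  have hdet : T.det = (T (EuclideanSpace.single 0 1)) 0 * (T (EuclideanSpace.single 1 1)) 1
      - (T (EuclideanSpace.single 1 1)) 0 * (T (EuclideanSpace.single 0 1)) 1 := by
    rw [ContinuousLinearMap.det, ← LinearMap.det_toMatrix (EuclideanSpace.basisFun (Fin 2) ℝ).toBasis,
      Matrix.det_fin_two]
    simp [LinearMap.toMatrix_apply]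
  rw [planeNormal, planeNormal, ContinuousLinearMap.comp_apply, ContinuousLinearMap.comp_apply,
    apply_eq_basis L (T (EuclideanSpace.single 0 1)), apply_eq_basis L (T (EuclideanSpace.single 1 1)),
    hdet]
  generalize L (EuclideanSpace.single 0 1) = v
  generalize L (EuclideanSpace.single 1 1) = w
  ext i
  fin_cases i <;> simp [cross, cross_apply] <;> ring

theorem planeNormal_ne_zero {L : E2 →L[ℝ] E3} (hL : Function.Injective L) : planeNormal L ≠ 0 := by
  intro h
  have h1 : crossProduct (WithLp.ofLp (L (EuclideanSpace.single 0 1)))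
      (WithLp.ofLp (L (EuclideanSpace.single 1 1))) = 0 := by
    have := congrArg WithLp.ofLp h
    simpa [planeNormal, cross] using this
  refine crossProduct_ne_zero_iff_linearIndependent.2 ?_ h1
  rw [LinearIndependent.pair_iff]
  intro s t hst
  have : L (WithLp.toLp 2 ![s, t]) = L 0 := by
    rw [apply_eq_basis, map_zero]
    ext i
    simpa using congrFun hst i
  have h2 := hL this
  exact ⟨by simpa using congrArg (fun x : E2 => x 0) h2,
    by simpa using congrArg (fun x : E2 => x 1) h2⟩

theorem continuous_planeNormal : Continuous planeNormal := by
  unfold planeNormal cross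
  refine (PiLp.continuous_toLp 2 _).comp ?_
  refine continuous_pi fun i => ?_
  have : ∀ (e : E2) (i : Fin 3), Continuous fun L : E2 →L[ℝ] E3 => (L e) i := fun e i => by fun_prop
  fin_cases i <;> simp [cross_apply] <;> fun_prop

/-- The inverse function theorem between spaces of the same finite dimension, with the domain of the
local inverse inside a prescribed neighbourhood. -/
theorem exists_openPartialHomeomorph_of_injective {X Y : Type*} [NormedAddCommGroup X]
    [NormedSpace ℝ X] [NormedAddCommGroup Y] [NormedSpace ℝ Y] [FiniteDimensional ℝ X]
    [FiniteDimensional ℝ Y] (hdim : Module.finrank ℝ X = Module.finrank ℝ Y) {Φ : X → Y} {a : X}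
    (hΦ : ContDiffAt ℝ 1 Φ a) (hinj : Function.Injective (fderiv ℝ Φ a)) {S : Set X}
    (hS : S ∈ 𝓝 a) :
    ∃ ψ : OpenPartialHomeomorph X Y, ⇑ψ = Φ ∧ a ∈ ψ.source ∧ ψ.source ⊆ S ∧
      (∀ x ∈ ψ.source, ContDiffAt ℝ 1 Φ x) ∧ ∀ y ∈ ψ.target, ContDiffAt ℝ 1 ψ.symm y := by
  have := FiniteDimensional.complete ℝ X
  have h1 : (1 : WithTop ℕ∞) ≠ 0 := by simp
  let L : X ≃L[ℝ] Y :=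
    (LinearEquiv.ofInjectiveOfFinrankEq (fderiv ℝ Φ a).toLinearMap hinj hdim).toContinuousLinearEquiv
  have hL : HasFDerivAt Φ (L : X →L[ℝ] Y) a := by
    convert (hΦ.differentiableAt h1).hasFDerivAt using 1
    ext x
    rfl
  set ψ := hΦ.toOpenPartialHomeomorph Φ hL h1 with hψ
  have hψc : ⇑ψ = Φ := rfl
  have ha : a ∈ ψ.source := hΦ.mem_toOpenPartialHomeomorph_source hL h1
  have hsymm : ContDiffAt ℝ 1 ψ.symm (Φ a) := hΦ.to_localInverse hL h1
  set s : Set X := S ∩ {x | ContDiffAt ℝ 1 Φ x} ∩ {x | ContDiffAt ℝ 1 ψ.symm (Φ x)} with hs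
  have hsa : s ∈ 𝓝 a := by
    refine inter_mem (inter_mem hS (hΦ.eventually (by simp))) ?_
    exact hΦ.continuousAt.eventually (hsymm.eventually (by simp))
  refine ⟨ψ.restr s, by simpa using hψc, ?_, ?_, ?_, ?_⟩
  · rw [ψ.restr_source]
    exact ⟨ha, mem_interior_iff_mem_nhds.2 hsa⟩
  · rw [ψ.restr_source]
    exact fun x hx => (interior_subset hx.2).1.1
  · rw [ψ.restr_source]
    exact fun x hx => (interior_subset hx.2).1.2
  · intro y hy
    have hy' := (ψ.restr s).map_target hy
    rw [ψ.restr_source] at hy'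
    have h2 : Φ ((ψ.restr s).symm y) = y := (ψ.restr s).right_inv hy
    have h3 := (interior_subset hy'.2).2
    change ContDiffAt ℝ 1 ψ.symm (Φ ((ψ.restr s).symm y)) at h3
    rw [h2] at h3
    exact h3

/-- The derivative, in the direction of the surface, of a family `G` of parametrized surfaces. -/
def surfaceDeriv (G : ℝ × E2 → E3) (x : ℝ × E2) : E2 →L[ℝ] E3 :=
  (fderiv ℝ G x).comp (ContinuousLinearMap.inr ℝ ℝ E2)

theorem contDiffAt_thickening {G : ℝ × E2 → E3} (n : E3) {x : ℝ × (E2 × ℝ)}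
    (hG : ContDiffAt ℝ ∞ G (x.1, x.2.1)) :
    ContDiffAt ℝ ∞ (fun x : ℝ × (E2 × ℝ) => (x.1, G (x.1, x.2.1) + x.2.2 • n)) x := by
  have hp : ContDiff ℝ ∞ (fun x : ℝ × (E2 × ℝ) => (x.1, x.2.1)) := by fun_prop
  have h1 : ContDiffAt ℝ ∞ (fun x : ℝ × (E2 × ℝ) => G (x.1, x.2.1)) x :=
    ContDiffAt.comp (f := fun x : ℝ × (E2 × ℝ) => (x.1, x.2.1)) (g := G) x hG hp.contDiffAt
  exact contDiffAt_fst.prodMk (h1.add (by fun_prop))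

theorem fderiv_thickening {G : ℝ × E2 → E3} (n : E3) {x : ℝ × (E2 × ℝ)}
    (hG : DifferentiableAt ℝ G (x.1, x.2.1)) (y : ℝ × (E2 × ℝ)) :
    fderiv ℝ (fun x : ℝ × (E2 × ℝ) => (x.1, G (x.1, x.2.1) + x.2.2 • n)) x y
      = (y.1, fderiv ℝ G (x.1, x.2.1) (y.1, y.2.1) + y.2.2 • n) := by
  have h2 : HasFDerivAt (fun x : ℝ × (E2 × ℝ) => (x.1, x.2.1))
      ((ContinuousLinearMap.fst ℝ ℝ (E2 × ℝ)).prod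
        ((ContinuousLinearMap.fst ℝ E2 ℝ).comp (ContinuousLinearMap.snd ℝ ℝ (E2 × ℝ)))) x :=
    ((ContinuousLinearMap.fst ℝ ℝ (E2 × ℝ)).prod ((ContinuousLinearMap.fst ℝ E2 ℝ).comp
      (ContinuousLinearMap.snd ℝ ℝ (E2 × ℝ)))).hasFDerivAt
  have h3 : HasFDerivAt (fun x : ℝ × (E2 × ℝ) => x.2.2 • n)
      (((ContinuousLinearMap.snd ℝ E2 ℝ).comp
        (ContinuousLinearMap.snd ℝ ℝ (E2 × ℝ))).smulRight n) x :=
    (((ContinuousLinearMap.snd ℝ E2 ℝ).comp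
      (ContinuousLinearMap.snd ℝ ℝ (E2 × ℝ))).smulRight n).hasFDerivAt
  have h5 := HasFDerivAt.comp (f := fun x : ℝ × (E2 × ℝ) => (x.1, x.2.1)) (g := G) x
    hG.hasFDerivAt h2
  have h6 : HasFDerivAt (fun x : ℝ × (E2 × ℝ) => x.1) (ContinuousLinearMap.fst ℝ ℝ (E2 × ℝ)) x :=
    hasFDerivAt_fst
  have h4 := h6.prodMk (h5.add h3)
  erw [h4.fderiv]
  rfl

/-- A family of immersed parametrized surfaces is, near a point, the zero set of a function whose
spatial gradient is a positive multiple of the oriented normal. The function is the last coordinate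
of the local inverse of the parametrization thickened in the direction of a normal vector. -/
theorem exists_equation_of_parametrization {G : ℝ × E2 → E3} {D : Set (ℝ × E2)} (hDo : IsOpen D)
    (hG : ContDiffOn ℝ ∞ G D) {x₀ : ℝ × E2} (hx₀ : x₀ ∈ D)
    (hinj : Function.Injective (surfaceDeriv G x₀)) :
    ∃ (g : ℝ × E3 → ℝ) (V : Set (ℝ × E3)) (W : Set (ℝ × E2)), IsOpen V ∧ IsOpen W ∧ x₀ ∈ W ∧
      W ⊆ D ∧ ContDiffOn ℝ 1 g V ∧ (∀ y ∈ W, (y.1, G y) ∈ V ∧ g (y.1, G y) = 0 ∧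
        ∃ μ > 0, ∀ v, fderiv ℝ g (y.1, G y) (0, v)
          = μ * inner ℝ (planeNormal (surfaceDeriv G y)) v) ∧
      (∀ x ∈ V, g x = 0 → ∃ u, (x.1, u) ∈ W ∧ G (x.1, u) = x.2) ∧
      (∀ x ∈ V, ∃ u, (x.1, u) ∈ D) ∧ InjOn (fun y => (y.1, G y)) W := by
  have hGd : ∀ x ∈ D, DifferentiableAt ℝ G x := fun x hx =>
    (hG.contDiffAt (hDo.mem_nhds hx)).differentiableAt (by simp)
  have hPc : ContinuousOn (surfaceDeriv G) D :=
    (hG.continuousOn_fderiv_of_isOpen hDo (by simp)).clm_comp continuousOn_const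
  set n := planeNormal (surfaceDeriv G x₀) with hn
  have hn0 : n ≠ 0 := planeNormal_ne_zero hinj
  set Φ : ℝ × (E2 × ℝ) → ℝ × E3 := fun x => (x.1, G (x.1, x.2.1) + x.2.2 • n) with hΦ
  set p₀ : ℝ × (E2 × ℝ) := (x₀.1, (x₀.2, 0)) with hp₀
  set π : ℝ × (E2 × ℝ) → ℝ × E2 := fun x => (x.1, x.2.1) with hπ
  have hπc : Continuous π := by fun_prop
  set S : Set (ℝ × (E2 × ℝ)) := {x | π x ∈ D ∧
    0 < inner ℝ (planeNormal (surfaceDeriv G (π x))) n} with hS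
  have hSa : S ∈ 𝓝 p₀ := by
    refine inter_mem (hπc.continuousAt.eventually (hDo.mem_nhds hx₀)) ?_
    have h1 : ContinuousAt (surfaceDeriv G) (π p₀) := hPc.continuousAt (hDo.mem_nhds hx₀)
    have h2 : ContinuousAt (fun x => surfaceDeriv G (π x)) p₀ :=
      ContinuousAt.comp (f := π) h1 hπc.continuousAt
    have h4 : ContinuousAt (fun x => planeNormal (surfaceDeriv G (π x))) p₀ :=
      ContinuousAt.comp (g := planeNormal) continuous_planeNormal.continuousAt h2
    have h3 : ContinuousAt (fun x => inner ℝ (planeNormal (surfaceDeriv G (π x))) n) p₀ :=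
      h4.inner continuousAt_const
    refine h3.eventually (lt_mem_nhds ?_)
    change 0 < inner ℝ (planeNormal (surfaceDeriv G x₀)) n
    exact real_inner_self_pos.2 hn0
  have hΦd : ∀ x, π x ∈ D → ∀ y : ℝ × (E2 × ℝ), fderiv ℝ Φ x y
        = (y.1, fderiv ℝ G (x.1, x.2.1) (y.1, y.2.1) + y.2.2 • n) :=
    fun x hx y => fderiv_thickening n (hGd _ hx) y
  have hΦc : ∀ x, π x ∈ D → ContDiffAt ℝ ∞ Φ x := fun x hx =>
    contDiffAt_thickening n (hG.contDiffAt (hDo.mem_nhds hx))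
  have hinjΦ : Function.Injective (fderiv ℝ Φ p₀) := by
    rw [injective_iff_map_eq_zero]
    rintro ⟨τ, υ, ζ⟩ h
    rw [hΦd p₀ hx₀] at h
    obtain ⟨h0, h⟩ := Prod.mk.inj h
    change τ = 0 at h0
    subst h0
    have h1 : fderiv ℝ G x₀ (0, υ) = surfaceDeriv G x₀ υ := by simp [surfaceDeriv]
    change fderiv ℝ G x₀ (0, υ) + ζ • n = 0 at h
    rw [h1] at h
    have h2 := congrArg (inner ℝ n) h
    rw [inner_add_right, hn, inner_planeNormal, ← hn, inner_smul_right, inner_zero_right,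
      zero_add] at h2
    have hζ : ζ = 0 := by simpa [hn0] using h2
    rw [hζ, zero_smul, add_zero] at h
    have h3 : υ = 0 := hinj (by rw [h, map_zero])
    rw [h3, hζ]
    rfl
  obtain ⟨ψ, hψ, haψ, hψS, -, hψsymm⟩ := exists_openPartialHomeomorph_of_injective
    (by simp [E2, E3]) ((hΦc p₀ hx₀).of_le (by simp)) hinjΦ hSa
  have hright : ∀ x ∈ ψ.target, Φ (ψ.symm x) = x := by
    intro x hx
    have := ψ.right_inv hx
    rwa [hψ] at this
  have hfst : ∀ x ∈ ψ.target, (ψ.symm x).1 = x.1 := fun x hx => congrArg Prod.fst (hright x hx)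
  have hΦ0 : ∀ y : ℝ × E2, Φ (y.1, (y.2, 0)) = (y.1, G y) := by
    intro y
    simp [hΦ]
  set ι : ℝ × E2 → ℝ × (E2 × ℝ) := fun y => (y.1, (y.2, (0 : ℝ))) with hι
  have hWV : ∀ y ∈ ι ⁻¹' ψ.source, (y.1, G y) ∈ ψ.target ∧ ψ.symm (y.1, G y) = ι y := by
    intro y hy
    have h1 := ψ.map_source hy
    have h2 := ψ.left_inv hy
    rw [hψ, hΦ0] at h1 h2
    exact ⟨h1, h2⟩
  refine ⟨fun x => (ψ.symm x).2.2, ψ.target, ι ⁻¹' ψ.source, ψ.open_target,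
    ψ.open_source.preimage (by fun_prop), haψ, fun y hy => (hψS hy).1, ?_, ?_, ?_, ?_, ?_⟩
  · intro x hx
    exact (ContDiffAt.comp x (contDiffAt_snd.comp _ contDiffAt_snd)
      (hψsymm x hx)).contDiffWithinAt
  · intro y hy
    obtain ⟨hyV, hys⟩ := hWV y hy
    refine ⟨hyV, by simp [hys, hι], ?_⟩
    obtain ⟨hyD, hyn⟩ := hψS hy
    change y ∈ D at hyD
    change 0 < inner ℝ (planeNormal (surfaceDeriv G y)) n at hyn
    set N := planeNormal (surfaceDeriv G y) with hN
    set x := (y.1, G y) with hx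
    have hsd : HasFDerivAt ψ.symm (fderiv ℝ ψ.symm x) x :=
      ((hψsymm x hyV).differentiableAt (by simp)).hasFDerivAt
    have hgd : HasFDerivAt (fun x => (ψ.symm x).2.2)
        (((ContinuousLinearMap.snd ℝ E2 ℝ).comp (ContinuousLinearMap.snd ℝ ℝ (E2 × ℝ))).comp
          (fderiv ℝ ψ.symm x)) x :=
      ((ContinuousLinearMap.snd ℝ E2 ℝ).comp
        (ContinuousLinearMap.snd ℝ ℝ (E2 × ℝ))).hasFDerivAt.comp x hsd
    have hcomp : HasFDerivAt (Φ ∘ ψ.symm) ((fderiv ℝ Φ (ι y)).comp (fderiv ℝ ψ.symm x)) x := by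
      refine HasFDerivAt.comp x ?_ hsd
      rw [hys]
      exact ((hΦc (ι y) hyD).differentiableAt (by simp)).hasFDerivAt
    have hid : Φ ∘ ψ.symm =ᶠ[𝓝 x] id := by
      filter_upwards [ψ.open_target.mem_nhds hyV] with z hz using hright z hz
    have hid' := (hcomp.congr_of_eventuallyEq hid.symm).unique (hasFDerivAt_id x)
    refine ⟨(inner ℝ N n)⁻¹, by positivity, fun v => ?_⟩
    have h1 : fderiv ℝ Φ (ι y) (fderiv ℝ ψ.symm x (0, v)) = (0, v) :=
      congrArg (fun L : ℝ × E3 →L[ℝ] ℝ × E3 => L (0, v)) hid'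
    rw [hgd.fderiv]
    change (fderiv ℝ ψ.symm x (0, v)).2.2 = _
    rw [hΦd (ι y) hyD] at h1
    generalize fderiv ℝ ψ.symm x (0, v) = w at h1 ⊢
    obtain ⟨τ, υ, ζ⟩ := w
    obtain ⟨h1, h2⟩ := Prod.mk.inj h1
    change τ = 0 at h1
    subst h1
    change fderiv ℝ G y (0, υ) + ζ • n = v at h2
    have h3 : fderiv ℝ G y (0, υ) = surfaceDeriv G y υ := by simp [surfaceDeriv]
    rw [h3] at h2
    have h4 := congrArg (inner ℝ N) h2
    rw [inner_add_right, hN, inner_planeNormal, ← hN, inner_smul_right, zero_add] at h4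
    rw [← h4]
    change ζ = _
    field_simp
  · intro x hx hx0
    have h1 := ψ.map_target hx
    have h3 := hright x hx
    have h4 : ψ.symm x = ι (x.1, (ψ.symm x).2.1) := by
      rw [← hfst x hx]
      exact Prod.ext rfl (Prod.ext rfl hx0)
    refine ⟨(ψ.symm x).2.1, ?_, ?_⟩
    · change ι _ ∈ ψ.source
      rwa [← h4]
    · rw [h4] at h3
      have := hΦ0 (x.1, (ψ.symm x).2.1)
      exact congrArg Prod.snd (this.symm.trans h3)
  · intro x hx
    have := (hψS (ψ.map_target hx)).1
    refine ⟨(ψ.symm x).2.1, ?_⟩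
    rw [← hfst x hx]
    exact this
  · intro y hy y' hy' h
    have h1 := (hWV _ hy).2
    have h2 := (hWV _ hy').2
    simp only at h
    rw [h, h2] at h1
    exact (congrArg π h1).symm

section Surface

variable {M : Type*} [TopologicalSpace M] [ChartedSpace E2 M]

theorem conormal_eq_planeNormal (f : M → E3) (q : M) :
    conormal f q = planeNormal (differential f q) := rfl

/-- In any chart of an oriented atlas the differential is that of the parametrization up to an
orientation-preserving change of basis. By `planeNormal_comp` the conormal is then, up to a positive
factor, the oriented normal of the parametrization. -/
theorem exists_differential_eq_comp [IsManifold (𝓡 2) ∞ M] (hM : IsOrientedAtlas M) {f : M → E3}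
    (hf : ContMDiff (𝓡 2) 𝓘(ℝ, E3) ∞ f) {e : OpenPartialHomeomorph M E2} (he : e ∈ atlas E2 M)
    {q : M} (hq : q ∈ e.source) :
    (DifferentiableAt ℝ (f ∘ e.symm) (e q)) ∧
    ∃ T : E2 →L[ℝ] E2, 0 < T.det ∧
      differential f q = (fderiv ℝ (f ∘ e.symm) (e q)).comp T := by
  set e' := chartAt E2 q with he'
  have hq' : q ∈ e'.source := mem_chart_source E2 q
  have hd : ContMDiffOn 𝓘(ℝ, E2) 𝓘(ℝ, E3) ∞ (f ∘ e.symm) e.target :=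
    hf.comp_contMDiffOn (contMDiffOn_symm_of_mem_maximalAtlas
      (IsManifold.subset_maximalAtlas he))
  rw [contMDiffOn_iff_contDiffOn] at hd
  have hd' : DifferentiableAt ℝ (f ∘ e.symm) (e q) :=
    (hd.contDiffAt (e.open_target.mem_nhds (e.map_source hq))).differentiableAt (by simp)
  refine ⟨hd', fderiv ℝ (e'.symm.trans e) (e' q), ?_, ?_⟩
  · refine hM e' (chart_mem_atlas E2 q) e he (e' q) ?_
    simp [hq', hq]
  · have ht : ContMDiffOn 𝓘(ℝ, E2) 𝓘(ℝ, E2) ∞ (e'.symm.trans e) (e'.symm.trans e).source := by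
      have h1 : ContMDiffOn 𝓘(ℝ, E2) (𝓡 2) ∞ e'.symm e'.target :=
        contMDiffOn_symm_of_mem_maximalAtlas (IsManifold.chart_mem_maximalAtlas q)
      have h2 : ContMDiffOn (𝓡 2) 𝓘(ℝ, E2) ∞ e e.source :=
        contMDiffOn_of_mem_maximalAtlas (IsManifold.subset_maximalAtlas he)
      exact h2.comp (h1.mono fun x hx => by simp at hx; exact hx.1) (fun x hx => by
        simp at hx; exact hx.2)
    rw [contMDiffOn_iff_contDiffOn] at ht
    have hmem : e' q ∈ (e'.symm.trans e).source := by simp [hq', hq]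
    have ht' : DifferentiableAt ℝ (e'.symm.trans e) (e' q) :=
      (ht.contDiffAt ((e'.symm.trans e).open_source.mem_nhds hmem)).differentiableAt (by simp)
    have hval : (e'.symm.trans e) (e' q) = e q := by simp [hq']
    have hmf : MDifferentiableAt (𝓡 2) 𝓘(ℝ, E3) f q := hf.mdifferentiableAt (by simp)
    have : differential f q = fderiv ℝ (f ∘ e'.symm) (e' q) := by
      have h0 : differential f q = fderivWithin ℝ (writtenInExtChartAt (𝓡 2) 𝓘(ℝ, E3) q f)
          (range (𝓡 2)) (extChartAt (𝓡 2) q q) := hmf.mfderiv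
      rw [h0]
      simp [writtenInExtChartAt, extChartAt, he']
      rfl
    rw [this]
    have heq : f ∘ e'.symm =ᶠ[𝓝 (e' q)] (f ∘ e.symm) ∘ (e'.symm.trans e) := by
      filter_upwards [(e'.symm.trans e).open_source.mem_nhds hmem] with x hx
      simp at hx
      simp [hx.2]
    rw [heq.fderiv_eq, fderiv_comp _ (by rw [hval]; exact hd') ht', hval]

/-- The homotopy read in a chart. -/
theorem contDiffOn_homotopy_chart [IsManifold (𝓡 2) ∞ M] {F : ℝ → M → E3} {a b : ℝ}
    (hF : IsRegularHomotopy F a b) {e : OpenPartialHomeomorph M E2} (he : e ∈ atlas E2 M) :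
    ContDiffOn ℝ ∞ (fun x : ℝ × E2 => F x.1 (e.symm x.2)) (Ioo a b ×ˢ e.target) := by
  rw [← contMDiffOn_iff_contDiffOn]
  have h1 : ContMDiffOn 𝓘(ℝ, ℝ × E2) (𝓘(ℝ, ℝ).prod (𝓡 2)) ∞
      (fun x : ℝ × E2 => (x.1, e.symm x.2)) (Ioo a b ×ˢ e.target) := by
    refine ContMDiffOn.prodMk (contDiff_fst.contMDiff.contMDiffOn) ?_
    exact (contMDiffOn_symm_of_mem_maximalAtlas (IsManifold.subset_maximalAtlas he)).comp
      contDiff_snd.contMDiff.contMDiffOn (fun x hx => hx.2)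
  exact hF.1.comp h1 (fun x hx => ⟨hx.1, mem_univ _⟩)

/-- A cooriented equation `g = 0`, near a point of space-time, of one sheet of the track of the
homotopy `F`: the zero set of `g` in `V` is the injective image of the set `W` of points of
`ℝ × M`, and the spatial gradient of `g` is a positive multiple of the conormal. -/
structure IsSheetEquation (F : ℝ → M → E3) (g : ℝ × E3 → ℝ) (W : Set (ℝ × M))
    (V : Set (ℝ × E3)) : Prop where
  isOpen : IsOpen W
  contDiffOn : ContDiffOn ℝ 1 g V
  mapsTo : ∀ y ∈ W, (y.1, F y.1 y.2) ∈ V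
  zero : ∀ y ∈ W, g (y.1, F y.1 y.2) = 0
  exists_of_zero : ∀ x ∈ V, g x = 0 → ∃ r, (x.1, r) ∈ W ∧ F x.1 r = x.2
  inj : ∀ t r r', (t, r) ∈ W → (t, r') ∈ W → F t r = F t r' → r = r'
  grad : ∀ y ∈ W, ∃ μ > 0, ∀ v, fderiv ℝ g (y.1, F y.1 y.2) (0, v)
    = μ * inner ℝ (conormal (F y.1) y.2) v

theorem exists_isSheetEquation [IsManifold (𝓡 2) ∞ M] (hM : IsOrientedAtlas M) {F : ℝ → M → E3}
    {a b : ℝ} (hF : IsRegularHomotopy F a b) {t₀ : ℝ} (ht₀ : t₀ ∈ Ioo a b) (q : M)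
    {O : Set (ℝ × M)} (hO : IsOpen O) (hqO : (t₀, q) ∈ O) :
    ∃ g W V, IsOpen V ∧ (t₀, q) ∈ W ∧ W ⊆ O ∧ V ⊆ Ioo a b ×ˢ univ ∧
      IsSheetEquation F g W V := by
  set e := chartAt E2 q with he_def
  have he : e ∈ atlas E2 M := chart_mem_atlas E2 q
  have hqe : q ∈ e.source := mem_chart_source E2 q
  set G : ℝ × E2 → E3 := fun x => F x.1 (e.symm x.2) with hG_def
  set D : Set (ℝ × E2) := Ioo a b ×ˢ e.target ∩ (fun x : ℝ × E2 => (x.1, e.symm x.2)) ⁻¹' O with hD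
  have hDo : IsOpen D := by
    refine ContinuousOn.isOpen_inter_preimage ?_ (isOpen_Ioo.prod e.open_target) hO
    refine continuousOn_fst.prodMk ?_
    exact e.symm.continuousOn.comp continuousOn_snd fun y hy => hy.2
  have hG : ContDiffOn ℝ ∞ G D := (contDiffOn_homotopy_chart hF he).mono inter_subset_left
  have hGd : ∀ x ∈ D, HasFDerivAt G (fderiv ℝ G x) x := fun x hx =>
    ((hG.contDiffAt (hDo.mem_nhds hx)).differentiableAt (by simp)).hasFDerivAt
  have hPeq : ∀ x ∈ D, surfaceDeriv G x = fderiv ℝ (F x.1 ∘ e.symm) x.2 := by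
    intro x hx
    have h1 : HasFDerivAt (fun u : E2 => (x.1, u)) (ContinuousLinearMap.inr ℝ ℝ E2) x.2 :=
      hasFDerivAt_prodMk_right x.1 x.2
    have h2 : HasFDerivAt (F x.1 ∘ e.symm) (surfaceDeriv G x) x.2 :=
      HasFDerivAt.comp (f := fun u : E2 => (x.1, u)) (g := G) x.2 (hGd x hx) h1
    exact h2.fderiv.symm
  have hcon : ∀ t ∈ Ioo a b, ∀ r ∈ e.source, (t, e r) ∈ D → ∃ c : ℝ, 0 < c ∧
      conormal (F t) r = c • planeNormal (surfaceDeriv G (t, e r)) := by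
    intro t ht r hr htr
    obtain ⟨_, T, hT, hTeq⟩ := exists_differential_eq_comp hM (hF.2 t ht).1 he hr
    refine ⟨T.det, hT, ?_⟩
    rw [conormal_eq_planeNormal, hTeq, planeNormal_comp, hPeq _ htr]
  have hx₀ : (t₀, e q) ∈ D := ⟨⟨ht₀, e.map_source hqe⟩, by simpa [hqe] using hqO⟩
  have hPinj : Function.Injective (surfaceDeriv G (t₀, e q)) := by
    obtain ⟨_, T, hT, hTeq⟩ := exists_differential_eq_comp hM (hF.2 t₀ ht₀).1 he hqe
    have hinj := (hF.2 t₀ ht₀).2 q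
    rw [hTeq, ← hPeq _ hx₀] at hinj
    have hTi : Function.Injective T :=
      Function.Injective.of_comp (f := surfaceDeriv G (t₀, e q)) hinj
    have hTs : Function.Surjective T :=
      LinearMap.injective_iff_surjective (f := T.toLinearMap).1 hTi
    intro u v huv
    obtain ⟨u, rfl⟩ := hTs u
    obtain ⟨v, rfl⟩ := hTs v
    exact congrArg T (hinj huv)
  obtain ⟨g, V, W, hV, hW, hxW, hWD, hg, hWV, hzero, hVD, hinj⟩ :=
    exists_equation_of_parametrization hDo hG hx₀ hPinj
  have hGF : ∀ t, ∀ r ∈ e.source, G (t, e r) = F t r := by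
    intro t r hr
    simp [hG_def, hr]
  refine ⟨g, (univ ×ˢ e.source) ∩ (fun y : ℝ × M => (y.1, e y.2)) ⁻¹' W, V, hV,
    ⟨⟨mem_univ _, hqe⟩, hxW⟩, ?_, ?_, ?_, hg, ?_, ?_, ?_, ?_, ?_⟩
  · intro y hy
    have := (hWD hy.2).2
    simpa [hy.1.2] using this
  · intro x hx
    obtain ⟨u, hu⟩ := hVD x hx
    exact ⟨hu.1.1, mem_univ _⟩
  · refine ContinuousOn.isOpen_inter_preimage ?_ (isOpen_univ.prod e.open_source) hW
    refine continuousOn_fst.prodMk ?_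
    exact e.continuousOn.comp continuousOn_snd fun y hy => hy.2
  · intro y hy
    have := (hWV _ hy.2).1
    rwa [hGF _ _ hy.1.2] at this
  · intro y hy
    have := (hWV _ hy.2).2.1
    rwa [hGF _ _ hy.1.2] at this
  · intro x hx hx0
    obtain ⟨u, hu, hu'⟩ := hzero x hx hx0
    have h5 : u ∈ e.target := (hWD hu).1.2
    refine ⟨e.symm u, ⟨⟨mem_univ _, e.map_target h5⟩, ?_⟩, hu'⟩
    simpa [e.right_inv h5] using hu
  · intro t r r' hr hr' h
    have := hinj hr.2 hr'.2 (by simp only [hGF _ _ hr.1.2, hGF _ _ hr'.1.2, h])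
    exact e.injOn hr.1.2 hr'.1.2 (congrArg Prod.snd this)
  · intro y hy
    obtain ⟨μ, hμ, h⟩ := (hWV _ hy.2).2.2
    obtain ⟨c, hc, hceq⟩ := hcon y.1 (hWD hy.2).1.1 y.2 hy.1.2 (hWD hy.2)
    refine ⟨μ / c, by positivity, fun v => ?_⟩
    have h' := h v
    simp only [hGF _ _ hy.1.2] at h'
    rw [h', hceq, real_inner_smul_left]
    field_simp

end Surface

/-! ### The sheets near a point of space-time -/

section Calculus

variable {X : Type*} [NormedAddCommGroup X] [NormedSpace ℝ X]

theorem lt_add_smul_of_fderiv_pos {g : X → ℝ} {B : Set X} {w : X} (hB : Convex ℝ B)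
    (hd : ∀ x ∈ B, DifferentiableAt ℝ g x) (hpos : ∀ x ∈ B, 0 < fderiv ℝ g x w) {y : X} {s : ℝ}
    (hs : 0 < s) (hy : y ∈ B) (hys : y + s • w ∈ B) : g y < g (y + s • w) := by
  have hmem : ∀ τ ∈ Icc 0 s, y + τ • w ∈ B := by
    intro τ hτ
    have := hB.add_smul_mem hy hys (t := τ / s)
      ⟨div_nonneg hτ.1 hs.le, (div_le_one hs).2 hτ.2⟩
    rwa [smul_smul, div_mul_cancel₀ _ hs.ne'] at this
  have hder : ∀ τ ∈ Icc 0 s, HasDerivAt (fun τ : ℝ => g (y + τ • w))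
      (fderiv ℝ g (y + τ • w) w) τ := by
    intro τ hτ
    have h1 : HasDerivAt (fun τ : ℝ => y + τ • w) w τ := by
      simpa using ((hasDerivAt_id τ).smul_const w).const_add y
    exact (hd _ (hmem τ hτ)).hasFDerivAt.comp_hasDerivAt τ h1
  have hmono : StrictMonoOn (fun τ : ℝ => g (y + τ • w)) (Icc 0 s) := by
    refine strictMonoOn_of_deriv_pos (convex_Icc 0 s)
      (fun τ hτ => (hder τ hτ).continuousAt.continuousWithinAt) ?_
    intro τ hτ
    rw [interior_Icc] at hτ
    rw [(hder τ (Ioo_subset_Icc_self hτ)).deriv]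
    exact hpos _ (hmem τ (Ioo_subset_Icc_self hτ))
  simpa using hmono (left_mem_Icc.2 hs.le) (right_mem_Icc.2 hs.le) hs

/-- A zero of `h` is found by following the direction `w` backwards from a point where `g` is positive
down to the zero set of `g`; the function `h` increases on the way back. -/
theorem eventually_pos_imp_of_zero_imp {g h : X → ℝ} {x₀ w : X} (hg : ContDiffAt ℝ 1 g x₀)
    (hh : ContDiffAt ℝ 1 h x₀) (hg0 : g x₀ = 0) (hgw : 0 < fderiv ℝ g x₀ w)
    (hhw : 0 < fderiv ℝ h x₀ w) (hz : ∀ᶠ x in 𝓝 x₀, g x = 0 → h x = 0) :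
    ∀ᶠ x in 𝓝 x₀, 0 < g x → 0 < h x := by
  have key : ∀ {g : X → ℝ}, ContDiffAt ℝ 1 g x₀ → 0 < fderiv ℝ g x₀ w →
      ∀ᶠ x in 𝓝 x₀, DifferentiableAt ℝ g x ∧ 0 < fderiv ℝ g x w := by
    intro g hg hgw
    have h1 : ∀ᶠ x in 𝓝 x₀, DifferentiableAt ℝ g x :=
      (hg.eventually (by simp)).mono fun x hx => hx.differentiableAt (by simp)
    have h2 : ContinuousAt (fun x => fderiv ℝ g x w) x₀ :=
      (hg.continuousAt_fderiv (by simp)).clm_apply continuousAt_const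
    exact h1.and (h2.eventually (lt_mem_nhds hgw))
  obtain ⟨r, hr, hB⟩ := Metric.eventually_nhds_iff_ball.1 ((key hg hgw).and ((key hh hhw).and hz))
  have hcv := convex_ball x₀ r
  -- a small step in the direction `-w`
  obtain ⟨ε, hε, hεB⟩ : ∃ ε > (0 : ℝ), x₀ + (-ε) • w ∈ Metric.ball x₀ r := by
    have hc : ContinuousAt (fun ε : ℝ => x₀ + (-ε) • w) 0 := by fun_prop
    have h0 : ∀ᶠ ε : ℝ in 𝓝 0, x₀ + (-ε) • w ∈ Metric.ball x₀ r :=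
      hc.eventually (Metric.isOpen_ball.mem_nhds (by simpa using hr))
    have h1 : ∀ᶠ ε : ℝ in 𝓝[>] 0, x₀ + (-ε) • w ∈ Metric.ball x₀ r := nhdsWithin_le_nhds h0
    obtain ⟨ε, hε0, hε⟩ := (h1.and self_mem_nhdsWithin).exists
    exact ⟨ε, hε, hε0⟩
  have hneg : g (x₀ + (-ε) • w) < 0 := by
    rw [← hg0]
    have := lt_add_smul_of_fderiv_pos hcv (fun x hx => (hB x hx).1.1) (fun x hx => (hB x hx).1.2)
      hε hεB (by simpa [neg_smul, add_assoc] using hr)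
    simpa [neg_smul, add_assoc] using this
  have hc : ContinuousAt (fun x : X => x + (-ε) • w) x₀ := by fun_prop
  have hgc : ContinuousAt (fun x : X => g (x + (-ε) • w)) x₀ :=
    ContinuousAt.comp (f := fun x : X => x + (-ε) • w) (hB _ hεB).1.1.continuousAt hc
  filter_upwards [hgc.eventually (gt_mem_nhds hneg),
    hc.eventually (Metric.isOpen_ball.mem_nhds hεB), Metric.ball_mem_nhds x₀ hr] with x hx1 hx2 hx3
  intro hgx
  have hmem : ∀ τ ∈ Icc (0 : ℝ) ε, x + (-τ) • w ∈ Metric.ball x₀ r := by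
    intro τ hτ
    have := hcv.add_smul_mem hx3 hx2 (t := τ / ε)
      ⟨div_nonneg hτ.1 hε.le, (div_le_one hε).2 hτ.2⟩
    rw [smul_smul] at this
    convert this using 3
    field_simp
  have hcont : ContinuousOn (fun τ : ℝ => g (x + (-τ) • w)) (Icc 0 ε) := by
    intro τ hτ
    have h1 : ContinuousAt (fun τ : ℝ => x + (-τ) • w) τ := by fun_prop
    exact (ContinuousAt.comp (f := fun τ : ℝ => x + (-τ) • w)
      (hB _ (hmem τ hτ)).1.1.continuousAt h1).continuousWithinAt
  obtain ⟨τ, hτ, hτ0⟩ := intermediate_value_Icc' hε.le hcont ⟨hx1.le, by simpa using hgx.le⟩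
  have hτpos : 0 < τ := by
    rcases hτ.1.eq_or_lt with rfl | h
    · simp at hτ0; linarith
    · exact h
  have h1 := (hB _ (hmem τ hτ)).2.2 hτ0
  have h2 := lt_add_smul_of_fderiv_pos hcv (fun x hx => (hB x hx).2.1.1)
    (fun x hx => (hB x hx).2.1.2) hτpos (hmem τ hτ) (by simpa using hx3)
  rw [h1] at h2
  simpa using h2

end Calculus

section Surface

variable {M : Type*} [TopologicalSpace M] [ChartedSpace E2 M]

theorem IsRegularHomotopy.continuousOn {F : ℝ → M → E3} {a b : ℝ} (hF : IsRegularHomotopy F a b) :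
    ContinuousOn (fun y : ℝ × M => F y.1 y.2) (Ioo a b ×ˢ univ) := hF.1.continuousOn

/-- Compactness of the surface: near `(t₀, p)` no further sheets appear. -/
theorem eventually_fiber_subset [CompactSpace M] {F : ℝ → M → E3} {a b : ℝ}
    (hF : IsRegularHomotopy F a b) {t₀ : ℝ} (ht₀ : t₀ ∈ Ioo a b) {p : E3} {O : Set (ℝ × M)}
    (hO : ∀ r, F t₀ r = p → O ∈ 𝓝 (t₀, r)) :
    ∀ᶠ x in 𝓝 (t₀, p), ∀ r, F x.1 r = x.2 → (x.1, r) ∈ O := by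
  have h := isCompact_univ.eventually_forall_of_forall_eventually (X := ℝ × E3) (Y := M)
    (x₀ := (t₀, p)) (P := fun x r => F x.1 r = x.2 → (x.1, r) ∈ O) ?_
  · filter_upwards [h] with x hx r using hx r (mem_univ _)
  · intro r _
    have hc1 : ContinuousAt (fun z : (ℝ × E3) × M => (z.1.1, z.2)) ((t₀, p), r) := by fun_prop
    by_cases hr : F t₀ r = p
    · filter_upwards [hc1.eventually (hO r hr)] with z hz _ using hz
    · have hc2 : ContinuousAt (fun z : (ℝ × E3) × M => F z.1.1 z.2) ((t₀, p), r) :=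
        ContinuousAt.comp (f := fun z : (ℝ × E3) × M => (z.1.1, z.2))
          (hF.continuousOn.continuousAt ((isOpen_Ioo.prod isOpen_univ).mem_nhds ⟨ht₀, mem_univ _⟩))
          hc1
      have hc3 : ContinuousAt (fun z : (ℝ × E3) × M => z.1.2) ((t₀, p), r) := by fun_prop
      filter_upwards [(hc2.prodMk hc3).eventually (isClosed_diagonal.isOpen_compl.mem_nhds hr)]
        with z hz' using fun h => absurd h hz'

/-- Equations `g i` of all the sheets of the track of `F` in a neighbourhood `V` of the point
`(t₀, p)` of space-time. The sheets are indexed by the preimages `pt i` of `p`. -/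
structure IsLocalModel {ι : Type*} (F : ℝ → M → E3) (t₀ : ℝ) (p : E3) (pt : ι → M)
    (g : ι → ℝ × E3 → ℝ) (W : ι → Set (ℝ × M)) (V : Set (ℝ × E3)) : Prop where
  finite : Finite ι
  isOpen : IsOpen V
  mem : (t₀, p) ∈ V
  injective : Function.Injective pt
  range_eq : range pt = F t₀ ⁻¹' {p}
  sheet : ∀ i, IsSheetEquation F (g i) (W i) V
  mem_sheet : ∀ i, (t₀, pt i) ∈ W i
  disjoint : Pairwise (Function.onFun Disjoint W)
  cover : ∀ t r, (t, F t r) ∈ V → ∃ i, (t, r) ∈ W i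

/-- A sheet equation may be restricted to a smaller open set of space-time. -/
theorem IsSheetEquation.mono {F : ℝ → M → E3} {a b : ℝ} (hF : IsRegularHomotopy F a b)
    {g : ℝ × E3 → ℝ} {W : Set (ℝ × M)} {V V' : Set (ℝ × E3)} (h : IsSheetEquation F g W V)
    (hVab : V ⊆ Ioo a b ×ˢ univ) (hV' : IsOpen V') (hsub : V' ⊆ V) :
    IsSheetEquation F g (W ∩ (fun y => (y.1, F y.1 y.2)) ⁻¹' V') V' where
  isOpen := by
    refine ContinuousOn.isOpen_inter_preimage ?_ h.isOpen hV'
    refine continuousOn_fst.prodMk (hF.continuousOn.mono fun y hy => ⟨?_, mem_univ _⟩)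
    exact (hVab (h.mapsTo y hy)).1
  contDiffOn := h.contDiffOn.mono hsub
  mapsTo y hy := hy.2
  zero y hy := h.zero y hy.1
  exists_of_zero x hx hx0 := by
    obtain ⟨r, hr, hr'⟩ := h.exists_of_zero x (hsub hx) hx0
    exact ⟨r, ⟨hr, by simpa [hr'] using hx⟩, hr'⟩
  inj t r r' hr hr' := h.inj t r r' hr.1 hr'.1
  grad y hy := h.grad y hy.1

/-- An immersion is locally injective, so the fibres are discrete and compact. -/
theorem finite_fiber [IsManifold (𝓡 2) ∞ M] [CompactSpace M] (hM : IsOrientedAtlas M)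
    {F : ℝ → M → E3} {a b : ℝ} (hF : IsRegularHomotopy F a b) {t₀ : ℝ} (ht₀ : t₀ ∈ Ioo a b)
    (p : E3) : (F t₀ ⁻¹' {p}).Finite := by
  have hc : IsCompact (F t₀ ⁻¹' {p}) :=
    (isClosed_singleton.preimage (hF.2 t₀ ht₀).1.continuous).isCompact
  have hloc : ∀ q ∈ F t₀ ⁻¹' {p}, ∃ N ∈ 𝓝 q, ∀ r ∈ N, F t₀ r = p → r = q := by
    intro q hq
    obtain ⟨g, W, V, -, hqW, -, -, hg⟩ :=
      exists_isSheetEquation hM hF ht₀ q isOpen_univ (mem_univ _)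
    refine ⟨(fun r => (t₀, r)) ⁻¹' W, (hg.isOpen.preimage (by fun_prop)).mem_nhds hqW, ?_⟩
    intro r hr hrp
    exact hg.inj t₀ r q hr hqW (hrp.trans hq.symm)
  choose! N hN hN' using hloc
  obtain ⟨s, hs, hcov⟩ := hc.elim_nhds_subcover N hN
  refine s.finite_toSet.subset fun r hr => ?_
  obtain ⟨q, hq, hrq⟩ := mem_iUnion₂.1 (hcov hr)
  rw [hN' q (hs q hq) r hrq hr]
  exact hq

theorem exists_isLocalModel [IsManifold (𝓡 2) ∞ M] [CompactSpace M] [T2Space M]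
    (hM : IsOrientedAtlas M) {F : ℝ → M → E3} {a b : ℝ} (hF : IsRegularHomotopy F a b) {t₀ : ℝ}
    (ht₀ : t₀ ∈ Ioo a b) (p : E3) {ι : Type*} {pt : ι → M} (hinj : Function.Injective pt)
    (hpt : range pt = F t₀ ⁻¹' {p}) :
    ∃ g W V, V ⊆ Ioo a b ×ˢ univ ∧ IsLocalModel F t₀ p pt g W V := by
  have hfin : (range pt).Finite := hpt ▸ finite_fiber hM hF ht₀ p
  have : Finite ι := (Set.finite_range_iff hinj).1 hfin
  obtain ⟨U, hU, hUd⟩ := hfin.t2_separation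
  have hpti : ∀ i, F t₀ (pt i) = p := fun i => by
    have : pt i ∈ F t₀ ⁻¹' {p} := hpt ▸ mem_range_self i
    exact this
  choose g W V hVo hqW hWU hVab hg using fun i => exists_isSheetEquation hM hF ht₀ (pt i)
    (O := univ ×ˢ U (pt i)) (isOpen_univ.prod (hU _).2) ⟨mem_univ _, (hU _).1⟩
  have htube := eventually_fiber_subset hF ht₀ (p := p) (O := ⋃ i, W i) (by
    intro r hr
    have : r ∈ range pt := by rw [hpt]; exact hr
    obtain ⟨i, rfl⟩ := this
    exact mem_of_superset ((hg i).isOpen.mem_nhds (hqW i)) (subset_iUnion W i))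
  have hab : ∀ᶠ x in 𝓝 (t₀, p), x ∈ Ioo a b ×ˢ (univ : Set E3) :=
    (isOpen_Ioo.prod isOpen_univ).mem_nhds ⟨ht₀, mem_univ _⟩
  have hV : ∀ᶠ x in 𝓝 (t₀, p), ∀ i, x ∈ V i := by
    rw [eventually_all]
    intro i
    have := (hg i).mapsTo _ (hqW i)
    rw [hpti] at this
    exact (hVo i).mem_nhds this
  obtain ⟨V', hV', hV'o, hpV'⟩ := eventually_nhds_iff.1 (htube.and (hab.and hV))
  refine ⟨g, fun i => W i ∩ (fun y => (y.1, F y.1 y.2)) ⁻¹' V', V', fun x hx => (hV' x hx).2.1, ?_⟩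
  refine ⟨this, hV'o, hpV', hinj, hpt, fun i => (hg i).mono hF (hVab i) hV'o
    fun x hx => (hV' x hx).2.2 i, fun i => ⟨hqW i, ?_⟩, ?_, ?_⟩
  · simpa [hpti] using hpV'
  · intro i j hij
    refine Set.disjoint_left.2 fun y hyi hyj => ?_
    exact Set.disjoint_left.1 (hUd (mem_range_self i) (mem_range_self j) (hinj.ne hij))
      (hWU i hyi.1).2 (hWU j hyj.1).2
  · intro t r hr
    obtain ⟨i, hi⟩ := mem_iUnion.1 ((hV' _ hr).1 r rfl)
    exact ⟨i, hi, hr⟩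

namespace IsLocalModel

variable {ι : Type*} {F : ℝ → M → E3} {t₀ : ℝ} {p : E3} {pt : ι → M}
  {g : ι → ℝ × E3 → ℝ} {W : ι → Set (ℝ × M)} {V : Set (ℝ × E3)}

theorem eq_of_mem (h : IsLocalModel F t₀ p pt g W V) {i j : ι} {y : ℝ × M} (hi : y ∈ W i)
    (hj : y ∈ W j) : i = j := by
  by_contra hij
  exact Set.disjoint_left.1 (h.disjoint hij) hi hj

theorem apply_pt (h : IsLocalModel F t₀ p pt g W V) (i : ι) : F t₀ (pt i) = p := by
  have : pt i ∈ F t₀ ⁻¹' {p} := h.range_eq ▸ mem_range_self i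
  exact this

/-- The preimages of a point `x` near the centre of a local model are in bijection with the sheets
of the model through `x`. -/
theorem exists_equiv_fiber (h : IsLocalModel F t₀ p pt g W V) {x : ℝ × E3} (hx : x ∈ V) :
    ∃ e : {i // g i x = 0} ≃ F x.1 ⁻¹' {x.2}, ∀ i : {i // g i x = 0}, (x.1, (e i : M)) ∈ W i.1 := by
  choose r hr hr' using fun i : {i // g i x = 0} => (h.sheet i).exists_of_zero x hx i.2
  refine ⟨Equiv.ofBijective (fun i => ⟨r i, hr' i⟩) ⟨?_, ?_⟩, hr⟩
  · intro i j hij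
    have : r i = r j := congrArg Subtype.val hij
    exact Subtype.ext (h.eq_of_mem (hr i) (this ▸ hr j))
  · rintro ⟨s, hs⟩
    have hs' : F x.1 s = x.2 := hs
    have hxs : (x.1, F x.1 s) = x := by rw [hs']
    obtain ⟨i, hi⟩ := h.cover x.1 s (by rwa [hxs])
    have hi0 := (h.sheet i).zero _ hi
    simp only [hxs] at hi0
    refine ⟨⟨i, hi0⟩, Subtype.ext ?_⟩
    exact (h.sheet i).inj x.1 _ _ (hr ⟨i, hi0⟩) hi ((hr' ⟨i, hi0⟩).trans hs'.symm)

end IsLocalModel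

/-- The number of sheets, among those of equations `g i`, of which `x` is on the positive side. -/
def sideCount {ι X : Type*} (g : ι → X → ℝ) (x : X) : ℚ := ({i | 0 < g i x}.ncard : ℚ)

theorem conormal_ne_zero {f : M → E3} {q : M} (h : Function.Injective (differential f q)) :
    conormal f q ≠ 0 := planeNormal_ne_zero h

/-- The local numberings at two neighbouring points differ by a constant. -/
theorem IsLocalModel.eventually_sideCount_eq [CompactSpace M] {a b : ℝ} {F : ℝ → M → E3}
    (hF : IsRegularHomotopy F a b)
    {ι : Type*} {t₀ : ℝ} {p : E3} {pt : ι → M} {g : ι → ℝ × E3 → ℝ} {W : ι → Set (ℝ × M)}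
    {V : Set (ℝ × E3)} (h : IsLocalModel F t₀ p pt g W V)
    {ι' : Type*} {t₁ : ℝ} {p' : E3} {pt' : ι' → M} {g' : ι' → ℝ × E3 → ℝ}
    {W' : ι' → Set (ℝ × M)} {V' : Set (ℝ × E3)} (h' : IsLocalModel F t₁ p' pt' g' W' V')
    (ht₁ : t₁ ∈ Ioo a b) (hV : (t₁, p') ∈ V) :
    ∃ c, ∀ᶠ x in 𝓝 (t₁, p'), sideCount g x = sideCount g' x + c := by
  have := h.finite
  have := h'.finite
  obtain ⟨e, he⟩ := h.exists_equiv_fiber hV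
  let e' : ι' ≃ F t₁ ⁻¹' {p'} :=
    (Equiv.ofInjective pt' h'.injective).trans (Equiv.setCongr h'.range_eq)
  -- the sheet of the first model that contains a given sheet of the second
  let φ : ι' → ι := fun k => (e.symm (e' k)).1
  have hφinj : Function.Injective φ :=
    Subtype.val_injective.comp (e.symm.injective.comp e'.injective)
  have hφW : ∀ k, (t₁, pt' k) ∈ W (φ k) := by
    intro k
    have := he (e.symm (e' k))
    rw [e.apply_symm_apply] at this
    exact this
  have hφ0 : ∀ k, g (φ k) (t₁, p') = 0 := fun k => (e.symm (e' k)).2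
  have hφsurj : ∀ i, g i (t₁, p') = 0 → ∃ k, φ k = i := by
    intro i hi
    refine ⟨e'.symm (e ⟨i, hi⟩), ?_⟩
    simp [φ]
  have hVn : ∀ᶠ x in 𝓝 (t₁, p'), x ∈ V ∧ x ∈ V' :=
    inter_mem (h.isOpen.mem_nhds hV) (h'.isOpen.mem_nhds h'.mem)
  have htube := eventually_fiber_subset hF ht₁ (p := p') (O := ⋃ k, W' k ∩ W (φ k)) (by
    intro r hr
    have hr' : r ∈ range pt' := by rw [h'.range_eq]; exact hr
    obtain ⟨k, rfl⟩ := hr'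
    exact mem_of_superset (inter_mem ((h'.sheet k).isOpen.mem_nhds (h'.mem_sheet k))
      ((h.sheet _).isOpen.mem_nhds (hφW k))) (subset_iUnion (fun k => W' k ∩ W (φ k)) k))
  -- the two equations of a common sheet have the same zeros, hence the same sign
  have hzero : ∀ᶠ x in 𝓝 (t₁, p'), ∀ k, g (φ k) x = 0 ↔ g' k x = 0 := by
    filter_upwards [htube, hVn] with x hx hxV k
    constructor
    · intro h0
      obtain ⟨r, hr, hrx⟩ := (h.sheet _).exists_of_zero x hxV.1 h0
      obtain ⟨k', hk'⟩ := mem_iUnion.1 (hx r hrx)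
      obtain rfl : k' = k := hφinj (h.eq_of_mem hk'.2 hr)
      have := (h'.sheet _).zero _ hk'.1
      simpa [hrx] using this
    · intro h0
      obtain ⟨r, hr, hrx⟩ := (h'.sheet _).exists_of_zero x hxV.2 h0
      obtain ⟨k', hk'⟩ := mem_iUnion.1 (hx r hrx)
      obtain rfl : k' = k := h'.eq_of_mem hk'.1 hr
      have := (h.sheet _).zero _ hk'.2
      simpa [hrx] using this
  have hsign : ∀ᶠ x in 𝓝 (t₁, p'), ∀ k, 0 < g (φ k) x ↔ 0 < g' k x := by
    rw [eventually_all]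
    intro k
    have hF0 : F t₁ (pt' k) = p' := h'.apply_pt k
    obtain ⟨μ, hμ, hgrad⟩ := (h.sheet _).grad _ (hφW k)
    obtain ⟨μ', hμ', hgrad'⟩ := (h'.sheet k).grad _ (h'.mem_sheet k)
    simp only [hF0] at hgrad hgrad'
    set n := conormal (F t₁) (pt' k)
    have hn : n ≠ 0 := conormal_ne_zero ((hF.2 t₁ ht₁).2 _)
    have hnn := real_inner_self_pos.2 hn
    have hd := ((h.sheet (φ k)).contDiffOn.contDiffAt (h.isOpen.mem_nhds hV))
    have hd' := ((h'.sheet k).contDiffOn.contDiffAt (h'.isOpen.mem_nhds h'.mem))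
    have hp : 0 < fderiv ℝ (g (φ k)) (t₁, p') (0, n) := by rw [hgrad]; positivity
    have hp' : 0 < fderiv ℝ (g' k) (t₁, p') (0, n) := by rw [hgrad']; positivity
    have h0' : g' k (t₁, p') = 0 := hzero.self_of_nhds k |>.1 (hφ0 k)
    filter_upwards [eventually_pos_imp_of_zero_imp hd hd' (hφ0 k) hp hp'
      (hzero.mono fun x hx => (hx k).1), eventually_pos_imp_of_zero_imp hd' hd h0' hp' hp
      (hzero.mono fun x hx => (hx k).2)] with x h1 h2 using ⟨h1, h2⟩
  -- the sheets that do not pass through `(t₁, p')` contribute a constant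
  have hother : ∀ᶠ x in 𝓝 (t₁, p'), ∀ i, g i (t₁, p') ≠ 0 → (0 < g i x ↔ 0 < g i (t₁, p')) := by
    rw [eventually_all]
    intro i
    by_cases hi : g i (t₁, p') = 0
    · simp [hi]
    have hc : ContinuousAt (g i) (t₁, p') :=
      ((h.sheet i).contDiffOn.contDiffAt (h.isOpen.mem_nhds hV)).continuousAt
    rcases lt_or_gt_of_ne hi with hlt | hgt
    · filter_upwards [hc.eventually (gt_mem_nhds hlt)] with x hx _
      exact ⟨fun h => absurd h (not_lt.2 hx.le), fun h => absurd h (not_lt.2 hlt.le)⟩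
    · filter_upwards [hc.eventually (lt_mem_nhds hgt)] with x hx _
      exact ⟨fun _ => hgt, fun _ => hx⟩
  refine ⟨sideCount g (t₁, p'), ?_⟩
  filter_upwards [hsign, hother] with x hx hx'
  have hset : {i | 0 < g i x} = φ '' {k | 0 < g' k x} ∪ {i | 0 < g i (t₁, p')} := by
    ext i
    simp only [mem_ofPred_eq, mem_union, mem_image]
    by_cases hi : g i (t₁, p') = 0
    · obtain ⟨k, rfl⟩ := hφsurj i hi
      simp [hi, hx, hφinj.eq_iff]
    · rw [hx' i hi]
      refine ⟨Or.inr, ?_⟩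
      rintro (⟨k, -, rfl⟩ | h)
      · exact absurd (hφ0 k) hi
      · exact h
  rw [sideCount, sideCount, sideCount, hset, ncard_union_eq, ncard_image_of_injective _ hφinj]
  · push_cast; rfl
  · refine Set.disjoint_left.2 ?_
    rintro _ ⟨k, -, rfl⟩ hk
    rw [mem_ofPred_eq, hφ0] at hk
    exact lt_irrefl _ hk

/-! ### The numbering of space-time -/

/-- Near every point of space-time the function `A` has, up to a constant, the jumps of the number
of sheets of which the variable is on the positive side. -/
def HasSheetJumps (F : ℝ → M → E3) (I : Set ℝ) (A : ℝ × E3 → ℚ) : Prop :=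
  ∀ t₀ ∈ I, ∀ p, ∃ g W V, IsLocalModel F t₀ p (Subtype.val : F t₀ ⁻¹' {p} → M) g W V ∧
    ∃ c, ∀ᶠ x in 𝓝 (t₀, p), A x = sideCount g x + c

theorem HasSheetJumps.exists_eventually_eq [CompactSpace M] {a b : ℝ} {F : ℝ → M → E3}
    (hF : IsRegularHomotopy F a b) {A : ℝ × E3 → ℚ} (hA : HasSheetJumps F (Ioo a b) A)
    {ι : Type*} {t₀ : ℝ} (ht₀ : t₀ ∈ Ioo a b) {p : E3} {pt : ι → M} {g : ι → ℝ × E3 → ℝ}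
    {W : ι → Set (ℝ × M)} {V : Set (ℝ × E3)} (h : IsLocalModel F t₀ p pt g W V) :
    ∃ c, ∀ᶠ x in 𝓝 (t₀, p), A x = sideCount g x + c := by
  obtain ⟨g', W', V', h', c, hc⟩ := hA t₀ ht₀ p
  obtain ⟨d, hd⟩ := h'.eventually_sideCount_eq hF h ht₀ h'.mem
  refine ⟨d + c, ?_⟩
  filter_upwards [hc, hd] with x hx hx'
  rw [hx, hx', add_assoc]

theorem exists_hasSheetJumps [IsManifold (𝓡 2) ∞ M] [CompactSpace M] [T2Space M]
    (hM : IsOrientedAtlas M) {F : ℝ → M → E3} {a b : ℝ} (hF : IsRegularHomotopy F a b) :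
    ∃ A, HasSheetJumps F (Ioo a b) A := by
  have hex : ∀ x : ℝ × E3, x.1 ∈ Ioo a b → ∃ g W V,
      IsLocalModel F x.1 x.2 (Subtype.val : F x.1 ⁻¹' {x.2} → M) g W V := by
    intro x hx
    obtain ⟨g, W, V, -, h⟩ := exists_isLocalModel hM hF hx x.2
      (pt := (Subtype.val : F x.1 ⁻¹' {x.2} → M)) Subtype.val_injective Subtype.range_val
    exact ⟨g, W, V, h⟩
  have hex' : ∀ x : ℝ × E3, ∃ g : F x.1 ⁻¹' {x.2} → ℝ × E3 → ℝ, x.1 ∈ Ioo a b → ∃ W V,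
      IsLocalModel F x.1 x.2 (Subtype.val : F x.1 ⁻¹' {x.2} → M) g W V := by
    intro x
    by_cases hx : x.1 ∈ Ioo a b
    · obtain ⟨g, h⟩ := hex x hx
      exact ⟨g, fun _ => h⟩
    · exact ⟨fun _ _ => 0, fun h => absurd h hx⟩
  choose g hg using hex'
  obtain ⟨A, hA⟩ := exists_hasJumpsOn_of_convex (α := fun x => sideCount (g x))
    (C := Ioo a b ×ˢ (univ : Set E3)) ((convex_Ioo a b).prod convex_univ)
    (isOpen_Ioo.prod isOpen_univ) (by
      rintro ⟨t, p⟩ ⟨ht, -⟩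
      obtain ⟨W, V, h⟩ := hg (t, p) ht
      filter_upwards [h.isOpen.mem_nhds h.mem,
        (isOpen_Ioo.prod isOpen_univ).mem_nhds (show (t, p) ∈ Ioo a b ×ˢ (univ : Set E3) from
          ⟨ht, mem_univ _⟩)] with x hxV hx
      obtain ⟨W', V', h'⟩ := hg x hx.1
      exact h.eventually_sideCount_eq hF h' hx.1 hxV)
  refine ⟨A, fun t ht p => ?_⟩
  obtain ⟨W, V, h⟩ := hg (t, p) ht
  exact ⟨g (t, p), W, V, h, hA (t, p) ⟨ht, mem_univ _⟩⟩

theorem isPreconnected_norm_gt (R : ℝ) (hR : 0 ≤ R) : IsPreconnected {x : E3 | R < ‖x‖} := by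
  have hrank : 1 < Module.rank ℝ E3 := by
    rw [← Module.finrank_eq_rank]
    simp [E3]
  have h := (isPreconnected_Ioi (a := R)).prod (isPreconnected_sphere hrank (0 : E3) 1)
  have h2 := h.image (fun x : ℝ × E3 => x.1 • x.2) (by fun_prop)
  convert h2 using 1
  ext x
  simp only [mem_ofPred_eq, mem_image, mem_prod, mem_Ioi, mem_sphere_zero_iff_norm]
  constructor
  · intro hx
    have hx0 : ‖x‖ ≠ 0 := by linarith
    refine ⟨(‖x‖, ‖x‖⁻¹ • x), ⟨hx, ?_⟩, ?_⟩
    · simp [norm_smul, hx0]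
    · simp [smul_smul, hx0]
  · rintro ⟨⟨r, u⟩, ⟨hr, hu⟩, rfl⟩
    simp only at hr hu ⊢
    rw [norm_smul, hu, mul_one, Real.norm_eq_abs]
    exact hr.trans_le (le_abs_self r)

/-- Where there are no sheets the local count of sides is the count over an empty type. -/
theorem HasSheetJumps.eventually_eq_of_notMem_range [CompactSpace M] {a b : ℝ} {F : ℝ → M → E3}
    {A : ℝ × E3 → ℚ} (hA : HasSheetJumps F (Ioo a b) A) {x : ℝ × E3} (hx : x.1 ∈ Ioo a b)
    (hxr : x.2 ∉ range (F x.1)) : ∀ᶠ y in 𝓝 x, A y = A x := by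
  obtain ⟨g, W, V, h, c, hc⟩ := hA x.1 hx x.2
  have : IsEmpty (F x.1 ⁻¹' {x.2}) := ⟨fun r => hxr ⟨r.1, r.2⟩⟩
  have h0 : ∀ y, sideCount g y = 0 := by
    intro y
    have : {i | 0 < g i y} = ∅ := by ext i; exact this.elim i
    simp [sideCount, this]
  have hc' : ∀ᶠ y in 𝓝 x, A y = c := by
    filter_upwards [hc] with y hy
    simpa [h0] using hy
  filter_upwards [hc'] with y hy
  rw [hy, hc'.self_of_nhds]

/-- Outside a large ball the numbering does not depend on the time either: over a compact interval of
times the surfaces stay in a bounded set, whose exterior is connected. -/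
theorem HasSheetJumps.exists_eventually_cobounded [CompactSpace M] {a b : ℝ} {F : ℝ → M → E3}
    (hF : IsRegularHomotopy F a b) {A : ℝ × E3 → ℚ} (hA : HasSheetJumps F (Ioo a b) A)
    {s t : ℝ} (hs : s ∈ Ioo a b) (ht : t ∈ Ioo a b) :
    ∃ c, (∀ᶠ x in Bornology.cobounded E3, A (s, x) = c) ∧
      ∀ᶠ x in Bornology.cobounded E3, A (t, x) = c := by
  have hsub : uIcc s t ⊆ Ioo a b := (ordConnected_Ioo).uIcc_subset hs ht
  have hK : IsCompact ((fun y : ℝ × M => F y.1 y.2) '' (uIcc s t ×ˢ univ)) :=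
    (isCompact_uIcc.prod isCompact_univ).image_of_continuousOn
      (hF.continuousOn.mono (prod_mono hsub subset_rfl))
  obtain ⟨R, hR⟩ := hK.isBounded.exists_norm_le
  have hpre : IsPreconnected (uIcc s t ×ˢ {x : E3 | max R 0 < ‖x‖}) :=
    isPreconnected_uIcc.prod (isPreconnected_norm_gt _ (le_max_right _ _))
  obtain ⟨x₀, hx₀⟩ := NormedSpace.exists_lt_norm ℝ E3 (max R 0)
  have hcob : ∀ᶠ x in Bornology.cobounded E3, max R 0 < ‖x‖ :=
    tendsto_norm_cobounded_atTop.eventually (eventually_gt_atTop _)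
  have hconst : ∀ τ ∈ uIcc s t, ∀ x : E3, max R 0 < ‖x‖ → A (τ, x) = A (s, x₀) := by
    intro τ hτ x hx
    refine eq_of_isPreconnected_of_eventually_eq hpre ?_ (mk_mem_prod hτ hx)
      (mk_mem_prod left_mem_uIcc hx₀)
    rintro ⟨τ, x⟩ ⟨hτ, hx⟩
    refine mem_nhdsWithin_of_mem_nhds (hA.eventually_eq_of_notMem_range (hsub hτ) ?_)
    rintro ⟨r, hr⟩
    have h1 := hR _ (mem_image_of_mem _ (mk_mem_prod hτ (mem_univ r)))
    simp only at hr h1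
    rw [hr] at h1
    exact absurd (lt_of_le_of_lt (le_max_left R 0) hx) (not_lt.2 h1)
  exact ⟨A (s, x₀), hcob.mono fun x hx => hconst s left_mem_uIcc x hx,
    hcob.mono fun x hx => hconst t right_mem_uIcc x hx⟩

/-- The numbering of space-time, normalized at infinity. -/
theorem exists_spacetime_numbering [IsManifold (𝓡 2) ∞ M] [CompactSpace M] [T2Space M]
    (hM : IsOrientedAtlas M) {F : ℝ → M → E3} {a b : ℝ} (hF : IsRegularHomotopy F a b) :
    ∃ A, HasSheetJumps F (Ioo a b) A ∧
      ∀ t ∈ Ioo a b, ∀ᶠ x in Bornology.cobounded E3, A (t, x) = -3 / 2 := by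
  obtain ⟨A, hA⟩ := exists_hasSheetJumps hM hF
  rcases (Ioo a b).eq_empty_or_nonempty with hab | ⟨s, hs⟩
  · exact ⟨A, hA, by simp [hab]⟩
  obtain ⟨c, hc, -⟩ := hA.exists_eventually_cobounded hF hs hs
  refine ⟨fun x => A x - c - 3 / 2, ?_, ?_⟩
  · intro t ht p
    obtain ⟨g, W, V, h, d, hd⟩ := hA t ht p
    refine ⟨g, W, V, h, d - c - 3 / 2, hd.mono fun x hx => ?_⟩
    simp only [hx]; ring
  · intro t ht
    obtain ⟨c', hc', ht'⟩ := hA.exists_eventually_cobounded hF hs ht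
    obtain ⟨x, hx, hx'⟩ := (hc.and hc').exists
    rw [hx] at hx'
    filter_upwards [ht'] with y hy
    simp only [hy, ← hx']; ring

end Surface

/-! ### The Alexander numbering of a generic immersion -/

theorem exists_inner_eq_of_linearIndependent {ι E : Type*} [NormedAddCommGroup E]
    [InnerProductSpace ℝ E] [FiniteDimensional ℝ E] {n : ι → E} (hn : LinearIndependent ℝ n)
    (c : ι → ℝ) : ∃ v, ∀ i, inner ℝ (n i) v = c i := by
  obtain ⟨φ, hφ⟩ := LinearMap.exists_extend ((Module.Basis.span hn).constr ℝ c)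
  have : CompleteSpace E := FiniteDimensional.complete ℝ E
  refine ⟨(InnerProductSpace.toDual ℝ E).symm φ.toContinuousLinearMap, fun i => ?_⟩
  rw [real_inner_comm, InnerProductSpace.toDual_symm_apply]
  have h1 := congrArg (fun L => L ((Module.Basis.span hn) i)) hφ
  rw [Module.Basis.constr_basis] at h1
  rw [← h1, LinearMap.comp_apply, Submodule.subtype_apply, Module.Basis.span_apply]
  rfl

theorem eventually_pos_of_hasDerivAt {h : ℝ → ℝ} {h' : ℝ} (hd : HasDerivAt h h' 0) (h0 : h 0 = 0)
    (hpos : 0 < h') : ∀ᶠ s in 𝓝[>] 0, 0 < h s := by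
  have h1 := hd.hasDerivWithinAt (s := Ioi 0)
  rw [hasDerivWithinAt_iff_tendsto_slope' (by simp)] at h1
  filter_upwards [h1.eventually (lt_mem_nhds hpos), self_mem_nhdsWithin] with s hs hs0
  rw [slope_def_field, h0, sub_zero, sub_zero] at hs
  exact (div_pos_iff_of_pos_right hs0).1 hs

theorem eventually_pos_of_fderiv_pos {X : Type*} [NormedAddCommGroup X] [NormedSpace ℝ X]
    {g : X → ℝ} {p v : X} (hd : DifferentiableAt ℝ g p) (h0 : g p = 0)
    (hpos : 0 < fderiv ℝ g p v) : ∀ᶠ s : ℝ in 𝓝[>] 0, 0 < g (p + s • v) := by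
  have h1 : HasDerivAt (fun s : ℝ => p + s • v) v 0 := by
    simpa using ((hasDerivAt_id (0 : ℝ)).smul_const v).const_add p
  have h2 : HasFDerivAt g (fderiv ℝ g p) (p + (0 : ℝ) • v) := by simpa using hd.hasFDerivAt
  exact eventually_pos_of_hasDerivAt (h2.comp_hasDerivAt (0 : ℝ) h1) (by simpa using h0) hpos

theorem eventually_neg_of_fderiv_neg {X : Type*} [NormedAddCommGroup X] [NormedSpace ℝ X]
    {g : X → ℝ} {p v : X} (hd : DifferentiableAt ℝ g p) (h0 : g p = 0)
    (hneg : fderiv ℝ g p v < 0) : ∀ᶠ s : ℝ in 𝓝[>] 0, g (p + s • v) < 0 := by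
  have := eventually_pos_of_fderiv_pos (g := fun x => -g x) (v := v) hd.neg (by simpa using h0)
    (by rw [fderiv_fun_neg]; simpa using hneg)
  simpa using this

/-- A function that is locally constant off the set `R` is constant on the preimage under the
coordinates of a convex set that avoids the coordinate hyperplanes. -/
theorem eq_of_convex_of_locallyConstant {ι : Type*} {R : Set E3} {K : Submodule ℝ E3}
    [Fintype ι] {ψ : OpenPartialHomeomorph E3 ((ι → ℝ) × K)} {D : E3 → ℚ}
    (hD : ∀ x ∉ R, ∀ᶠ y in 𝓝 x, D y = D x) {C : Set ((ι → ℝ) × K)} (hC : Convex ℝ C)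
    (hCt : C ⊆ ψ.target) (hCr : ∀ z ∈ C, ψ.symm z ∉ R) {z z' : (ι → ℝ) × K} (hz : z ∈ C)
    (hz' : z' ∈ C) : D (ψ.symm z) = D (ψ.symm z') := by
  refine eq_of_isPreconnected_of_eventually_eq (f := fun z => D (ψ.symm z)) hC.isPreconnected
    (fun w hw => ?_) hz hz'
  exact mem_nhdsWithin_of_mem_nhds
    ((ψ.continuousAt_symm (hCt hw)).eventually (hD _ (hCr w hw)))

section Surface

variable {M : Type*} [TopologicalSpace M] [ChartedSpace E2 M]

/-- Equations `g i` of all the sheets of `f` in the open set `V`. -/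
structure IsSheetChart {ι : Type*} (f : M → E3) (g : ι → E3 → ℝ) (V : Set E3) : Prop where
  finite : Finite ι
  isOpen : IsOpen V
  contDiffOn : ∀ i, ContDiffOn ℝ 1 (g i) V
  fiber : ∀ x ∈ V, ∃ e : {i // g i x = 0} ≃ f ⁻¹' {x}, ∀ i : {i // g i x = 0}, ∃ μ > 0, ∀ v,
    fderiv ℝ (g i.1) x v = μ * inner ℝ (conormal f (e i)) v

theorem IsLocalModel.isSheetChart {ι : Type*} {F : ℝ → M → E3} {t₀ : ℝ} {p : E3} {pt : ι → M}
    {g : ι → ℝ × E3 → ℝ} {W : ι → Set (ℝ × M)} {V : Set (ℝ × E3)}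
    (h : IsLocalModel F t₀ p pt g W V) (t : ℝ) :
    IsSheetChart (F t) (fun i x => g i (t, x)) ((fun x => (t, x)) ⁻¹' V) where
  finite := h.finite
  isOpen := h.isOpen.preimage (by fun_prop)
  contDiffOn i := (h.sheet i).contDiffOn.comp (by fun_prop) fun x hx => hx
  fiber x hx := by
    obtain ⟨e, he⟩ := h.exists_equiv_fiber hx
    refine ⟨e, fun i => ?_⟩
    obtain ⟨μ, hμ, hgrad⟩ := (h.sheet i.1).grad _ (he i)
    refine ⟨μ, hμ, fun v => ?_⟩
    have hFx : F t (e i) = x := (e i).2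
    simp only [hFx] at hgrad
    rw [← hgrad]
    have h1 : HasFDerivAt (fun x : E3 => (t, x)) (ContinuousLinearMap.inr ℝ ℝ E3) x :=
      hasFDerivAt_prodMk_right t x
    have h2 : DifferentiableAt ℝ (g i.1) (t, x) :=
      ((h.sheet i.1).contDiffOn.contDiffAt (h.isOpen.mem_nhds hx)).differentiableAt (by simp)
    have h3 : HasFDerivAt (fun x => g i.1 (t, x)) _ x :=
      HasFDerivAt.comp (f := fun x : E3 => (t, x)) x h2.hasFDerivAt h1
    rw [h3.fderiv]
    rfl

namespace IsSheetChart

variable {ι : Type*} {f : M → E3} {g : ι → E3 → ℝ} {V : Set E3}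

theorem contDiffAt (h : IsSheetChart f g V) {x : E3} (hx : x ∈ V) (i : ι) :
    ContDiffAt ℝ 1 (g i) x := (h.contDiffOn i).contDiffAt (h.isOpen.mem_nhds hx)

theorem differentiableAt (h : IsSheetChart f g V) {x : E3} (hx : x ∈ V) (i : ι) :
    DifferentiableAt ℝ (g i) x := (h.contDiffAt hx i).differentiableAt (by simp)

theorem mem_range_iff (h : IsSheetChart f g V) {x : E3} (hx : x ∈ V) :
    x ∈ range f ↔ ∃ i, g i x = 0 := by
  obtain ⟨e, -⟩ := h.fiber x hx
  constructor
  · rintro ⟨q, hq⟩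
    exact ⟨(e.symm ⟨q, hq⟩).1, (e.symm ⟨q, hq⟩).2⟩
  · rintro ⟨i, hi⟩
    exact ⟨(e ⟨i, hi⟩).1, (e ⟨i, hi⟩).2⟩

theorem exists_fderiv_eq (h : IsSheetChart f g V) {x : E3} (hx : x ∈ V)
    (ht : IsTransverseAt f x) (c : ι → ℝ) :
    ∃ v, ∀ i, g i x = 0 → fderiv ℝ (g i) x v = c i := by
  obtain ⟨e, he⟩ := h.fiber x hx
  choose μ hμ hgrad using he
  obtain ⟨v, hv⟩ := exists_inner_eq_of_linearIndependent ht
    (fun q => c (e.symm q).1 / μ (e.symm q))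
  refine ⟨v, fun i hi => ?_⟩
  rw [hgrad ⟨i, hi⟩, hv, e.symm_apply_apply]
  have := hμ ⟨i, hi⟩
  field_simp

theorem continuousAt_of_range_compl (h : IsSheetChart f g V) {x : E3} (hx : x ∈ V)
    (hxr : x ∉ range f) : ∀ᶠ y in 𝓝 x, sideCount g y = sideCount g x := by
  have := h.finite
  have hne : ∀ i, g i x ≠ 0 := fun i hi => hxr ((h.mem_range_iff hx).2 ⟨i, hi⟩)
  have : ∀ᶠ y in 𝓝 x, ∀ i, 0 < g i y ↔ 0 < g i x := by
    rw [eventually_all]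
    intro i
    have hc := (h.contDiffAt hx i).continuousAt
    rcases lt_or_gt_of_ne (hne i) with hlt | hgt
    · filter_upwards [hc.eventually (gt_mem_nhds hlt)] with y hy
      exact ⟨fun h => absurd h (not_lt.2 hy.le), fun h => absurd h (not_lt.2 hlt.le)⟩
    · filter_upwards [hc.eventually (lt_mem_nhds hgt)] with y hy
      exact ⟨fun _ => hgt, fun _ => hy⟩
  filter_upwards [this] with y hy
  simp only [sideCount, hy]

end IsSheetChart

/-- The function `B` has near every point, up to a constant, the jumps of the number of sheets of
`f` of which the variable is on the positive side. -/
def HasSideJumps (f : M → E3) (B : E3 → ℚ) : Prop :=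
  ∀ p, ∃ (g : f ⁻¹' {p} → E3 → ℝ) (V : Set E3), IsSheetChart f g V ∧ p ∈ V ∧ (∀ i, g i p = 0) ∧
    ∃ c, ∀ᶠ x in 𝓝 p, B x = sideCount g x + c

theorem HasSheetJumps.hasSideJumps {F : ℝ → M → E3} {I : Set ℝ} {A : ℝ × E3 → ℚ}
    (hA : HasSheetJumps F I A) {t : ℝ} (ht : t ∈ I) : HasSideJumps (F t) (fun x => A (t, x)) := by
  intro p
  obtain ⟨g, W, V, h, c, hc⟩ := hA t ht p
  have hcont : ContinuousAt (fun x : E3 => (t, x)) p := by fun_prop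
  refine ⟨fun i x => g i (t, x), _, h.isSheetChart t, h.mem, fun i => ?_, c, hcont.eventually hc⟩
  have := (h.sheet i).zero _ (h.mem_sheet i)
  rwa [h.apply_pt] at this

open Classical in
/-- A function with the right jumps and the right value at infinity, set to `0` on the image, is an
Alexander numbering. -/
theorem HasSideJumps.isAlexanderNumbering [CompactSpace M] {f : M → E3} (hf : Continuous f)
    {B : E3 → ℚ} (hB : HasSideJumps f B)
    (hinf : ∀ᶠ x in Bornology.cobounded E3, B x = -3 / 2)
    (hne : ∀ q, conormal f q ≠ 0) :
    IsAlexanderNumbering f (fun x => if x ∈ range f then 0 else B x) where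
  locallyConstant x hx := by
    obtain ⟨g, V, h, hxV, -, c, hc⟩ := hB x
    have hopen : (range f)ᶜ ∈ 𝓝 x := (isCompact_range hf).isClosed.isOpen_compl.mem_nhds hx
    filter_upwards [hopen, hc, h.continuousAt_of_range_compl hxV hx] with y hy hyc hys
    rw [if_neg hy, if_neg hx, hyc, hc.self_of_nhds, hys]
  infinity := by
    have : ∀ᶠ x in Bornology.cobounded E3, x ∉ range f :=
      Bornology.isBounded_def.1 (isCompact_range hf).isBounded
    filter_upwards [this, hinf] with x hx hx'
    rw [if_neg hx, hx']
  crossing q hq := by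
    obtain ⟨g, V, h, hpV, h0, c, hc⟩ := hB (f q)
    have hall : ∀ i : f ⁻¹' {f q}, i = ⟨q, rfl⟩ := by
      rintro ⟨r, hr⟩
      rw [hq] at hr
      exact Subtype.ext hr
    set i₀ : f ⁻¹' {f q} := ⟨q, rfl⟩
    obtain ⟨e, he⟩ := h.fiber _ hpV
    obtain ⟨μ, hμ, hgrad⟩ := he ⟨i₀, h0 i₀⟩
    rw [hall (e ⟨i₀, h0 i₀⟩)] at hgrad
    have hnn := real_inner_self_pos.2 (hne q)
    have hpos := eventually_pos_of_fderiv_pos (v := conormal f q) (h.differentiableAt hpV i₀)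
      (h0 i₀) (by rw [hgrad]; positivity)
    have hneg := eventually_neg_of_fderiv_neg (v := -conormal f q) (h.differentiableAt hpV i₀)
      (h0 i₀) (by rw [map_neg, hgrad]; simp only [Left.neg_neg_iff]; positivity)
    have hev : ∀ v : E3, ∀ᶠ s : ℝ in 𝓝[>] 0, f q + s • v ∈ V ∧
        B (f q + s • v) = sideCount g (f q + s • v) + c := by
      intro v
      have hcont : ContinuousAt (fun s : ℝ => f q + s • v) 0 := by fun_prop
      have h1 : ∀ᶠ x in 𝓝 (f q + (0 : ℝ) • v), x ∈ V ∧ B x = sideCount g x + c := by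
        rw [zero_smul, add_zero]
        exact inter_mem (h.isOpen.mem_nhds hpV) hc
      exact nhdsWithin_le_nhds (hcont.eventually h1)
    filter_upwards [hpos, hneg, hev (conormal f q), hev (-conormal f q)] with s h1 h2 h3 h4
    simp only [smul_neg, ← sub_eq_add_neg] at h2 h4
    rw [if_neg, if_neg, h3.2, h4.2]
    · have e1 : {i | 0 < g i (f q + s • conormal f q)} = {i₀} := by
        ext i; rw [hall i]; simpa using h1
      have e2 : {i | 0 < g i (f q - s • conormal f q)} = ∅ := by
        ext i; rw [hall i]; simpa using h2.le
      rw [sideCount, sideCount, e1, e2]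
      simp; ring
    · rw [h.mem_range_iff h4.1]
      rintro ⟨i, hi⟩
      rw [hall i] at hi
      exact h2.ne hi
    · rw [h.mem_range_iff h3.1]
      rintro ⟨i, hi⟩
      rw [hall i] at hi
      exact h1.ne' hi
  image x hx := if_pos hx

/-- Local coordinates near a point where the sheets are transverse: the sheets become coordinate
hyperplanes of a box. -/
theorem IsSheetChart.exists_box {ι : Type*} [Fintype ι] {f : M → E3} {g : ι → E3 → ℝ} {V : Set E3}
    (h : IsSheetChart f g V) {p : E3} (hp : p ∈ V) (h0 : ∀ i, g i p = 0) (ht : IsTransverseAt f p) :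
    ∃ (K : Submodule ℝ E3) (ψ : OpenPartialHomeomorph E3 ((ι → ℝ) × K)) (ε : ℝ), 0 < ε ∧
      p ∈ ψ.source ∧ ψ p = 0 ∧ (∀ x i, (ψ x).1 i = g i x) ∧ ψ.source ⊆ V ∧
      Metric.ball (0 : ι → ℝ) ε ×ˢ Metric.ball (0 : K) ε ⊆ ψ.target := by
  have hs : HasStrictFDerivAt (fun x i => g i x)
      (ContinuousLinearMap.pi fun i => fderiv ℝ (g i) p) p :=
    hasStrictFDerivAt_pi.2 fun i => (h.contDiffAt hp i).hasStrictFDerivAt (by simp)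
  have hsurj : (ContinuousLinearMap.pi fun i => fderiv ℝ (g i) p : E3 →L[ℝ] ι → ℝ).range = ⊤ := by
    rw [LinearMap.range_eq_top]
    intro c
    obtain ⟨v, hv⟩ := h.exists_fderiv_eq hp ht c
    exact ⟨v, funext fun i => hv i (h0 i)⟩
  set ψ₀ := hs.implicitToOpenPartialHomeomorph _ _ hsurj with hψ₀
  have hp0 : p ∈ ψ₀.source := hs.mem_implicitToOpenPartialHomeomorph_source hsurj
  have hψp : ψ₀ p = 0 := by
    rw [hψ₀, hs.implicitToOpenPartialHomeomorph_self hsurj]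
    exact Prod.ext (funext h0) rfl
  have hpS : p ∈ (ψ₀.restr V).source := by
    rw [ψ₀.restr_source, h.isOpen.interior_eq]
    exact ⟨hp0, hp⟩
  have htgt : (ψ₀.restr V).target ∈ 𝓝 (0 : (ι → ℝ) × _) := by
    have := (ψ₀.restr V).open_target.mem_nhds ((ψ₀.restr V).map_source hpS)
    rwa [ψ₀.restr_apply, hψp] at this
  obtain ⟨ε, hε, hball⟩ := Metric.mem_nhds_iff.1 htgt
  refine ⟨_, ψ₀.restr V, ε, hε, hpS, hψp, fun x i => ?_, ?_, ?_⟩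
  · exact congrFun (hs.implicitToOpenPartialHomeomorph_fst hsurj x) i
  · rw [ψ₀.restr_source, h.isOpen.interior_eq]
    exact inter_subset_right
  · rwa [ball_prod_same]

/-- At a point with a single preimage, a function that does not jump across the sheet is constant
nearby, off the image. -/
theorem exists_eventually_eq_of_subsingleton {f : M → E3} {ι : Type*} [Fintype ι]
    {g : ι → E3 → ℝ} {V : Set E3} (h : IsSheetChart f g V) {p : E3} (hp : p ∈ V)
    (h0 : ∀ i, g i p = 0) (ht : IsTransverseAt f p) {D : E3 → ℚ}
    (hD : ∀ x ∉ range f, ∀ᶠ y in 𝓝 x, D y = D x) {q : M} (hq : f ⁻¹' {p} = {q})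
    (hcr : ∀ᶠ s : ℝ in 𝓝[>] 0, D (p + s • conormal f q) = D (p - s • conormal f q))
    (hne : conormal f q ≠ 0) :
    ∃ d, ∀ᶠ x in 𝓝 p, x ∉ range f → D x = d := by
  obtain ⟨K, ψ, ε, hε, hpS, hψp, hψ, hSV, hbox⟩ := h.exists_box hp h0 ht
  obtain ⟨e, he⟩ := h.fiber _ hp
  have hqm : q ∈ f ⁻¹' {p} := by rw [hq]; rfl
  set i₀ := (e.symm ⟨q, hqm⟩).1 with hi₀
  have hall : ∀ i, i = i₀ := by
    intro i
    have : e ⟨i, h0 i⟩ = ⟨q, hqm⟩ :=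
      Subtype.ext (hq.subset (e ⟨i, h0 i⟩).2)
    rw [hi₀, ← this, e.symm_apply_apply]
  have hU : ∀ᶠ x in 𝓝 p, x ∈ ψ.source ∧
      ψ x ∈ Metric.ball (0 : ι → ℝ) ε ×ˢ Metric.ball (0 : K) ε := by
    refine inter_mem (ψ.open_source.mem_nhds hpS) ((ψ.continuousAt hpS).eventually ?_)
    rw [hψp]
    exact (Metric.isOpen_ball.prod Metric.isOpen_ball).mem_nhds (by simp [hε])
  have hconst : ∀ σ : ℝ, ∀ x x', (x ∈ ψ.source ∧
      ψ x ∈ Metric.ball (0 : ι → ℝ) ε ×ˢ Metric.ball (0 : K) ε) → (x' ∈ ψ.source ∧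
      ψ x' ∈ Metric.ball (0 : ι → ℝ) ε ×ˢ Metric.ball (0 : K) ε) → 0 < σ * g i₀ x →
      0 < σ * g i₀ x' → D x = D x' := by
    intro σ x x' hx hx' hgx hgx'
    rw [← hψ] at hgx hgx'
    have hlin : IsLinearMap ℝ (fun z : (ι → ℝ) × K => σ * z.1 i₀) :=
      ⟨fun a b => by simp [mul_add], fun c a => by simp; ring⟩
    have := eq_of_convex_of_locallyConstant (R := range f) hD
      (C := (Metric.ball (0 : ι → ℝ) ε ×ˢ Metric.ball (0 : K) ε) ∩ {z | 0 < σ * z.1 i₀})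
      (ψ := ψ) (((convex_ball _ _).prod (convex_ball _ _)).inter (convex_halfSpace_gt hlin 0))
      (inter_subset_left.trans hbox) (fun z hz => ?_) ⟨hx.2, hgx⟩ ⟨hx'.2, hgx'⟩
    · rwa [ψ.left_inv hx.1, ψ.left_inv hx'.1] at this
    · rw [h.mem_range_iff (hSV (ψ.map_target (hbox hz.1)))]
      rintro ⟨i, hi⟩
      rw [hall i, ← hψ, ψ.right_inv (hbox hz.1)] at hi
      have := hz.2
      simp [hi] at this
  obtain ⟨μ, hμ, hgrad⟩ := he ⟨i₀, h0 i₀⟩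
  have heq : (e ⟨i₀, h0 i₀⟩ : M) = q := hq.subset (e ⟨i₀, h0 i₀⟩).2
  rw [heq] at hgrad
  have hnn := real_inner_self_pos.2 hne
  have hpos := eventually_pos_of_fderiv_pos (v := conormal f q) (h.differentiableAt hp i₀)
    (h0 i₀) (by rw [hgrad]; positivity)
  have hneg := eventually_neg_of_fderiv_neg (v := -conormal f q) (h.differentiableAt hp i₀)
    (h0 i₀) (by rw [map_neg, hgrad]; simp only [Left.neg_neg_iff]; positivity)
  have hev : ∀ v : E3, ∀ᶠ s : ℝ in 𝓝[>] 0, (p + s • v) ∈ ψ.source ∧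
      ψ (p + s • v) ∈ Metric.ball (0 : ι → ℝ) ε ×ˢ Metric.ball (0 : K) ε := by
    intro v
    have hcont : ContinuousAt (fun s : ℝ => p + s • v) 0 := by fun_prop
    have h1 : ∀ᶠ x in 𝓝 (p + (0 : ℝ) • v), x ∈ ψ.source ∧
        ψ x ∈ Metric.ball (0 : ι → ℝ) ε ×ˢ Metric.ball (0 : K) ε := by
      rwa [zero_smul, add_zero]
    exact (hcont.eventually h1).filter_mono nhdsWithin_le_nhds
  obtain ⟨s, h1, h2, h3, h4, h5⟩ := (hpos.and (hneg.and ((hev (conormal f q)).and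
    ((hev (-conormal f q)).and hcr)))).exists
  simp only [smul_neg, ← sub_eq_add_neg] at h2 h4
  refine ⟨D (p + s • conormal f q), ?_⟩
  filter_upwards [hU] with x hx hxr
  have hgx : g i₀ x ≠ 0 := fun hg => hxr ((h.mem_range_iff (hSV hx.1)).2 ⟨i₀, hg⟩)
  rcases lt_or_gt_of_ne hgx with hlt | hgt
  · rw [h5]
    exact hconst (-1) _ _ hx h4 (by linarith) (by linarith)
  · exact hconst 1 _ _ hx h3 (by linarith) (by linarith)

/-- A locally constant function without jumps across the sheets at the simple points of the image
is constant, off the image, near every point where the sheets are transverse. Two points of a box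
are joined by changing one coordinate at a time; only simple points of the image are crossed. -/
theorem exists_eventually_eq_of_isTransverseAt {f : M → E3} {ι : Type*} [Fintype ι]
    {g : ι → E3 → ℝ} {V : Set E3} (h : IsSheetChart f g V) {p : E3} (hp : p ∈ V)
    (h0 : ∀ i, g i p = 0) (ht : IsTransverseAt f p) {D : E3 → ℚ}
    (hD : ∀ x ∉ range f, ∀ᶠ y in 𝓝 x, D y = D x)
    (hsimple : ∀ q, f ⁻¹' {f q} = {q} → ∃ d, ∀ᶠ x in 𝓝 (f q), x ∉ range f → D x = d) :
    ∃ d, ∀ᶠ x in 𝓝 p, x ∉ range f → D x = d := by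
  classical
  obtain ⟨K, ψ, ε, hε, hpS, hψp, hψ, hSV, hbox⟩ := h.exists_box hp h0 ht
  set N := Metric.ball (0 : ι → ℝ) ε with hN
  have hcoord : ∀ z ∈ N ×ˢ Metric.ball (0 : K) ε, ∀ i, g i (ψ.symm z) = z.1 i := by
    intro z hz i
    rw [← hψ, ψ.right_inv (hbox hz)]
  have hVz : ∀ z ∈ N ×ˢ Metric.ball (0 : K) ε, ψ.symm z ∈ V := fun z hz =>
    hSV (ψ.map_target (hbox hz))
  have hoff : ∀ z ∈ N ×ˢ Metric.ball (0 : K) ε, (∀ i, z.1 i ≠ 0) → ψ.symm z ∉ range f := by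
    intro z hz hne
    rw [h.mem_range_iff (hVz z hz)]
    rintro ⟨i, hi⟩
    exact hne i ((hcoord z hz i).symm.trans hi)
  have hNmem : ∀ y : ι → ℝ, y ∈ N ↔ ∀ i, |y i| < ε := by
    intro y
    rw [hN, mem_ball_zero_iff, pi_norm_lt_iff hε]
    simp
  have hK0 : (0 : K) ∈ Metric.ball (0 : K) ε := Metric.mem_ball_self hε
  -- the coordinates along the strata do not matter
  have hfibre : ∀ y ∈ N, (∀ i, y i ≠ 0) → ∀ k ∈ Metric.ball (0 : K) ε,
      D (ψ.symm (y, k)) = D (ψ.symm (y, 0)) := by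
    intro y hy hy0 k hk
    refine eq_of_convex_of_locallyConstant (R := range f) hD (C := {y} ×ˢ Metric.ball (0 : K) ε)
      ((convex_singleton y).prod (convex_ball _ _)) ?_ ?_ ⟨rfl, hk⟩ ⟨rfl, hK0⟩
    · rintro z ⟨hz1, hz2⟩
      exact hbox ⟨by rw [mem_singleton_iff.1 hz1]; exact hy, hz2⟩
    · rintro z ⟨hz1, hz2⟩
      rw [mem_singleton_iff] at hz1
      exact hoff z ⟨by rw [hz1]; exact hy, hz2⟩ (by rw [hz1]; exact hy0)
  set H : (ι → ℝ) → ℚ := fun y => D (ψ.symm (y, 0)) with hH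
  have hline : ∀ y ∈ N, (∀ i, y i ≠ 0) → ∀ i, ∀ u : ℝ, |u| < ε → u ≠ 0 →
      H (Function.update y i u) = H y := by
    intro y hy hy0 i
    have hupd : ∀ u : ℝ, |u| < ε → Function.update y i u ∈ N := by
      intro u hu
      rw [hNmem]
      intro j
      rcases eq_or_ne j i with rfl | hj
      · simpa using hu
      · simpa [hj] using (hNmem y).1 hy j
    have hside : ∀ σ : ℝ, ∀ u v : ℝ, |u| < ε → |v| < ε → 0 < σ * u → 0 < σ * v →
        H (Function.update y i u) = H (Function.update y i v) := by
      intro σ u v hu hv hσu hσv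
      have hlin : IsLinearMap ℝ (fun z : (ι → ℝ) × K => σ * z.1 i) :=
        ⟨fun a b => by simp [mul_add], fun c a => by simp; ring⟩
      have hconv : Convex ℝ {z : (ι → ℝ) × K | (∀ j, j ≠ i → z.1 j = y j) ∧ z.2 = 0} := by
        rintro z ⟨hz, hz2⟩ z' ⟨hz', hz2'⟩ α β - - hαβ
        refine ⟨fun j hj => ?_, by simp [hz2, hz2']⟩
        simp [hz j hj, hz' j hj, ← add_mul, hαβ]
      refine eq_of_convex_of_locallyConstant (R := range f) hD
        (C := (N ×ˢ Metric.ball (0 : K) ε) ∩ {z | (∀ j, j ≠ i → z.1 j = y j) ∧ z.2 = 0} ∩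
          {z | 0 < σ * z.1 i}) ((((convex_ball _ _).prod (convex_ball _ _)).inter hconv).inter
          (convex_halfSpace_gt hlin 0)) (fun z hz => hbox hz.1.1) (fun z hz => ?_) ?_ ?_
      · refine hoff z hz.1.1 fun j => ?_
        rcases eq_or_ne j i with rfl | hj
        · intro hj
          have := hz.2
          simp [hj] at this
        · rw [hz.1.2.1 j hj]
          exact hy0 j
      · exact ⟨⟨⟨hupd u hu, hK0⟩, fun j hj => by simp [hj], rfl⟩, by simpa using hσu⟩
      · exact ⟨⟨⟨hupd v hv, hK0⟩, fun j hj => by simp [hj], rfl⟩, by simpa using hσv⟩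
    -- on the hyperplane `u = 0` there is a simple point of the image
    have hcross : ∃ u v : ℝ, |u| < ε ∧ |v| < ε ∧ 0 < u ∧ v < 0 ∧
        H (Function.update y i u) = H (Function.update y i v) := by
      set z₀ : (ι → ℝ) × K := (Function.update y i 0, 0) with hz₀
      have hz₀m : z₀ ∈ N ×ˢ Metric.ball (0 : K) ε := ⟨hupd 0 (by simpa using hε), hK0⟩
      set x₀ := ψ.symm z₀ with hx₀
      obtain ⟨e, -⟩ := h.fiber x₀ (hVz z₀ hz₀m)
      have hgi : g i x₀ = 0 := by rw [hcoord z₀ hz₀m]; simp [hz₀]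
      have hgj : ∀ j, g j x₀ = 0 → j = i := by
        intro j hj
        rw [hcoord z₀ hz₀m] at hj
        by_contra hji
        simp [hz₀, hji] at hj
        exact hy0 j hj
      have hq : f (e ⟨i, hgi⟩) = x₀ := (e ⟨i, hgi⟩).2
      have hsingle : f ⁻¹' {f (e ⟨i, hgi⟩)} = {(e ⟨i, hgi⟩ : M)} := by
        ext r
        rw [hq]
        constructor
        · intro hr
          have h1 : e.symm ⟨r, hr⟩ = ⟨i, hgi⟩ := Subtype.ext (hgj _ (e.symm ⟨r, hr⟩).2)
          have h2 := congrArg e h1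
          rw [e.apply_symm_apply] at h2
          exact congrArg Subtype.val h2
        · rintro rfl
          exact hq
      obtain ⟨d, hd⟩ := hsimple _ hsingle
      rw [hq] at hd
      have hcont : ContinuousAt (fun u : ℝ => ψ.symm (Function.update y i u, (0 : K))) 0 := by
        refine ContinuousAt.comp (f := fun u : ℝ => (Function.update y i u, (0 : K)))
          (ψ.continuousAt_symm (hbox hz₀m)) ?_
        exact ((continuous_const.update i continuous_id).prodMk continuous_const).continuousAt
      have hsmall : ∀ᶠ u : ℝ in 𝓝 0, |u| < ε ∧ (u ≠ 0 → H (Function.update y i u) = d) := by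
        have h1 : ∀ᶠ u : ℝ in 𝓝 0, |u| < ε := by
          have : ContinuousAt (fun u : ℝ => |u|) 0 := by fun_prop
          exact this.eventually (gt_mem_nhds (by simpa using hε))
        filter_upwards [h1, hcont.eventually hd] with u hu hu'
        refine ⟨hu, fun hu0 => hu' (hoff _ ⟨hupd u hu, hK0⟩ fun j => ?_)⟩
        rcases eq_or_ne j i with rfl | hj
        · simpa using hu0
        · simpa [hj] using hy0 j
      obtain ⟨u, hu, hu0⟩ := ((hsmall.filter_mono
        (nhdsWithin_le_nhds (s := Ioi (0 : ℝ)))).and self_mem_nhdsWithin).exists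
      obtain ⟨v, hv, hv0⟩ := ((hsmall.filter_mono
        (nhdsWithin_le_nhds (s := Iio (0 : ℝ)))).and self_mem_nhdsWithin).exists
      exact ⟨u, v, hu.1, hv.1, hu0, hv0, (hu.2 (ne_of_gt hu0)).trans (hv.2 (ne_of_lt hv0)).symm⟩
    obtain ⟨u₁, v₁, hu₁, hv₁, hu₁0, hv₁0, huv⟩ := hcross
    have hall : ∀ u : ℝ, |u| < ε → u ≠ 0 →
        H (Function.update y i u) = H (Function.update y i u₁) := by
      intro u hu hu0
      rcases lt_or_gt_of_ne hu0 with hlt | hgt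
      · rw [huv]
        exact hside (-1) u v₁ hu hv₁ (by linarith) (by linarith)
      · exact hside 1 u u₁ hu hu₁ (by linarith) (by linarith)
    intro u hu hu0
    rw [hall u hu hu0, ← hall (y i) ((hNmem y).1 hy i) (hy0 i), Function.update_eq_self]
  have hpiece : ∀ y ∈ N, (∀ i, y i ≠ 0) → ∀ y' ∈ N, (∀ i, y' i ≠ 0) → ∀ s : Finset ι,
      H (s.piecewise y' y) = H y := by
    intro y hy hy0 y' hy' hy0' s
    induction s using Finset.induction_on with
    | empty => simp
    | insert i s _ ih =>
      rw [Finset.piecewise_insert, hline, ih]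
      · rw [hNmem] at hy hy' ⊢
        intro j
        by_cases hj : j ∈ s
        · simpa [hj] using hy' j
        · simpa [hj] using hy j
      · intro j
        by_cases hj : j ∈ s
        · simpa [hj] using hy0' j
        · simpa [hj] using hy0 j
      · exact (hNmem y').1 hy' i
      · exact hy0' i
  have hU : ∀ᶠ x in 𝓝 p, x ∈ ψ.source ∧ ψ x ∈ N ×ˢ Metric.ball (0 : K) ε := by
    refine inter_mem (ψ.open_source.mem_nhds hpS) ((ψ.continuousAt hpS).eventually ?_)
    rw [hψp]
    exact (Metric.isOpen_ball.prod Metric.isOpen_ball).mem_nhds (by simp [hε])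
  have hy₁ : (fun _ => ε / 2 : ι → ℝ) ∈ N := by
    rw [hNmem]
    intro i
    rw [abs_of_pos (by positivity)]
    linarith
  refine ⟨H fun _ => ε / 2, ?_⟩
  filter_upwards [hU] with x hx hxr
  have hx0 : ∀ i, (ψ x).1 i ≠ 0 := by
    intro i hi
    rw [hψ] at hi
    exact hxr ((h.mem_range_iff (hSV hx.1)).2 ⟨i, hi⟩)
  have h1 := hfibre (ψ x).1 hx.2.1 hx0 (ψ x).2 hx.2.2
  rw [Prod.mk.eta, ψ.left_inv hx.1] at h1
  have h2 := hpiece _ hx.2.1 hx0 _ hy₁ (fun _ => by positivity) Finset.univ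
  rw [Finset.piecewise_univ] at h2
  rw [h1, h2]

/-- A generic immersion has at most one Alexander numbering. The difference of two of them does not
jump at the simple points of the image, hence extends to a locally constant function `d` on the
whole space, which vanishes at infinity. -/
theorem IsAlexanderNumbering.unique [CompactSpace M] {f : M → E3} (hf : Continuous f)
    (hchart : ∀ p, ∃ (g : f ⁻¹' {p} → E3 → ℝ) (V : Set E3), IsSheetChart f g V ∧ p ∈ V ∧
      ∀ i, g i p = 0) (hne : ∀ q, conormal f q ≠ 0) (ht : ∀ p, IsTransverseAt f p)
    {A B : E3 → ℚ} (hA : IsAlexanderNumbering f A) (hB : IsAlexanderNumbering f B) : A = B := by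
  set D : E3 → ℚ := fun x => A x - B x with hDdef
  have hD : ∀ x ∉ range f, ∀ᶠ y in 𝓝 x, D y = D x := by
    intro x hx
    filter_upwards [hA.locallyConstant x hx, hB.locallyConstant x hx] with y h1 h2
    simp only [hDdef, h1, h2]
  have hloc : ∀ p, ∃ d, ∀ᶠ x in 𝓝 p, x ∉ range f → D x = d := by
    intro p
    obtain ⟨g, V, h, hp, h0⟩ := hchart p
    have := h.finite
    have := Fintype.ofFinite (f ⁻¹' {p})
    refine exists_eventually_eq_of_isTransverseAt h hp h0 (ht p) hD fun q hq => ?_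
    obtain ⟨g', V', h', hp', h0'⟩ := hchart (f q)
    have := h'.finite
    have := Fintype.ofFinite (f ⁻¹' {f q})
    refine exists_eventually_eq_of_subsingleton h' hp' h0' (ht _) hD hq ?_ (hne q)
    filter_upwards [hA.crossing q hq, hB.crossing q hq] with s h1 h2
    simp only [hDdef, h1, h2]
    ring
  -- the image has no interior, so the local values `d p` are determined by `D`
  have hfreq : ∀ p, ∃ᶠ x in 𝓝 p, x ∉ range f := by
    intro p
    obtain ⟨g, V, h, hp, h0⟩ := hchart p
    have := h.finite
    obtain ⟨v, hv⟩ := h.exists_fderiv_eq hp (ht p) (fun _ => 1)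
    have hcont : Tendsto (fun s : ℝ => p + s • v) (𝓝[>] 0) (𝓝 p) := by
      have : ContinuousAt (fun s : ℝ => p + s • v) 0 := by fun_prop
      have h1 : Tendsto (fun s : ℝ => p + s • v) (𝓝 0) (𝓝 p) := by
        simpa [ContinuousAt] using this
      exact h1.mono_left nhdsWithin_le_nhds
    refine hcont.frequently (Eventually.frequently ?_)
    have h1 : ∀ᶠ s : ℝ in 𝓝[>] 0, ∀ i, 0 < g i (p + s • v) := by
      rw [eventually_all]
      intro i
      exact eventually_pos_of_fderiv_pos (h.differentiableAt hp i) (h0 i)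
        (by rw [hv i (h0 i)]; norm_num)
    filter_upwards [h1, hcont.eventually (h.isOpen.mem_nhds hp)] with s hs hsV
    rw [h.mem_range_iff hsV]
    rintro ⟨i, hi⟩
    exact (hs i).ne' hi
  choose d hd using hloc
  have hdloc : ∀ p, ∀ᶠ p' in 𝓝 p, d p' = d p := by
    intro p
    filter_upwards [(hd p).eventually_nhds] with p' hp'
    obtain ⟨x, hx, h1, h2⟩ := ((hfreq p').and_eventually (hp'.and (hd p'))).exists
    rw [← h1 hx, ← h2 hx]
  have hdconst : ∀ p p', d p = d p' := fun p p' =>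
    eq_of_isPreconnected_of_eventually_eq isPreconnected_univ
      (fun x _ => mem_nhdsWithin_of_mem_nhds (hdloc x)) (mem_univ p) (mem_univ p')
  have hDd : ∀ x ∉ range f, D x = d x := fun x hx => (hd x).self_of_nhds hx
  have hoff : ∀ᶠ x in Bornology.cobounded E3, x ∉ range f :=
    Bornology.isBounded_def.1 (isCompact_range hf).isBounded
  obtain ⟨x₁, h1, h2, h3⟩ := (hoff.and (hA.infinity.and hB.infinity)).exists
  have hd0 : d x₁ = 0 := by rw [← hDd x₁ h1, hDdef]; simp [h2, h3]
  funext x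
  by_cases hx : x ∈ range f
  · rw [hA.image x hx, hB.image x hx]
  · have := hDd x hx
    rw [hdconst x x₁, hd0] at this
    exact sub_eq_zero.1 this

end Surface

/-! ### The index of a triple point -/

/-- The eight choices of sides of three sheets have in all twelve positive sides. -/
theorem finsum_sign_card {κ : Type*} (hκ : Nat.card κ = 3) (k : ℚ) :
    ∑ᶠ ε : κ → ℤˣ, (k + ({q | ε q = 1}.ncard : ℚ)) = 8 * k + 12 := by
  have : Finite κ := Nat.finite_of_card_ne_zero (by omega)
  let φ : κ ≃ Fin 3 := Finite.equivFinOfCardEq hκ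
  have h1 : ∀ ε : κ → ℤˣ, {q | ε q = 1}.ncard
      = (Finset.univ.filter fun i => (φ.arrowCongr (Equiv.refl ℤˣ)) ε i = 1).card := by
    intro ε
    rw [← ncard_coe_finset, ← ncard_image_of_injective _ φ.injective]
    congr 1
    ext i
    simp only [mem_image, mem_ofPred_eq, Finset.coe_filter, Finset.mem_univ, true_and]
    constructor
    · rintro ⟨q, hq, rfl⟩
      simpa using hq
    · intro hi
      exact ⟨φ.symm i, hi, by simp⟩
  simp only [h1]
  rw [finsum_comp_equiv (φ.arrowCongr (Equiv.refl ℤˣ)) (f := fun ε : Fin 3 → ℤˣ =>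
    k + ((Finset.univ.filter fun i => ε i = 1).card : ℚ)), finsum_eq_sum_of_fintype,
    Finset.sum_add_distrib, Finset.sum_const]
  have h2 : ∑ ε : Fin 3 → ℤˣ, (Finset.univ.filter fun i => ε i = 1).card = 12 := by decide
  have h3 : (Finset.univ : Finset (Fin 3 → ℤˣ)).card = 8 := by decide
  rw [h3, ← Nat.cast_sum, h2]
  norm_num

section Surface

variable {M : Type*} [TopologicalSpace M] [ChartedSpace E2 M]

/-- Going from `p` into an octant, one gets to the positive side of the sheets through `p` that the
octant prescribes, and crosses no other sheet. -/
theorem IsSheetChart.eventually_octant {ι : Type*} {f : M → E3} {g : ι → E3 → ℝ} {V : Set E3}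
    (h : IsSheetChart f g V) {p : E3} (hp : p ∈ V) {ε : f ⁻¹' {p} → ℤˣ} {v : E3}
    (hv : ∀ q : f ⁻¹' {p}, 0 < ((ε q : ℤ) : ℝ) * inner ℝ (conormal f q) v) :
    ∀ᶠ s : ℝ in 𝓝[>] 0, p + s • v ∉ range f ∧
      sideCount g (p + s • v) = sideCount g p + ({q | ε q = 1}.ncard : ℚ) := by
  have := h.finite
  obtain ⟨e, he⟩ := h.fiber p hp
  have : Finite (f ⁻¹' {p}) := Finite.of_equiv _ e
  have hline : Tendsto (fun s : ℝ => p + s • v) (𝓝[>] 0) (𝓝 p) := by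
    have h1 : Tendsto (fun s : ℝ => p + s • v) (𝓝 0) (𝓝 (p + (0 : ℝ) • v)) :=
      Continuous.tendsto (by fun_prop) 0
    rw [zero_smul, add_zero] at h1
    exact h1.mono_left nhdsWithin_le_nhds
  have hsign : ∀ i, ∀ᶠ s : ℝ in 𝓝[>] 0, g i (p + s • v) ≠ 0 ∧
      (0 < g i (p + s • v) ↔ 0 < g i p ∨ ∃ hi : g i p = 0, ε (e ⟨i, hi⟩) = 1) := by
    intro i
    by_cases hi : g i p = 0
    · obtain ⟨μ, hμ, hgrad⟩ := he ⟨i, hi⟩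
      have hvi := hv (e ⟨i, hi⟩)
      rcases Int.units_eq_one_or (ε (e ⟨i, hi⟩)) with h1 | h1
      · rw [h1] at hvi
        have hvi' : 0 < inner ℝ (conormal f (e ⟨i, hi⟩)) v := by simpa using hvi
        filter_upwards [eventually_pos_of_fderiv_pos (h.differentiableAt hp i) hi
          (by rw [hgrad]; positivity)] with s hs
        exact ⟨hs.ne', fun _ => Or.inr ⟨hi, h1⟩, fun _ => hs⟩
      · rw [h1] at hvi
        have hvi' : inner ℝ (conormal f (e ⟨i, hi⟩)) v < 0 := by simpa using hvi
        filter_upwards [eventually_neg_of_fderiv_neg (h.differentiableAt hp i) hi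
          (by rw [hgrad]; exact mul_neg_of_pos_of_neg hμ hvi')] with s hs
        refine ⟨hs.ne, fun h => absurd h (not_lt.2 hs.le), ?_⟩
        rintro (h2 | ⟨_, h2⟩)
        · exact absurd hi h2.ne'
        · rw [h1] at h2
          exact absurd h2 (by decide)
    · have hc := (h.contDiffAt hp i).continuousAt
      have hnot : ¬ ∃ hi : g i p = 0, ε (e ⟨i, hi⟩) = 1 := fun ⟨h, _⟩ => hi h
      simp only [hnot, or_false]
      rcases lt_or_gt_of_ne hi with hlt | hgt
      · filter_upwards [hline.eventually (hc.eventually (gt_mem_nhds hlt))] with s hs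
        exact ⟨hs.ne, fun h => absurd h (not_lt.2 hs.le), fun h => absurd h (not_lt.2 hlt.le)⟩
      · filter_upwards [hline.eventually (hc.eventually (lt_mem_nhds hgt))] with s hs
        exact ⟨hs.ne', fun _ => hgt, fun _ => hs⟩
  filter_upwards [eventually_all.2 hsign, hline.eventually (h.isOpen.mem_nhds hp)] with s hs hsV
  constructor
  · rw [h.mem_range_iff hsV]
    rintro ⟨i, hi⟩
    exact (hs i).1 hi
  · have hinj : Function.Injective (fun q => (e.symm q).1) :=
      Subtype.val_injective.comp e.symm.injective
    have hset : {i | 0 < g i (p + s • v)}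
        = {i | 0 < g i p} ∪ (fun q => (e.symm q).1) '' {q | ε q = 1} := by
      ext i
      simp only [mem_ofPred_eq, mem_union, mem_image, (hs i).2]
      refine or_congr_right ⟨?_, ?_⟩
      · rintro ⟨hi, h1⟩
        exact ⟨e ⟨i, hi⟩, h1, by simp⟩
      · rintro ⟨q, hq, rfl⟩
        exact ⟨(e.symm q).2, by simpa using hq⟩
    rw [sideCount, sideCount, hset, ncard_union_eq, ncard_image_of_injective _ hinj]
    · push_cast; rfl
    · refine Set.disjoint_left.2 ?_
      rintro _ hi ⟨q, -, rfl⟩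
      rw [mem_ofPred_eq, (e.symm q).2] at hi
      exact lt_irrefl _ hi

/-- The index of a triple point in terms of equations of the sheets in a neighbourhood, some of which
may not pass through it: the mean over the eight octants adds `3 / 2` to the value of the numbering
in the octant on the negative side of the three sheets. -/
theorem tripleIndex_eq {ι : Type*} {f : M → E3} {g : ι → E3 → ℝ} {V : Set E3}
    (h : IsSheetChart f g V) {p : E3} (hp : p ∈ V) (ht : IsTransverseAt f p)
    (h3 : p ∈ triplePoints f) {c : ℚ}
    (hA : ∀ᶠ x in 𝓝 p, x ∉ range f → alexanderNumbering f x = sideCount g x + c) :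
    tripleIndex f p = sideCount g p + c + 3 / 2 := by
  have hoct : ∀ ε : f ⁻¹' {p} → ℤˣ,
      octantIndex f p ε = sideCount g p + c + ({q | ε q = 1}.ncard : ℚ) := by
    intro ε
    have hval : ∀ v : E3, (∀ q : f ⁻¹' {p}, 0 < ((ε q : ℤ) : ℝ) * inner ℝ (conormal f q) v) →
        ∀ᶠ s : ℝ in 𝓝[>] 0, alexanderNumbering f (p + s • v)
          = sideCount g p + c + ({q | ε q = 1}.ncard : ℚ) := by
      intro v hv
      have hline : Tendsto (fun s : ℝ => p + s • v) (𝓝[>] 0) (𝓝 p) := by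
        have h1 : Tendsto (fun s : ℝ => p + s • v) (𝓝 0) (𝓝 (p + (0 : ℝ) • v)) :=
          Continuous.tendsto (by fun_prop) 0
        rw [zero_smul, add_zero] at h1
        exact h1.mono_left nhdsWithin_le_nhds
      filter_upwards [h.eventually_octant hp hv, hline.eventually hA] with s hs hs'
      rw [hs' hs.1, hs.2]
      ring
    have hspec := Classical.epsilon_spec (p := fun c : ℚ =>
      ∀ v : E3, (∀ q : f ⁻¹' {p}, 0 < ((ε q : ℤ) : ℝ) * inner ℝ (conormal f q) v) →
        ∀ᶠ s : ℝ in 𝓝[>] 0, alexanderNumbering f (p + s • v) = c) ⟨_, hval⟩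
    -- the octant is not empty
    obtain ⟨v, hv⟩ := exists_inner_eq_of_linearIndependent ht (fun q => ((ε q : ℤ) : ℝ))
    have hvo : ∀ q : f ⁻¹' {p}, 0 < ((ε q : ℤ) : ℝ) * inner ℝ (conormal f q) v := by
      intro q
      rw [hv q]
      rcases Int.units_eq_one_or (ε q) with h1 | h1 <;> simp [h1]
    obtain ⟨s, h1, h2⟩ := ((hspec v hvo).and (hval v hvo)).exists
    exact h1.symm.trans h2
  have hcard : Nat.card (f ⁻¹' {p}) = 3 := by
    have : (f ⁻¹' {p}).encard = 3 := h3
    rw [Nat.card_coe_set_eq, ncard, this]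
    rfl
  rw [tripleIndex]
  simp only [hoct]
  rw [finsum_sign_card hcard]
  ring

/-- The Alexander numbering of a generic immersion exists, is unique, and is given by the numbering
of space-time. -/
theorem existsUnique_isAlexanderNumbering [CompactSpace M] {F : ℝ → M → E3} {a b : ℝ}
    {A : ℝ × E3 → ℚ} (hA : HasSheetJumps F (Ioo a b) A)
    (hinf : ∀ t ∈ Ioo a b, ∀ᶠ x in Bornology.cobounded E3, A (t, x) = -3 / 2) {t : ℝ}
    (ht : t ∈ Ioo a b) (hgen : IsGenericImmersion (F t)) :
    (∃! B, IsAlexanderNumbering (F t) B) ∧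
      ∀ x ∉ range (F t), alexanderNumbering (F t) x = A (t, x) := by
  classical
  have hjump := hA.hasSideJumps ht
  have hne : ∀ q, conormal (F t) q ≠ 0 := fun q => conormal_ne_zero (hgen.1.2 q)
  have hex := hjump.isAlexanderNumbering hgen.1.1.continuous (hinf t ht) hne
  have huniq : ∀ B, IsAlexanderNumbering (F t) B → B = _ := fun B hB =>
    IsAlexanderNumbering.unique hgen.1.1.continuous (fun p => by
      obtain ⟨g, V, h, hp, h0, -⟩ := hjump p
      exact ⟨g, V, h, hp, h0⟩) hne hgen.2 hB hex
  refine ⟨⟨_, hex, huniq⟩, fun x hx => ?_⟩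
  have hspec : IsAlexanderNumbering (F t) (alexanderNumbering (F t)) :=
    Classical.epsilon_spec ⟨_, hex⟩
  rw [huniq _ hspec]
  exact if_neg hx

/-! ### Curves of triple points -/

/-- The implicit function theorem, applied to `(t, x) ↦ (t, γ (t, x))`. -/
theorem exists_curve_of_zeros {κ : Type*} [Fintype κ] (hκ : Fintype.card κ = 3)
    {γ : κ → ℝ × E3 → ℝ} {t₀ : ℝ} {p : E3} (hγ : ∀ k, ContDiffAt ℝ 1 (γ k) (t₀, p))
    (h0 : ∀ k, γ k (t₀, p) = 0)
    (hinj : ∀ v : E3, (∀ k, fderiv ℝ (γ k) (t₀, p) (0, v) = 0) → v = 0) :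
    ∃ x : ℝ → E3, DifferentiableAt ℝ x t₀ ∧ x t₀ = p ∧
      ∀ᶠ y in 𝓝 (t₀, p), (∀ k, γ k y = 0) ↔ y.2 = x y.1 := by
  set Φ : ℝ × E3 → ℝ × (κ → ℝ) := fun y => (y.1, fun k => γ k y) with hΦ
  have hΦc : ContDiffAt ℝ 1 Φ (t₀, p) := contDiffAt_fst.prodMk (contDiffAt_pi.2 hγ)
  have hder : HasFDerivAt Φ ((ContinuousLinearMap.fst ℝ ℝ E3).prod
      (ContinuousLinearMap.pi fun k => fderiv ℝ (γ k) (t₀, p))) (t₀, p) :=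
    hasFDerivAt_fst.prodMk (hasFDerivAt_pi.2 fun k =>
      ((hγ k).differentiableAt (by simp)).hasFDerivAt)
  have hinjΦ : Function.Injective (fderiv ℝ Φ (t₀, p)) := by
    rw [injective_iff_map_eq_zero, hder.fderiv]
    rintro ⟨τ, v⟩ h
    obtain ⟨h1, h2⟩ := Prod.mk.inj h
    change τ = 0 at h1
    subst h1
    rw [hinj v fun k => congrFun h2 k]
    rfl
  obtain ⟨ψ, hψ, hpψ, -, -, hψs⟩ := exists_openPartialHomeomorph_of_injective
    (by simp [E3, hκ]) hΦc hinjΦ univ_mem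
  have hΦp : Φ (t₀, p) = (t₀, 0) := Prod.ext rfl (funext h0)
  have htgt : (t₀, (0 : κ → ℝ)) ∈ ψ.target := by
    have := ψ.map_source hpψ
    rwa [hψ, hΦp] at this
  have hsymm : ψ.symm (t₀, 0) = (t₀, p) := by
    have := ψ.left_inv hpψ
    rwa [hψ, hΦp] at this
  refine ⟨fun t => (ψ.symm (t, 0)).2, ?_, by simp [hsymm], ?_⟩
  · have h1 : DifferentiableAt ℝ (fun t : ℝ => (t, (0 : κ → ℝ))) t₀ := by fun_prop
    have h2 : DifferentiableAt ℝ ψ.symm (t₀, (0 : κ → ℝ)) :=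
      (hψs _ htgt).differentiableAt (by simp)
    exact (DifferentiableAt.comp (f := fun t : ℝ => (t, (0 : κ → ℝ))) t₀ h2 h1).snd
  · have hc : ContinuousAt (fun y : ℝ × E3 => (y.1, (0 : κ → ℝ))) (t₀, p) := by fun_prop
    filter_upwards [ψ.open_source.mem_nhds hpψ,
      hc.eventually (ψ.open_target.mem_nhds htgt)] with y hy hyt
    have hr := ψ.right_inv hyt
    rw [hψ] at hr
    constructor
    · intro h
      have h1 := ψ.left_inv hy
      rw [hψ, show Φ y = (y.1, 0) from Prod.ext rfl (funext h)] at h1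
      rw [h1]
    · intro h k
      have h1 : ψ.symm (y.1, 0) = y := Prod.ext (congrArg Prod.fst hr :) h.symm
      rw [h1] at hr
      exact congrFun (congrArg Prod.snd hr) k

namespace IsLocalModel

variable {ι : Type*} {F : ℝ → M → E3} {t₀ : ℝ} {p : E3} {pt : ι → M}
  {g : ι → ℝ × E3 → ℝ} {W : ι → Set (ℝ × M)} {V : Set (ℝ × E3)}

theorem contDiffAt (h : IsLocalModel F t₀ p pt g W V) {x : ℝ × E3} (hx : x ∈ V) (i : ι) :
    ContDiffAt ℝ 1 (g i) x := (h.sheet i).contDiffOn.contDiffAt (h.isOpen.mem_nhds hx)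

theorem zero (h : IsLocalModel F t₀ p pt g W V) (i : ι) : g i (t₀, p) = 0 := by
  have := (h.sheet i).zero _ (h.mem_sheet i)
  rwa [h.apply_pt] at this

theorem exists_grad (h : IsLocalModel F t₀ p pt g W V) (i : ι) : ∃ μ > 0, ∀ v,
    fderiv ℝ (g i) (t₀, p) (0, v) = μ * inner ℝ (conormal (F t₀) (pt i)) v := by
  have := (h.sheet i).grad _ (h.mem_sheet i)
  simpa only [h.apply_pt] using this

/-- The curve of triple points at which three given sheets of a local model meet. -/
theorem exists_triple_curve (h : IsLocalModel F t₀ p pt g W V) {s : Finset ι} (hs : s.card = 3)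
    (hind : LinearIndependent ℝ (fun k : s => conormal (F t₀) (pt k))) :
    ∃ x : ℝ → E3, DifferentiableAt ℝ x t₀ ∧ x t₀ = p ∧
      ∀ᶠ y in 𝓝 (t₀, p), (∀ k ∈ s, g k y = 0) ↔ y.2 = x y.1 := by
  obtain ⟨x, hx, hx0, hxU⟩ := exists_curve_of_zeros (κ := s) (γ := fun k => g k) (by simpa using hs)
    (fun k => h.contDiffAt h.mem k) (fun k => h.zero k) (by
      intro v hv
      have hperp : ∀ k : s, inner ℝ (conormal (F t₀) (pt k)) v = 0 := by
        intro k
        obtain ⟨μ, hμ, hgrad⟩ := h.exists_grad k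
        have := hv k
        rw [hgrad] at this
        exact (mul_eq_zero.1 this).resolve_left hμ.ne'
      have : Nonempty s := (Finset.card_pos.1 (by omega)).to_subtype
      have hspan : Submodule.span ℝ (range fun k : s => conormal (F t₀) (pt k)) = ⊤ :=
        hind.span_eq_top_of_card_eq_finrank (by simp [hs, E3])
      have hmem : v ∈ Submodule.span ℝ (range fun k : s => conormal (F t₀) (pt k)) := by
        rw [hspan]; trivial
      have hall : ∀ w ∈ Submodule.span ℝ (range fun k : s => conormal (F t₀) (pt k)),
          inner ℝ w v = 0 := by
        intro w hw
        induction hw using Submodule.span_induction with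
        | mem w hw => obtain ⟨k, rfl⟩ := hw; exact hperp k
        | zero => simp
        | add a b _ _ ha hb => rw [inner_add_left, ha, hb, add_zero]
        | smul r a _ ha => rw [real_inner_smul_left, ha, mul_zero]
      exact inner_self_eq_zero.1 (hall v hmem))
  refine ⟨x, hx, hx0, ?_⟩
  filter_upwards [hxU] with y hy
  rw [← hy]
  exact ⟨fun h k => h k k.2, fun h k hk => h ⟨k, hk⟩⟩

theorem mem_triplePoints_iff [Fintype ι] (h : IsLocalModel F t₀ p pt g W V) {y : ℝ × E3}
    (hy : y ∈ V) : y.2 ∈ triplePoints (F y.1) ↔ {i | g i y = 0}.ncard = 3 := by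
  obtain ⟨e, -⟩ := h.exists_equiv_fiber hy
  have hcard : (F y.1 ⁻¹' {y.2}).encard = ({i | g i y = 0} : Set ι).encard :=
    Set.encard_congr e.symm
  rw [triplePoints, mem_ofPred_eq, hcard, ← (Set.toFinite {i | g i y = 0}).cast_ncard_eq]
  norm_cast

end IsLocalModel

end Surface

/-! ### Local contributions to the invariant -/

theorem triplePoints_subset_range {M : Type*} (f : M → E3) : triplePoints f ⊆ range f := by
  intro y hy
  have h1 : (f ⁻¹' {y}).encard = 3 := hy
  have h2 : (f ⁻¹' {y}).Nonempty := by
    rw [← Set.encard_ne_zero, h1]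
    norm_num
  obtain ⟨r, hr⟩ := h2
  exact ⟨r, hr⟩

section Surface

variable {M : Type*} [TopologicalSpace M] [ChartedSpace E2 M]

/-- Along the filter `l` of times, the triple points near `p` contribute `L` to the sum of the
indices. -/
def HasLocalSum (F : ℝ → M → E3) (l : Filter ℝ) (p : E3) (L : ℚ) : Prop :=
  ∃ N ∈ 𝓝 p, ∀ N' ∈ 𝓝 p, N' ⊆ N → ∀ᶠ t in l, (triplePoints (F t) ∩ N').Finite ∧
    ∑ᶠ y ∈ triplePoints (F t) ∩ N', tripleIndex (F t) y = L

/-- The triple points near the centre of a local model all of whose triples of sheets are in general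
position: every triple of sheets contributes one. -/
theorem IsLocalModel.exists_nhds_triplePoints [CompactSpace M] {F : ℝ → M → E3} {a b : ℝ}
    {A : ℝ × E3 → ℚ} (hA : HasSheetJumps F (Ioo a b) A)
    (hinf : ∀ t ∈ Ioo a b, ∀ᶠ x in Bornology.cobounded E3, A (t, x) = -3 / 2)
    {ι : Type*} [Fintype ι] [DecidableEq ι] {t₀ : ℝ} {p : E3} {pt : ι → M} {g : ι → ℝ × E3 → ℝ}
    {W : ι → Set (ℝ × M)} {V : Set (ℝ × E3)} (h : IsLocalModel F t₀ p pt g W V) {c : ℚ}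
    (hc : ∀ᶠ y in 𝓝 (t₀, p), A y = sideCount g y + c) {x : Finset ι → ℝ → E3}
    (hx : ∀ s, s.card = 3 → ContinuousAt (x s) t₀ ∧ x s t₀ = p ∧
      ∀ᶠ y in 𝓝 (t₀, p), (∀ k ∈ s, g k y = 0) ↔ y.2 = x s y.1)
    {l : Filter ℝ} (hl : l ≤ 𝓝 t₀) (hgen : ∀ᶠ t in l, t ∈ Ioo a b ∧ IsGenericImmersion (F t))
    (hne : ∀ s : Finset ι, s.card = 3 → ∀ᶠ t in l, ∀ i ∉ s, g i (t, x s t) ≠ 0) :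
    ∃ N ∈ 𝓝 p, ∀ N' ∈ 𝓝 p, N' ⊆ N → ∀ᶠ t in l,
      triplePoints (F t) ∩ N' = (Finset.univ.powersetCard 3).image (fun s => x s t) ∧
      ∑ᶠ y ∈ triplePoints (F t) ∩ N', tripleIndex (F t) y
        = ∑ s ∈ Finset.univ.powersetCard 3, (sideCount g (t, x s t) + c + 3 / 2) := by
  have hP : ∀ᶠ y in 𝓝 (t₀, p), y ∈ V ∧ (∀ᶠ y' in 𝓝 y, A y' = sideCount g y' + c) ∧
      ∀ s : Finset ι, s.card = 3 → ((∀ k ∈ s, g k y = 0) ↔ y.2 = x s y.1) := by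
    refine inter_mem (h.isOpen.mem_nhds h.mem) (inter_mem hc.eventually_nhds ?_)
    refine eventually_all.2 fun s => ?_
    by_cases hs : s.card = 3
    · simpa [hs] using (hx s hs).2.2
    · simp [hs]
  rw [nhds_prod_eq, eventually_prod_iff] at hP
  obtain ⟨pa, hpa, pb, hpb, hPab⟩ := hP
  refine ⟨{y | pb y}, hpb, fun N' hN' hsub => ?_⟩
  have hmem : ∀ᶠ t in l, ∀ s : Finset ι, s.card = 3 → x s t ∈ N' := by
    refine eventually_all.2 fun s => ?_
    by_cases hs : s.card = 3
    · have h1 := (hx s hs).1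
      rw [ContinuousAt, (hx s hs).2.1] at h1
      filter_upwards [hl (h1.eventually hN')] with t ht _ using ht
    · simp [hs]
  have hne' : ∀ᶠ t in l, ∀ s : Finset ι, s.card = 3 → ∀ i ∉ s, g i (t, x s t) ≠ 0 := by
    refine eventually_all.2 fun s => ?_
    by_cases hs : s.card = 3
    · simpa [hs] using hne s hs
    · simp [hs]
  filter_upwards [hl hpa, hgen, hmem, hne'] with t hta htgen htmem htne
  have hzero : ∀ s : Finset ι, s.card = 3 → {i | g i (t, x s t) = 0} = (s : Set ι) := by
    intro s hs
    have h1 := ((hPab hta (hsub (htmem s hs))).2.2 s hs).2 rfl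
    ext i
    exact ⟨fun hi => by_contra fun his => htne s hs i his hi, fun hi => h1 i hi⟩
  have htriple : ∀ s : Finset ι, s.card = 3 → x s t ∈ triplePoints (F t) := by
    intro s hs
    have h1 := (hPab hta (hsub (htmem s hs))).1
    have h2 := h.mem_triplePoints_iff h1
    rw [h2, hzero s hs, ncard_coe_finset, hs]
  have hset : triplePoints (F t) ∩ N' = (Finset.univ.powersetCard 3).image (fun s => x s t) := by
    ext y
    simp only [Finset.coe_image, mem_image, Finset.mem_coe, Finset.mem_powersetCard,
      Finset.subset_univ, true_and]
    constructor
    · rintro ⟨hyT, hyN⟩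
      have hPy := hPab hta (hsub hyN)
      have h2 := (h.mem_triplePoints_iff hPy.1).1 hyT
      refine ⟨Finset.univ.filter fun i => g i (t, y) = 0, ?_, ?_⟩
      · rw [← ncard_coe_finset]
        simpa using h2
      · refine ((hPy.2.2 _ ?_).1 ?_).symm
        · rw [← ncard_coe_finset]
          simpa using h2
        · simp
    · rintro ⟨s, hs, rfl⟩
      exact ⟨htriple s hs, htmem s hs⟩
  refine ⟨hset, ?_⟩
  rw [hset, finsum_mem_coe_finset, Finset.sum_image]
  · refine Finset.sum_congr rfl fun s hs => ?_
    have hs3 : s.card = 3 := (Finset.mem_powersetCard.1 hs).2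
    have hPy := hPab hta (hsub (htmem s hs3))
    refine tripleIndex_eq (h.isSheetChart t) (p := x s t) hPy.1 (htgen.2.2 _) (htriple s hs3) ?_
    have hcont : ContinuousAt (fun y : E3 => (t, y)) (x s t) := by fun_prop
    filter_upwards [hcont.eventually hPy.2.1] with y hy hyr
    rw [(existsUnique_isAlexanderNumbering hA hinf htgen.1 htgen.2).2 y hyr, hy]
    rfl
  · intro s hs s' hs' heq
    have hs3 : s.card = 3 := (Finset.mem_powersetCard.1 hs).2
    have hs3' : s'.card = 3 := (Finset.mem_powersetCard.1 hs').2
    have h1 := hzero s hs3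
    simp only at heq
    rw [heq, hzero s' hs3'] at h1
    exact (Finset.coe_injective h1).symm

/-- Triple points are stable near a point where the sheets are transverse, and so is their index:
at most three sheets pass through `p`, hence no fourth sheet can change the index. The second
alternative covers the points that no triple point approaches. -/
theorem exists_hasLocalSum_of_isTransverseAt [IsManifold (𝓡 2) ∞ M] [CompactSpace M] [T2Space M]
    (hM : IsOrientedAtlas M) {F : ℝ → M → E3} {a b : ℝ} (hF : IsRegularHomotopy F a b)
    {A : ℝ × E3 → ℚ} (hA : HasSheetJumps F (Ioo a b) A)
    (hinf : ∀ t ∈ Ioo a b, ∀ᶠ x in Bornology.cobounded E3, A (t, x) = -3 / 2)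
    {t₀ : ℝ} (ht₀ : t₀ ∈ Ioo a b) {p : E3} (htr : IsTransverseAt (F t₀) p) :
    ∃ L, ∀ l ≤ 𝓝 t₀, (∀ᶠ t in l, t ∈ Ioo a b ∧ IsGenericImmersion (F t)) →
      HasLocalSum F l p L ∧
      (p ∉ triplePoints (F t₀) → ∃ N ∈ 𝓝 p, ∀ᶠ t in l, triplePoints (F t) ∩ N = ∅) := by
  classical
  obtain ⟨g, W, V, -, h⟩ := exists_isLocalModel hM hF ht₀ p
    (pt := (Subtype.val : F t₀ ⁻¹' {p} → M)) Subtype.val_injective Subtype.range_val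
  have := h.finite
  have := Fintype.ofFinite (F t₀ ⁻¹' {p})
  obtain ⟨c, hc⟩ := hA.exists_eventually_eq hF ht₀ h
  have hcurve : ∀ s : Finset (F t₀ ⁻¹' {p}), ∃ x : ℝ → E3, s.card = 3 →
      DifferentiableAt ℝ x t₀ ∧ x t₀ = p ∧
      ∀ᶠ y in 𝓝 (t₀, p), (∀ k ∈ s, g k y = 0) ↔ y.2 = x y.1 := by
    intro s
    by_cases hs : s.card = 3
    · obtain ⟨x, hx⟩ := h.exists_triple_curve hs
        (LinearIndependent.comp htr (Subtype.val : s → _) Subtype.val_injective)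
      exact ⟨x, fun _ => hx⟩
    · exact ⟨0, fun h => absurd h hs⟩
  choose x hx using hcurve
  have hcard : Fintype.card (F t₀ ⁻¹' {p}) ≤ 3 := by
    have := htr.fintype_card_le_finrank
    simpa [E3] using this
  have huniv : ∀ s : Finset (F t₀ ⁻¹' {p}), s.card = 3 → s = Finset.univ := fun s hs =>
    Finset.eq_univ_of_card s (le_antisymm (Finset.card_le_univ s) (hs ▸ hcard))
  refine ⟨(Finset.univ.powersetCard 3 : Finset (Finset (F t₀ ⁻¹' {p}))).card • (c + 3 / 2),
    fun l hl hgen => ?_⟩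
  obtain ⟨N, hN, hN'⟩ := h.exists_nhds_triplePoints hA hinf hc
    (fun s hs => ⟨(hx s hs).1.continuousAt, (hx s hs).2⟩) hl hgen
    (fun s hs => Eventually.of_forall fun t i hi => by simp [huniv s hs] at hi)
  constructor
  · refine ⟨N, hN, fun N' hN'' hsub => ?_⟩
    have hzero : ∀ᶠ t in l, ∀ s : Finset (F t₀ ⁻¹' {p}), s.card = 3 →
        ∀ k, g k (t, x s t) = 0 := by
      refine eventually_all.2 fun s => ?_
      by_cases hs : s.card = 3
      · have h1 : ContinuousAt (fun t => (t, x s t)) t₀ :=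
          continuousAt_id.prodMk (hx s hs).1.continuousAt
        rw [ContinuousAt, (hx s hs).2.1] at h1
        filter_upwards [hl (h1.eventually (hx s hs).2.2)] with t ht _ k
        exact ht.2 rfl k (by simp [huniv s hs])
      · simp [hs]
    filter_upwards [hN' N' hN'' hsub, hzero] with t ht htz
    refine ⟨by rw [ht.1]; exact Finset.finite_toSet _, ?_⟩
    rw [ht.2, ← Finset.sum_const]
    refine Finset.sum_congr rfl fun s hs => ?_
    have h1 := htz s (Finset.mem_powersetCard.1 hs).2
    simp [sideCount, h1]
  · intro hp
    refine ⟨N, hN, ?_⟩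
    filter_upwards [hN' N hN subset_rfl] with t ht
    have hne : Fintype.card (F t₀ ⁻¹' {p}) ≠ 3 := by
      intro h3
      refine hp ?_
      rw [triplePoints, mem_ofPred_eq, Set.encard_eq_coe_toFinset_card, Set.toFinset_card, h3]
      rfl
    have hempty : (Finset.univ.powersetCard 3 : Finset (Finset (F t₀ ⁻¹' {p}))) = ∅ := by
      rw [Finset.powersetCard_eq_empty, Finset.card_univ]
      omega
    rw [ht.1, hempty]
    simp

/-- The sum of the indices of the triple points is the sum of the local contributions. -/
theorem eventually_St2_eq [CompactSpace M] {F : ℝ → M → E3} {a b : ℝ}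
    (hF : IsRegularHomotopy F a b) {t₀ : ℝ} (ht₀ : t₀ ∈ Ioo a b) {l : Filter ℝ} (hl : l ≤ 𝓝 t₀)
    (S : Finset E3) {L : E3 → ℚ} (hS : ∀ p ∈ S, HasLocalSum F l p (L p))
    (hSc : ∀ p ∉ S, ∃ N ∈ 𝓝 p, ∀ᶠ t in l, triplePoints (F t) ∩ N = ∅) :
    ∀ᶠ t in l, (triplePoints (F t)).Finite ∧ St2 (F t) = ∑ p ∈ S, L p := by
  obtain ⟨U, hU, hUd⟩ := S.finite_toSet.t2_separation
  choose! N hN hNsum using hS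
  choose! N₀ hN₀ hNempty using hSc
  set N' : E3 → Set E3 := fun p => U p ∩ interior (N p) with hN'
  have hN'o : ∀ p, IsOpen (N' p) := fun p => (hU p).2.inter isOpen_interior
  have hN'm : ∀ p ∈ S, N' p ∈ 𝓝 p := fun p hp =>
    (hN'o p).mem_nhds ⟨(hU p).1, mem_interior_iff_mem_nhds.2 (hN p hp)⟩
  have hO : IsOpen (⋃ p ∈ S, N' p) := isOpen_biUnion fun p _ => hN'o p
  obtain ⟨δ, hδ, hδab⟩ := Metric.isOpen_iff.1 (isOpen_Ioo (a := a) (b := b)) t₀ ht₀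
  set K : Set E3 := (fun y : ℝ × M => F y.1 y.2) '' (Metric.closedBall t₀ (δ / 2) ×ˢ univ) with hK
  have hKc : IsCompact K := by
    refine ((isCompact_closedBall t₀ (δ / 2)).prod isCompact_univ).image_of_continuousOn
      (hF.continuousOn.mono (prod_mono (fun t ht => hδab ?_) subset_rfl))
    rw [Metric.mem_closedBall] at ht
    rw [Metric.mem_ball]
    linarith
  -- at the times close to `t₀` the surface stays in the compact set `K`
  have hKr : ∀ᶠ t in l, ∀ r, F t r ∈ K := by
    filter_upwards [hl (Metric.closedBall_mem_nhds t₀ (half_pos hδ))] with t ht r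
    exact ⟨(t, r), ⟨ht, mem_univ r⟩, rfl⟩
  have hsubset : ∀ᶠ t in l, triplePoints (F t) ⊆ ⋃ p ∈ S, N' p := by
    obtain ⟨T, hcov⟩ := (hKc.diff hO).elim_nhds_subcover' (fun p _ => N₀ p) (fun p hp => by
      refine hN₀ p fun hpS => hp.2 ?_
      exact mem_biUnion hpS (mem_of_mem_nhds (hN'm p hpS)))
    have hev : ∀ᶠ t in l, ∀ p ∈ T, triplePoints (F t) ∩ N₀ p = ∅ := by
      rw [Filter.eventually_all_finset]
      rintro ⟨p, hp⟩ -
      refine hNempty p fun hpS => hp.2 ?_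
      exact mem_biUnion hpS (mem_of_mem_nhds (hN'm p hpS))
    filter_upwards [hKr, hev] with t htK ht y hy
    by_contra hyO
    have hyr : y ∈ K := by
      obtain ⟨r, rfl⟩ := triplePoints_subset_range (F t) hy
      exact htK r
    obtain ⟨p, hpT, hyp⟩ := mem_iUnion₂.1 (hcov ⟨hyr, hyO⟩)
    have : y ∈ triplePoints (F t) ∩ N₀ p := ⟨hy, hyp⟩
    rw [ht p hpT] at this
    exact this
  have hsum : ∀ᶠ t in l, ∀ p ∈ S, (triplePoints (F t) ∩ N' p).Finite ∧
      ∑ᶠ y ∈ triplePoints (F t) ∩ N' p, tripleIndex (F t) y = L p := by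
    rw [Filter.eventually_all_finset]
    intro p hp
    exact hNsum p hp (N' p) (hN'm p hp) (inter_subset_right.trans interior_subset)
  filter_upwards [hsubset, hsum] with t ht hts
  have hT : triplePoints (F t) = ⋃ p ∈ (S : Set E3), triplePoints (F t) ∩ N' p := by
    rw [← inter_iUnion₂]
    exact (inter_eq_left.2 ht).symm
  constructor
  · rw [hT]
    exact S.finite_toSet.biUnion fun p hp => (hts p hp).1
  · rw [St2, hT, finsum_mem_biUnion, finsum_mem_coe_finset]
    · refine Finset.sum_congr rfl fun p hp => ?_
      exact (hts p hp).2
    · intro p hp p' hp' hne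
      exact (hUd hp hp' hne).mono (fun y hy => hy.2.1) (fun y hy => hy.2.1)
    · exact S.finite_toSet
    · exact fun p hp => (hts p hp).1

end Surface

/-! ### Perpendiculars to the sheets -/

/-- A vector orthogonal to the plane parametrized by `L` is a multiple of its normal. -/
theorem exists_smul_eq_of_inner_eq_zero {L : E2 →L[ℝ] E3} (hL : Function.Injective L) {z : E3}
    (hz : ∀ u, inner ℝ z (L u) = 0) : ∃ s : ℝ, z = s • planeNormal L := by
  set n := planeNormal L
  have hn : n ≠ 0 := planeNormal_ne_zero hL
  have hnn : inner ℝ n n ≠ 0 := (real_inner_self_pos.2 hn).ne'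
  let Φ : E2 × ℝ →ₗ[ℝ] E3 :=
    L.toLinearMap.comp (LinearMap.fst ℝ E2 ℝ) + (LinearMap.snd ℝ E2 ℝ).smulRight n
  have hΦ : ∀ u ζ, Φ (u, ζ) = L u + ζ • n := fun u ζ => rfl
  have hinj : Function.Injective Φ := by
    rw [injective_iff_map_eq_zero]
    rintro ⟨u, ζ⟩ h
    rw [hΦ] at h
    have h1 := congrArg (inner ℝ n) h
    rw [inner_add_right, inner_planeNormal, inner_smul_right, zero_add, inner_zero_right] at h1
    have hζ : ζ = 0 := (mul_eq_zero.1 h1).resolve_right hnn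
    rw [hζ, zero_smul, add_zero] at h
    rw [hζ, hL (h.trans (map_zero L).symm)]
    rfl
  have hsurj : Function.Surjective Φ :=
    (LinearMap.injective_iff_surjective_of_finrank_eq_finrank (by simp [E2, E3])).1 hinj
  refine ⟨inner ℝ z n / inner ℝ n n, ?_⟩
  set y := z - (inner ℝ z n / inner ℝ n n) • n with hy
  have hyL : ∀ u, inner ℝ y (L u) = 0 := by
    intro u
    rw [hy, inner_sub_left, hz, real_inner_smul_left, inner_planeNormal]
    simp
  have hyn : inner ℝ y n = 0 := by
    rw [hy, inner_sub_left, real_inner_smul_left]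
    field_simp
    ring
  obtain ⟨⟨u, ζ⟩, hu⟩ := hsurj y
  have h0 : inner ℝ y y = 0 := by
    nth_rewrite 2 [← hu]
    rw [hΦ, inner_add_right, hyL, inner_smul_right, hyn]
    simp
  exact sub_eq_zero.1 (inner_self_eq_zero.1 h0)

section Surface

variable {M : Type*} [TopologicalSpace M] [ChartedSpace E2 M]

theorem inner_differential_eq_zero_of_isLocalMin [IsManifold (𝓡 2) ∞ M] (hM : IsOrientedAtlas M)
    {f : M → E3} (hf : ContMDiff (𝓡 2) 𝓘(ℝ, E3) ∞ f) {v : E3} {r : M}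
    (hr : IsLocalMin (fun x => ‖f x - v‖ ^ 2) r) (u : E2) :
    inner ℝ (f r - v) (differential f r u) = 0 := by
  set e := chartAt E2 r with he
  have hre : r ∈ e.source := mem_chart_source E2 r
  obtain ⟨hd, T, -, hT⟩ := exists_differential_eq_comp hM hf (chart_mem_atlas E2 r) hre
  have hval : (f ∘ e.symm) (e r) = f r := by simp [hre]
  have hmin : IsLocalMin (fun x => ‖(f ∘ e.symm) x - v‖ ^ 2) (e r) := by
    have hc : ContinuousAt e.symm (e r) := e.continuousAt_symm (e.map_source hre)
    have h1 : Tendsto e.symm (𝓝 (e r)) (𝓝 r) := by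
      rw [ContinuousAt, e.left_inv hre] at hc
      exact hc
    filter_upwards [h1.eventually hr] with x hx
    rw [hval]
    exact hx
  have h1 := hd.hasFDerivAt.sub_const v |>.norm_sq
  have h2 := hmin.hasFDerivAt_eq_zero h1
  have h3 := congrArg (fun Λ : E2 →L[ℝ] ℝ => Λ (T u)) h2
  rw [hT]
  rw [hval] at h3
  simpa [inner_sub_left] using h3

/-- If the sheet of equation `g` is reached from `v` by moving along the conormal at the point that
is reached, then the direction of the motion is given by the sign of `g` at `v`. -/
theorem IsLocalModel.eventually_sign {F : ℝ → M → E3} {a b : ℝ} (hF : IsRegularHomotopy F a b)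
    {ι : Type*} {t₀ : ℝ} (ht₀ : t₀ ∈ Ioo a b)
    {p : E3} {pt : ι → M} {g : ι → ℝ × E3 → ℝ} {W : ι → Set (ℝ × M)} {V : Set (ℝ × E3)}
    (h : IsLocalModel F t₀ p pt g W V) (i : ι) :
    ∃ B ∈ 𝓝 (t₀, p), ∀ t r v, ∀ s : ℝ, (t, r) ∈ W i → (t, F t r) ∈ B → (t, v) ∈ B →
      v + s • conormal (F t) r = F t r → (0 < s ↔ g i (t, v) < 0) := by
  -- the spatial gradient of the equation
  set G : ℝ × E3 → E3 := fun y => (InnerProductSpace.toDual ℝ E3).symm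
    ((fderiv ℝ (g i) y).comp (ContinuousLinearMap.inr ℝ ℝ E3)) with hG
  have hGi : ∀ y v, inner ℝ (G y) v = fderiv ℝ (g i) y (0, v) := by
    intro y v
    rw [hG, InnerProductSpace.toDual_symm_apply]
    simp
  have hGc : ContinuousAt G (t₀, p) := by
    have h1 : ContinuousAt (fderiv ℝ (g i)) (t₀, p) :=
      (h.contDiffAt h.mem i).continuousAt_fderiv (by simp)
    exact (InnerProductSpace.toDual ℝ E3).symm.continuous.continuousAt.comp
      (h1.clm_comp continuousAt_const)
  have hG0 : G (t₀, p) ≠ 0 := by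
    intro h0
    obtain ⟨μ, hμ, hgrad⟩ := h.exists_grad i
    have hn := real_inner_self_pos.2 (conormal_ne_zero ((hF.2 t₀ ht₀).2 (pt i)))
    have h1 := hgrad (conormal (F t₀) (pt i))
    rw [← hGi, h0, inner_zero_left] at h1
    exact (mul_pos hμ hn).ne h1
  have hpos : ∀ᶠ y : (ℝ × E3) × (ℝ × E3) in 𝓝 ((t₀, p), (t₀, p)), 0 < inner ℝ (G y.1) (G y.2) := by
    have h1 : ContinuousAt (fun y : (ℝ × E3) × (ℝ × E3) => inner ℝ (G y.1) (G y.2))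
        ((t₀, p), (t₀, p)) := by
      refine ContinuousAt.inner ?_ ?_
      · exact ContinuousAt.comp (f := Prod.fst) (g := G) (x := ((t₀, p), (t₀, p))) hGc continuousAt_fst
      · exact ContinuousAt.comp (f := Prod.snd) (g := G) (x := ((t₀, p), (t₀, p))) hGc continuousAt_snd
    exact h1.eventually (lt_mem_nhds (real_inner_self_pos.2 hG0))
  rw [nhds_prod_eq] at hpos
  obtain ⟨B₀, hB₀, hB₀pos⟩ := (eventually_prod_self_iff
    (r := fun y y' => 0 < inner ℝ (G y) (G y'))).1 hpos
  obtain ⟨ρ, hρ, hball⟩ := Metric.mem_nhds_iff.1 (inter_mem hB₀ (h.isOpen.mem_nhds h.mem))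
  refine ⟨Metric.ball (t₀, p) ρ, Metric.ball_mem_nhds _ hρ, ?_⟩
  intro t r v s hr hw hv hs
  obtain ⟨μ, hμ, hgrad⟩ := (h.sheet i).grad _ hr
  set n := conormal (F t) r with hn
  have hn' : ∀ y ∈ Metric.ball (t₀, p) ρ, 0 < fderiv ℝ (g i) y (0, n) := by
    intro y hy
    have hGn : G (t, F t r) = μ • n := by
      refine ext_inner_right ℝ fun w => ?_
      rw [hGi, hgrad, real_inner_smul_left]
    have h1 := hB₀pos _ (hball hy).1 _ (hball hw).1
    rw [hGn, inner_smul_right, hGi] at h1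
    exact (mul_pos_iff_of_pos_left hμ).1 h1
  have hd : ∀ y ∈ Metric.ball (t₀, p) ρ, DifferentiableAt ℝ (g i) y := fun y hy =>
    (h.contDiffAt (hball hy).2 i).differentiableAt (by simp)
  have hw0 : g i (t, F t r) = 0 := (h.sheet i).zero _ hr
  have e1 : ((t, v) : ℝ × E3) + s • ((0 : ℝ), n) = (t, F t r) :=
    Prod.ext (by simp) (by simpa using hs)
  have e2 : ((t, F t r) : ℝ × E3) + (-s) • ((0 : ℝ), n) = (t, v) :=
    Prod.ext (by simp) (by simp [← hs])
  have hpos' : 0 < s → g i (t, v) < 0 := by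
    intro hs0
    have h1 := lt_add_smul_of_fderiv_pos (g := g i) (y := (t, v)) (w := ((0 : ℝ), n)) (s := s)
      (convex_ball (t₀, p) ρ) hd hn' hs0 hv (by rw [e1]; exact hw)
    rwa [e1, hw0] at h1
  have hneg' : s < 0 → 0 < g i (t, v) := by
    intro hs0
    have h1 := lt_add_smul_of_fderiv_pos (g := g i) (y := (t, F t r)) (w := ((0 : ℝ), n)) (s := -s)
      (convex_ball (t₀, p) ρ) hd hn' (neg_pos.2 hs0) hw (by rw [e2]; exact hv)
    rwa [e2, hw0] at h1
  have hzero : s = 0 → g i (t, v) = 0 := by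
    rintro rfl
    rw [zero_smul, add_zero] at hs
    rw [hs, hw0]
  refine ⟨hpos', fun hg => ?_⟩
  rcases lt_trichotomy s 0 with h1 | h1 | h1
  · exact absurd hg (not_lt.2 (hneg' h1).le)
  · exact absurd (hzero h1) hg.ne
  · exact h1

/-- From a point close to the centre of a local model one can drop a perpendicular to each sheet:
its foot is a closest point of the sheet. -/
theorem IsLocalModel.eventually_exists_foot [IsManifold (𝓡 2) ∞ M] [CompactSpace M] [T2Space M]
    (hM : IsOrientedAtlas M) {F : ℝ → M → E3} {a b : ℝ} (hF : IsRegularHomotopy F a b)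
    {ι : Type*} {t₀ : ℝ} (ht₀ : t₀ ∈ Ioo a b)
    {p : E3} {pt : ι → M} {g : ι → ℝ × E3 → ℝ} {W : ι → Set (ℝ × M)} {V : Set (ℝ × E3)}
    (h : IsLocalModel F t₀ p pt g W V) (i : ι) {O : Set M} (hO : O ∈ 𝓝 (pt i))
    {B : Set (ℝ × E3)} (hB : B ∈ 𝓝 (t₀, p)) :
    ∀ᶠ y in 𝓝 (t₀, p), ∃ r ∈ O, (y.1, r) ∈ W i ∧ (y.1, F y.1 r) ∈ B ∧
      ∃ s : ℝ, y.2 + s • conormal (F y.1) r = F y.1 r := by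
  have hFc : ∀ r, ContinuousAt (fun z : ℝ × M => F z.1 z.2) (t₀, r) := fun r =>
    hF.continuousOn.continuousAt ((isOpen_Ioo.prod isOpen_univ).mem_nhds ⟨ht₀, mem_univ _⟩)
  have hFp : F t₀ (pt i) = p := h.apply_pt i
  obtain ⟨C, hC, hCO, hCc⟩ := local_compact_nhds (x := pt i) (n := O ∩ (fun r => (t₀, r)) ⁻¹' W i)
    (inter_mem hO (((h.sheet i).isOpen.preimage (by fun_prop)).mem_nhds (h.mem_sheet i)))
  have hCclosed : IsClosed C := hCc.isClosed
  have hdist : ∀ r, ContinuousAt (fun z : (ℝ × E3) × M => ‖F z.1.1 z.2 - z.1.2‖) ((t₀, p), r) := by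
    intro r
    have h1 : ContinuousAt (fun z : (ℝ × E3) × M => (z.1.1, z.2)) ((t₀, p), r) := by fun_prop
    have h2 : ContinuousAt (fun z : (ℝ × E3) × M => F z.1.1 z.2) ((t₀, p), r) :=
      ContinuousAt.comp (f := fun z : (ℝ × E3) × M => (z.1.1, z.2))
        (g := fun z : ℝ × M => F z.1 z.2) (hFc r) h1
    exact (h2.sub (by fun_prop)).norm
  have hdist0 : ContinuousAt (fun y : ℝ × E3 => ‖F y.1 (pt i) - y.2‖) (t₀, p) :=
    ContinuousAt.comp (f := fun y : ℝ × E3 => (y, pt i)) (hdist (pt i)) (by fun_prop)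
  -- the closest point is not on the boundary of the compact piece of the sheet
  have hbd : ∀ᶠ y in 𝓝 (t₀, p), ∀ r ∈ C \ interior C,
      ‖F y.1 (pt i) - y.2‖ < ‖F y.1 r - y.2‖ := by
    refine (hCc.diff isOpen_interior).eventually_forall_of_forall_eventually fun r hr => ?_
    have h1 : ContinuousAt (fun z : (ℝ × E3) × M => ‖F z.1.1 (pt i) - z.1.2‖) ((t₀, p), r) :=
      ContinuousAt.comp (f := fun z : (ℝ × E3) × M => z.1) (x := ((t₀, p), r))
        (g := fun y : ℝ × E3 => ‖F y.1 (pt i) - y.2‖) hdist0 continuousAt_fst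
    refine h1.eventually_lt (hdist r) ?_
    simp only [hFp, sub_self, norm_zero, norm_pos_iff, sub_ne_zero]
    intro hrp
    have : r = pt i := (h.sheet i).inj t₀ r (pt i) (hCO hr.1).2 (h.mem_sheet i) (hrp.trans hFp.symm)
    exact hr.2 (this ▸ mem_interior_iff_mem_nhds.2 hC)
  have hW : ∀ᶠ y : ℝ × E3 in 𝓝 (t₀, p), ∀ r ∈ C, (y.1, r) ∈ W i := by
    refine hCc.eventually_forall_of_forall_eventually fun r hr => ?_
    have h1 : ContinuousAt (fun z : (ℝ × E3) × M => (z.1.1, z.2)) ((t₀, p), r) := by fun_prop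
    exact h1.eventually ((h.sheet i).isOpen.mem_nhds (hCO hr).2)
  obtain ⟨ρ, hρ, hρB⟩ := Metric.mem_nhds_iff.1 hB
  have hsmall : ∀ᶠ y in 𝓝 (t₀, p), ‖F y.1 (pt i) - y.2‖ < ρ / 2 := by
    refine hdist0.eventually (gt_mem_nhds ?_)
    simpa [hFp] using hρ
  have hab : ∀ᶠ y : ℝ × E3 in 𝓝 (t₀, p), y.1 ∈ Ioo a b :=
    continuousAt_fst.eventually (isOpen_Ioo.mem_nhds ht₀)
  filter_upwards [hbd, hW, hsmall, hab, Metric.ball_mem_nhds (t₀, p) (half_pos hρ)]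
    with y hybd hyW hysmall hyab hyball
  have hpC : pt i ∈ C := mem_of_mem_nhds hC
  have hFyc : Continuous (F y.1) := (hF.2 _ hyab).1.continuous
  obtain ⟨r, hrC, hrmin⟩ := hCc.exists_isMinOn ⟨_, hpC⟩
    (f := fun r => ‖F y.1 r - y.2‖) (by fun_prop)
  have hrle : ‖F y.1 r - y.2‖ ≤ ‖F y.1 (pt i) - y.2‖ := hrmin hpC
  have hrint : r ∈ interior C := by
    by_contra hri
    exact absurd (hybd r ⟨hrC, hri⟩) (not_lt.2 hrle)
  have hloc : IsLocalMin (fun x => ‖F y.1 x - y.2‖ ^ 2) r := by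
    filter_upwards [mem_interior_iff_mem_nhds.1 hrint] with x hx
    exact pow_le_pow_left₀ (norm_nonneg _) (hrmin hx) 2
  obtain ⟨s, hs⟩ := exists_smul_eq_of_inner_eq_zero ((hF.2 _ hyab).2 r)
    (inner_differential_eq_zero_of_isLocalMin hM (hF.2 _ hyab).1 hloc)
  refine ⟨r, (hCO hrC).1, hyW r hrC, hρB ?_, s, ?_⟩
  · rw [Metric.mem_ball, Prod.dist_eq, max_lt_iff] at hyball ⊢
    refine ⟨by linarith [hyball.1], ?_⟩
    calc dist (F y.1 r) p ≤ dist (F y.1 r) y.2 + dist y.2 p := dist_triangle _ _ _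
      _ < ρ / 2 + ρ / 2 := by
        refine add_lt_add ?_ hyball.2
        rw [dist_eq_norm]
        exact hrle.trans_lt hysmall
      _ = ρ := by ring
  · rw [conormal_eq_planeNormal, ← hs]
    abel

end Surface

/-! ### The quadruple point -/

theorem eventually_sign_of_hasDerivAt {h : ℝ → ℝ} {d t₀ : ℝ} (hd : HasDerivAt h d t₀)
    (h0 : h t₀ = 0) (hd0 : d ≠ 0) :
    ∀ᶠ t in 𝓝[≠] t₀, (0 < h t ↔ 0 < d * (t - t₀)) ∧ (h t < 0 ↔ d * (t - t₀) < 0) := by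
  have hs := hasDerivAt_iff_tendsto_slope.1 hd
  have key : ∀ᶠ t in 𝓝[≠] t₀, 0 < slope h t₀ t * d := by
    have : Tendsto (fun t => slope h t₀ t * d) (𝓝[≠] t₀) (𝓝 (d * d)) := hs.mul_const d
    exact this.eventually (lt_mem_nhds (mul_self_pos.2 hd0))
  filter_upwards [key, self_mem_nhdsWithin] with t ht hne
  have hne' : t - t₀ ≠ 0 := sub_ne_zero.2 hne
  have hsl : h t = slope h t₀ t * (t - t₀) := by
    rw [slope_def_field, h0, sub_zero]
    field_simp
  have hprod : 0 < h t * (d * (t - t₀)) := by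
    have : h t * (d * (t - t₀)) = (slope h t₀ t * d) * ((t - t₀) * (t - t₀)) := by rw [hsl]; ring
    rw [this]
    exact mul_pos ht (mul_self_pos.2 hne')
  rcases mul_pos_iff.1 hprod with ⟨h1, h2⟩ | ⟨h1, h2⟩
  · exact ⟨⟨fun _ => h2, fun _ => h1⟩, fun h => absurd h1 (not_lt.2 h.le),
      fun h => absurd h2 (not_lt.2 h.le)⟩
  · exact ⟨⟨fun h => absurd h1 (not_lt.2 h.le), fun h => absurd h2 (not_lt.2 h.le)⟩,
      fun _ => h2, fun _ => h1⟩

section Surface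

variable {M : Type*} [TopologicalSpace M] [ChartedSpace E2 M]

theorem IsRegularHomotopy.differentiableAt_time [IsManifold (𝓡 2) ∞ M] {F : ℝ → M → E3} {a b : ℝ}
    (hF : IsRegularHomotopy F a b) {t₀ : ℝ} (ht₀ : t₀ ∈ Ioo a b) (r : M) :
    DifferentiableAt ℝ (fun t => F t r) t₀ := by
  set e := chartAt E2 r
  have hre : r ∈ e.source := mem_chart_source E2 r
  have h1 := contDiffOn_homotopy_chart hF (chart_mem_atlas E2 r)
  have h2 : DifferentiableAt ℝ (fun x : ℝ × E2 => F x.1 (e.symm x.2)) (t₀, e r) :=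
    (h1.contDiffAt ((isOpen_Ioo.prod e.open_target).mem_nhds
      ⟨ht₀, e.map_source hre⟩)).differentiableAt (by simp)
  have h3 : DifferentiableAt ℝ (fun t : ℝ => (t, e r)) t₀ := by fun_prop
  have h4 := DifferentiableAt.comp (f := fun t : ℝ => (t, e r)) t₀ h2 h3
  refine h4.congr_of_eventuallyEq (Eventually.of_forall fun t => ?_)
  simp [hre]

/-- The differential in space-time of the equation of a sheet. -/
theorem IsLocalModel.exists_fderiv_eq [IsManifold (𝓡 2) ∞ M] {F : ℝ → M → E3} {a b : ℝ}
    (hF : IsRegularHomotopy F a b) {ι : Type*} {t₀ : ℝ} (ht₀ : t₀ ∈ Ioo a b)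
    {p : E3} {pt : ι → M} {g : ι → ℝ × E3 → ℝ} {W : ι → Set (ℝ × M)} {V : Set (ℝ × E3)}
    (h : IsLocalModel F t₀ p pt g W V) (i : ι) :
    ∃ μ > 0, ∀ τ v, fderiv ℝ (g i) (t₀, p) (τ, v) = μ * (inner ℝ (conormal (F t₀) (pt i)) v
      + -inner ℝ (conormal (F t₀) (pt i)) (deriv (fun t => F t (pt i)) t₀) * τ) := by
  obtain ⟨μ, hμ, hgrad⟩ := h.exists_grad i
  refine ⟨μ, hμ, fun τ v => ?_⟩
  set w := deriv (fun t => F t (pt i)) t₀ with hw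
  have hw' : HasDerivAt (fun t => F t (pt i)) w t₀ := (hF.differentiableAt_time ht₀ _).hasDerivAt
  have hcurve : HasDerivAt (fun t => (t, F t (pt i))) (1, w) t₀ := (hasDerivAt_id t₀).prodMk hw'
  have hg : HasFDerivAt (g i) (fderiv ℝ (g i) (t₀, p)) (t₀, F t₀ (pt i)) := by
    rw [h.apply_pt]
    exact ((h.contDiffAt h.mem i).differentiableAt (by simp)).hasFDerivAt
  have hcomp := hg.comp_hasDerivAt t₀ hcurve
  have hzero : (g i ∘ fun t => (t, F t (pt i))) =ᶠ[𝓝 t₀] fun _ => 0 := by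
    have hc : ContinuousAt (fun t : ℝ => (t, pt i)) t₀ := by fun_prop
    filter_upwards [hc.eventually ((h.sheet i).isOpen.mem_nhds (h.mem_sheet i))] with t ht
    exact (h.sheet i).zero _ ht
  have h0 : fderiv ℝ (g i) (t₀, p) (1, w) = 0 :=
    hcomp.unique ((hasDerivAt_const t₀ (0 : ℝ)).congr_of_eventuallyEq hzero)
  have hdec : ((τ, v) : ℝ × E3) = τ • ((1 : ℝ), w) + ((0 : ℝ), v - τ • w) :=
    Prod.ext (by simp) (by simp)
  rw [hdec, map_add, map_smul, h0, hgrad, inner_sub_right, inner_smul_right, smul_zero]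
  ring

/-- No direction transverse to the time slices is tangent to all four sheets of the track. -/
theorem exists_fderiv_ne_zero_of_crossing [IsManifold (𝓡 2) ∞ M] {F : ℝ → M → E3} {a b : ℝ}
    (hF : IsRegularHomotopy F a b) {t₀ : ℝ} (ht₀ : t₀ ∈ Ioo a b) {q : Fin 4 → M}
    (hQ : IsQuadrupleEvent F t₀ q) {p : E3} {g : Fin 4 → ℝ × E3 → ℝ} {W : Fin 4 → Set (ℝ × M)}
    {V : Set (ℝ × E3)} (h : IsLocalModel F t₀ p q g W V) (ξ : E3) :
    ∃ i, fderiv ℝ (g i) (t₀, p) (1, ξ) ≠ 0 := by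
  by_contra! hall
  set c : Fin 4 → E3 × ℝ := fun i => (conormal (F t₀) (q i),
    -inner ℝ (conormal (F t₀) (q i)) (deriv (fun t => F t (q i)) t₀)) with hc
  have hspan : Submodule.span ℝ (range c) = ⊤ :=
    hQ.crossing.span_eq_top_of_card_eq_finrank (by simp [E3])
  have hzero : ∀ z ∈ Submodule.span ℝ (range c), inner ℝ z.1 ξ + z.2 = 0 := by
    intro z hz
    induction hz using Submodule.span_induction with
    | mem z hz =>
      obtain ⟨i, rfl⟩ := hz
      obtain ⟨μ, hμ, hgrad⟩ := h.exists_fderiv_eq hF ht₀ i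
      have h1 := hall i
      rw [hgrad, mul_one] at h1
      exact (mul_eq_zero.1 h1).resolve_left hμ.ne'
    | zero => simp
    | add x y _ _ hx hy =>
      rw [Prod.fst_add, Prod.snd_add, inner_add_left]
      linarith
    | smul r x _ hx =>
      rw [Prod.smul_fst, Prod.smul_snd, real_inner_smul_left, smul_eq_mul, ← mul_add, hx, mul_zero]
  have h1 := hzero ((0 : E3), (1 : ℝ)) (by rw [hspan]; trivial)
  simp at h1

/-- The face of the tetrahedron on the `i`-th sheet is cooriented outwards if and only if the
opposite vertex, the triple point `x t` of the other sheets, is on the negative side of the sheet. -/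
theorem isOutward_iff [IsManifold (𝓡 2) ∞ M] [CompactSpace M] [T2Space M]
    (hM : IsOrientedAtlas M) {F : ℝ → M → E3} {a b : ℝ} (hF : IsRegularHomotopy F a b)
    {t₀ : ℝ} (ht₀ : t₀ ∈ Ioo a b) {q : Fin 4 → M} {p : E3} {g : Fin 4 → ℝ × E3 → ℝ}
    {W : Fin 4 → Set (ℝ × M)} {V : Set (ℝ × E3)} (h : IsLocalModel F t₀ p q g W V) (i : Fin 4)
    {x : ℝ → E3} (hx : ContinuousAt x t₀) (hx0 : x t₀ = p)
    (hxU : ∀ᶠ y in 𝓝 (t₀, p), (∀ k, k ≠ i → g k y = 0) ↔ y.2 = x y.1)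
    {l : Filter ℝ} [l.NeBot] (hl : l ≤ 𝓝 t₀) {P : Prop}
    (hsign : ∀ᶠ t in l, g i (t, x t) < 0 ↔ P) : IsOutward F l q i ↔ P := by
  obtain ⟨B, hB, hBsign⟩ := h.eventually_sign hF ht₀ i
  have hxc : ContinuousAt (fun t => (t, x t)) t₀ := continuousAt_id.prodMk hx
  have hxB : ∀ᶠ t in 𝓝 t₀, (t, x t) ∈ B := by
    rw [ContinuousAt, hx0] at hxc
    exact hxc.eventually hB
  constructor
  · intro hout
    have hFc : ∀ r, ContinuousAt (fun z : ℝ × M => (z.1, F z.1 z.2)) (t₀, r) := fun r =>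
      continuousAt_fst.prodMk (hF.continuousOn.continuousAt
        ((isOpen_Ioo.prod isOpen_univ).mem_nhds ⟨ht₀, mem_univ _⟩))
    have hnear : ∀ k, ∀ᶠ z in 𝓝 (t₀, q k), z ∈ W k ∧ (z.1, F z.1 z.2) ∈ B ∧
        ((∀ k, k ≠ i → g k (z.1, F z.1 z.2) = 0) ↔ F z.1 z.2 = x z.1) := by
      intro k
      have h1 := hFc (q k)
      rw [ContinuousAt, h.apply_pt k] at h1
      exact inter_mem ((h.sheet k).isOpen.mem_nhds (h.mem_sheet k))
        (inter_mem (h1.eventually hB) (h1.eventually hxU))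
    simp only [nhds_prod_eq, eventually_prod_iff] at hnear
    choose pa hpa pb hpb hpab using hnear
    have hU : {r : Fin 4 → M | ∀ k, pb k (r k)} ∈ 𝓝 q := by
      have : ∀ᶠ r : Fin 4 → M in 𝓝 q, ∀ k, pb k (r k) := by
        rw [eventually_all]
        exact fun k => (continuous_apply k).continuousAt.eventually (hpb k)
      exact this
    have hpa' : ∀ᶠ t in l, ∀ k, pa k t := by
      rw [eventually_all]
      exact fun k => hl (hpa k)
    have hxB' : ∀ᶠ t in l, (t, x t) ∈ B := hl hxB
    obtain ⟨t, ⟨r, hrU, s, hs, hr⟩, hta, htB, htsign⟩ :=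
      ((hout _ hU).and (hpa'.and (hxB'.and hsign))).exists
    have hprop := fun k => hpab k (hta k) (hrU k)
    have hv : ∀ k, k ≠ i → F t (r k) = F t (r i) - s • conormal (F t) (r i) := fun k hk =>
      eq_sub_of_add_eq (hr k hk)
    -- the common value of the `F t (r k)` is the vertex opposite to the face
    have hvx : F t (r i) - s • conormal (F t) (r i) = x t := by
      obtain ⟨k₀, hk₀⟩ := exists_ne i
      rw [← hv k₀ hk₀]
      refine (hprop k₀).2.2.1 fun k hk => ?_
      rw [hv k₀ hk₀, ← hv k hk]
      exact (h.sheet k).zero _ (hprop k).1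
    refine htsign.1 (((hBsign t (r i) (x t) s (hprop i).1 (hprop i).2.1 htB ?_)).1 hs)
    rw [← hvx]
    abel
  · intro hP U hU
    rw [nhds_pi, Filter.mem_pi'] at hU
    obtain ⟨I, O, hO, hOU⟩ := hU
    have hfoot := h.eventually_exists_foot hM hF ht₀ i (hO i) hB
    have hnear := eventually_fiber_subset hF ht₀ (p := p) (O := ⋃ k, W k ∩ univ ×ˢ O k) (by
      intro r hr
      have hr' : r ∈ range q := by rw [h.range_eq]; exact hr
      obtain ⟨k, rfl⟩ := hr'
      refine mem_of_superset (inter_mem ((h.sheet k).isOpen.mem_nhds (h.mem_sheet k)) ?_)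
        (subset_iUnion (fun k => W k ∩ univ ×ˢ O k) k)
      exact prod_mem_nhds univ_mem (hO k))
    have hV : ∀ᶠ y in 𝓝 (t₀, p), y ∈ V := h.isOpen.mem_nhds h.mem
    rw [ContinuousAt, hx0] at hxc
    filter_upwards [hl hxB, hsign, hl (hxc.eventually (hfoot.and (hnear.and (hV.and hxU))))]
      with t htB htsign ht
    obtain ⟨⟨ri, hriO, hriW, hriB, s, hs⟩, htn, htV, htx⟩ := ht
    have hzero : ∀ k, k ≠ i → g k (t, x t) = 0 := htx.2 rfl
    have hpre : ∀ k, ∃ r, k ≠ i → r ∈ O k ∧ F t r = x t := by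
      intro k
      by_cases hk : k = i
      · exact ⟨q k, fun h => absurd hk h⟩
      · obtain ⟨r, hrW, hr⟩ := (h.sheet k).exists_of_zero _ htV (hzero k hk)
        obtain ⟨k', hk'⟩ := mem_iUnion.1 (htn r hr)
        have hkk : k' = k := h.eq_of_mem hk'.1 hrW
        subst hkk
        exact ⟨r, fun _ => ⟨hk'.2.2, hr⟩⟩
    choose r hr using hpre
    refine ⟨Function.update r i ri, hOU fun k _ => ?_, s, ?_, fun k hk => ?_⟩
    · by_cases hk : k = i
      · subst hk
        simpa using hriO
      · simpa [hk] using (hr k hk).1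
    · exact ((hBsign t ri (x t) s hriW hriB htB hs)).2 (htsign.2 hP)
    · rw [Function.update_self, Function.update_of_ne hk, (hr k hk).2]
      exact hs

theorem powersetCard_three_eq_image_compl :
    (Finset.univ : Finset (Fin 4)).powersetCard 3 = Finset.univ.image fun i => ({i}ᶜ : Finset _) := by
  decide

/-- The local picture of a quadruple-point event: `d i` is the speed, relative to the `i`-th sheet,
of the triple point of the three others, counted in the direction of the coorientation, and the
numbering near the event is `c` plus the number of the four sheets of which the point is on the
positive side. The sign of `σ` is the sign of
`t - t₀` along the filter `l`: negative before the event, positive after it. At these times the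
triple point opposite to the `i`-th sheet is on the positive side of it if and only if `σ * d i` is
positive, and its index is `c + 3 / 2`, increased by `1` in this case. -/
theorem IsQuadrupleEvent.exists_speeds [IsManifold (𝓡 2) ∞ M] [CompactSpace M] [T2Space M]
    (hM : IsOrientedAtlas M) {F : ℝ → M → E3} {a b : ℝ} (hF : IsRegularHomotopy F a b)
    {A : ℝ × E3 → ℚ} (hA : HasSheetJumps F (Ioo a b) A)
    (hinf : ∀ t ∈ Ioo a b, ∀ᶠ x in Bornology.cobounded E3, A (t, x) = -3 / 2)
    {t₀ : ℝ} (ht₀ : t₀ ∈ Ioo a b) {q : Fin 4 → M} (hQ : IsQuadrupleEvent F t₀ q) :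
    ∃ (d : Fin 4 → ℝ) (c : ℚ), (∀ i, d i ≠ 0) ∧
      (∃ N ∈ 𝓝 (F t₀ (q 0)), triplePoints (F t₀) ∩ N ⊆ {F t₀ (q 0)}) ∧
      ∀ (l : Filter ℝ) (σ : ℝ), l.NeBot → l ≤ 𝓝[≠] t₀ → (∀ᶠ t in l, 0 < σ * (t - t₀)) →
        (∀ᶠ t in l, t ∈ Ioo a b ∧ IsGenericImmersion (F t)) →
        (∀ i, IsOutward F l q i ↔ σ * d i < 0) ∧
        HasLocalSum F l (F t₀ (q 0)) (∑ i, ((if 0 < σ * d i then 1 else 0) + c + 3 / 2)) := by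
  classical
  set p := F t₀ (q 0) with hp
  obtain ⟨g, W, V, -, h⟩ := exists_isLocalModel hM hF ht₀ p hQ.injective hQ.fiber.symm
  obtain ⟨c, hc⟩ := hA.exists_eventually_eq hF ht₀ h
  have hcurve : ∀ i : Fin 4, ∃ x : ℝ → E3, DifferentiableAt ℝ x t₀ ∧ x t₀ = p ∧
      ∀ᶠ y in 𝓝 (t₀, p), (∀ k ∈ ({i}ᶜ : Finset (Fin 4)), g k y = 0) ↔ y.2 = x y.1 := by
    intro i
    refine h.exists_triple_curve (by simp [Finset.card_compl]) ?_
    refine (hQ.generalPosition i).comp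
      (fun k : ({i}ᶜ : Finset (Fin 4)) => ⟨k.1, fun hki => Finset.mem_compl.1 k.2 (Finset.mem_singleton.2 hki)⟩) fun k k' hkk => ?_
    exact Subtype.ext (congrArg (fun z : {k : Fin 4 // k ≠ i} => z.1) hkk)
  choose x hx hx0 hxU using hcurve
  have hxU' : ∀ i, ∀ᶠ y in 𝓝 (t₀, p), (∀ k, k ≠ i → g k y = 0) ↔ y.2 = x i y.1 := by
    intro i
    simpa using hxU i
  have hxc : ∀ i, Tendsto (fun t => (t, x i t)) (𝓝 t₀) (𝓝 (t₀, p)) := by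
    intro i
    have : ContinuousAt (fun t => (t, x i t)) t₀ := continuousAt_id.prodMk (hx i).continuousAt
    rwa [ContinuousAt, hx0] at this
  have hcurve0 : ∀ i, ∀ᶠ t in 𝓝 t₀, ∀ k, k ≠ i → g k (t, x i t) = 0 := by
    intro i
    filter_upwards [(hxc i).eventually (hxU' i)] with t ht using ht.2 rfl
  have hder : ∀ i k, HasDerivAt (fun t => g k (t, x i t))
      (fderiv ℝ (g k) (t₀, p) (1, deriv (x i) t₀)) t₀ := by
    intro i k
    have h1 : HasDerivAt (fun t => (t, x i t)) (1, deriv (x i) t₀) t₀ :=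
      (hasDerivAt_id t₀).prodMk (hx i).hasDerivAt
    have h2 : HasFDerivAt (g k) (fderiv ℝ (g k) (t₀, p)) (t₀, x i t₀) := by
      rw [hx0]
      exact ((h.contDiffAt h.mem k).differentiableAt (by simp)).hasFDerivAt
    exact h2.comp_hasDerivAt t₀ h1
  -- the speed of the `i`-th triple point relative to the `i`-th sheet
  set d : Fin 4 → ℝ := fun i => fderiv ℝ (g i) (t₀, p) (1, deriv (x i) t₀) with hd
  have hd0 : ∀ i, d i ≠ 0 := by
    intro i hdi
    -- otherwise the velocity of the triple point in space-time is tangent to all four sheets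
    obtain ⟨k, hk⟩ := exists_fderiv_ne_zero_of_crossing hF ht₀ hQ h (deriv (x i) t₀)
    by_cases hki : k = i
    · subst hki
      exact hk hdi
    · refine hk ((hder i k).unique ((hasDerivAt_const t₀ (0 : ℝ)).congr_of_eventuallyEq ?_))
      filter_upwards [hcurve0 i] with t ht using ht k hki
  refine ⟨d, c, hd0, ?_, fun l σ hlne hl hσ hgen => ?_⟩
  · have hev : ∀ᶠ y in 𝓝 (t₀, p), y ∈ V ∧ ∀ i, (∀ k, k ≠ i → g k y = 0) ↔ y.2 = x i y.1 :=
      inter_mem (h.isOpen.mem_nhds h.mem) (eventually_all.2 hxU')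
    have hcont : ContinuousAt (fun y : E3 => (t₀, y)) p := by fun_prop
    refine ⟨{y | (t₀, y) ∈ V ∧ ∀ i, (∀ k, k ≠ i → g k (t₀, y) = 0) ↔ y = x i t₀},
      hcont.eventually hev, ?_⟩
    rintro y ⟨hyT, hyV, hy⟩
    have h3 := (h.mem_triplePoints_iff hyV).1 hyT
    have hsc : (Finset.univ.filter fun i => g i (t₀, y) = 0) ∈
        (Finset.univ : Finset (Fin 4)).powersetCard 3 := by
      rw [Finset.mem_powersetCard, ← ncard_coe_finset]
      simpa using h3
    rw [powersetCard_three_eq_image_compl] at hsc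
    obtain ⟨i, -, hi⟩ := Finset.mem_image.1 hsc
    rw [mem_singleton_iff, ← hx0 i]
    refine (hy i).1 fun k hk => ?_
    have : k ∈ ({i}ᶜ : Finset (Fin 4)) := by simpa using hk
    rw [hi] at this
    simpa using this
  have hl' : l ≤ 𝓝 t₀ := hl.trans nhdsWithin_le_nhds
  have hsg : ∀ i, ∀ᶠ t in l, (0 < g i (t, x i t) ↔ 0 < σ * d i) ∧
      (g i (t, x i t) < 0 ↔ σ * d i < 0) := by
    intro i
    have h0 : g i (t₀, x i t₀) = 0 := by rw [hx0, h.zero]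
    filter_upwards [hl (eventually_sign_of_hasDerivAt (hder i i) h0 (hd0 i)), hσ] with t ht hσt
    have hsq : d i * (t - t₀) * (σ * σ) = σ * d i * (σ * (t - t₀)) := by ring
    have hσ2 : 0 < σ * σ := mul_self_pos.2 fun h => by simp [h] at hσt
    rw [ht.1, ht.2]
    constructor
    · rw [← mul_pos_iff_of_pos_right hσ2, hsq, mul_pos_iff_of_pos_right hσt]
    · have hneg : ∀ {u v : ℝ}, 0 < v → (u < 0 ↔ u * v < 0) := fun hv =>
        ⟨fun hu => mul_neg_of_neg_of_pos hu hv, fun hu => neg_of_mul_neg_left hu hv.le⟩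
      rw [hneg hσ2, hsq, ← hneg hσt]
  refine ⟨fun i => isOutward_iff hM hF ht₀ h i (hx i).continuousAt (hx0 i) (hxU' i) hl'
    ((hsg i).mono fun t ht => ht.2), ?_⟩
  -- the curve on which the sheets of the triple `s` meet is `x i`, where `i` is the sheet not in `s`
  set X : Finset (Fin 4) → ℝ → E3 := fun s t =>
    if hs : ∃ i, s = {i}ᶜ then x hs.choose t else 0 with hX
  have hXi : ∀ i : Fin 4, X {i}ᶜ = x i := by
    intro i
    have hex : ∃ k : Fin 4, ({i}ᶜ : Finset (Fin 4)) = {k}ᶜ := ⟨i, rfl⟩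
    have hch : hex.choose = i := by
      have := hex.choose_spec
      exact (Finset.singleton_injective (compl_injective this)).symm
    funext t
    simp only [hX]
    rw [dif_pos hex, hch]
  have hcompl : ∀ s : Finset (Fin 4), s.card = 3 → ∃ i, s = {i}ᶜ := by
    intro s hs
    have : s ∈ (Finset.univ : Finset (Fin 4)).powersetCard 3 :=
      Finset.mem_powersetCard.2 ⟨Finset.subset_univ s, hs⟩
    rw [powersetCard_three_eq_image_compl] at this
    obtain ⟨i, -, hi⟩ := Finset.mem_image.1 this
    exact ⟨i, hi.symm⟩
  obtain ⟨N, hN, hN'⟩ := h.exists_nhds_triplePoints hA hinf hc (x := X) (by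
      intro s hs
      obtain ⟨i, rfl⟩ := hcompl s hs
      rw [hXi]
      exact ⟨(hx i).continuousAt, hx0 i, hxU i⟩) hl' hgen (by
      intro s hs
      obtain ⟨i, rfl⟩ := hcompl s hs
      rw [hXi]
      filter_upwards [hsg i] with t ht k hk
      have hki : k = i := by simpa using hk
      subst hki
      rcases lt_or_gt_of_ne (mul_ne_zero (fun h0 : σ = 0 => by
        obtain ⟨t, ht⟩ := hσ.exists
        simp [h0] at ht) (hd0 k)) with h1 | h1
      · exact (ht.2.2 h1).ne
      · exact (ht.1.2 h1).ne')
  refine ⟨N, hN, fun N' hN'' hsub => ?_⟩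
  filter_upwards [hN' N' hN'' hsub, eventually_all.2 hsg,
    eventually_all.2 fun i => hl' (hcurve0 i)] with t ht hts ht0
  refine ⟨by rw [ht.1]; exact Finset.finite_toSet _, ?_⟩
  rw [ht.2, powersetCard_three_eq_image_compl, Finset.sum_image
    (fun i _ k _ hik => Finset.singleton_injective (compl_injective hik))]
  refine Finset.sum_congr rfl fun i _ => ?_
  congr 2
  rw [hXi]
  by_cases hdi : 0 < σ * d i
  · have hset : {k | 0 < g k (t, x i t)} = {i} := by
      ext k
      rw [mem_ofPred_eq, mem_singleton_iff]
      refine ⟨fun hk => by_contra fun hki => ?_, ?_⟩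
      · rw [ht0 i k hki] at hk
        exact lt_irrefl _ hk
      · rintro rfl
        exact (hts k).1.2 hdi
    rw [if_pos hdi, sideCount, hset]
    simp
  · have hset : {k | 0 < g k (t, x i t)} = ∅ := by
      ext k
      rw [mem_ofPred_eq, mem_empty_iff_false, iff_false]
      intro hk
      by_cases hki : k = i
      · subst hki
        exact hdi ((hts k).1.1 hk)
      · rw [ht0 i k hki] at hk
        exact lt_irrefl _ hk
    rw [if_neg hdi, sideCount, hset]
    simp

end Surface

/-! ### The jump of the invariant -/

theorem finite_triplePoints {M : Type*} [TopologicalSpace M] [CompactSpace M]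
    {f : M → E3} (hf : Continuous f) (h : ∀ p, ∃ N ∈ 𝓝 p, triplePoints f ∩ N ⊆ {p}) :
    (triplePoints f).Finite := by
  choose N hN hNT using h
  obtain ⟨S, -, hS⟩ := (isCompact_range hf).elim_nhds_subcover N fun p _ => hN p
  refine S.finite_toSet.subset fun y hy => ?_
  obtain ⟨p, hp, hyp⟩ := mem_iUnion₂.1 (hS (triplePoints_subset_range f hy))
  have : y = p := hNT p ⟨hy, hyp⟩
  exact this ▸ hp

section Surface

variable {M : Type*} [TopologicalSpace M] [ChartedSpace E2 M]

/-- Triple points are isolated from the points where the sheets are transverse. -/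
theorem exists_nhds_triplePoints_subset [IsManifold (𝓡 2) ∞ M] [CompactSpace M] [T2Space M]
    (hM : IsOrientedAtlas M) {F : ℝ → M → E3} {a b : ℝ} (hF : IsRegularHomotopy F a b)
    {t₀ : ℝ} (ht₀ : t₀ ∈ Ioo a b) {p : E3} (htr : IsTransverseAt (F t₀) p) :
    ∃ N ∈ 𝓝 p, triplePoints (F t₀) ∩ N ⊆ {p} := by
  classical
  obtain ⟨g, W, V, -, h⟩ := exists_isLocalModel hM hF ht₀ p
    (pt := (Subtype.val : F t₀ ⁻¹' {p} → M)) Subtype.val_injective Subtype.range_val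
  have := h.finite
  have := Fintype.ofFinite (F t₀ ⁻¹' {p})
  have hcard : Fintype.card (F t₀ ⁻¹' {p}) ≤ 3 := by
    have := htr.fintype_card_le_finrank
    simpa [E3] using this
  have hcont : ContinuousAt (fun y : E3 => (t₀, y)) p := by fun_prop
  have hV : {y : E3 | (t₀, y) ∈ V} ∈ 𝓝 p := hcont.eventually (h.isOpen.mem_nhds h.mem)
  have hcardle : ∀ y, (t₀, y) ∈ V → y ∈ triplePoints (F t₀) →
      3 ≤ (Finset.univ.filter fun i => g i (t₀, y) = 0).card := by
    intro y hy hyT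
    have h3 := (h.mem_triplePoints_iff hy).1 hyT
    rw [← ncard_coe_finset]
    simpa using h3.ge
  by_cases h3 : Fintype.card (F t₀ ⁻¹' {p}) = 3
  · have hind : ∀ s : Finset (F t₀ ⁻¹' {p}),
        LinearIndependent ℝ fun k : s => conormal (F t₀) (k : F t₀ ⁻¹' {p}) := fun s =>
      LinearIndependent.comp htr (Subtype.val : s → _) Subtype.val_injective
    obtain ⟨x, -, hx0, hxU⟩ := h.exists_triple_curve (s := Finset.univ) h3 (hind _)
    refine ⟨_, inter_mem hV (hcont.eventually hxU), ?_⟩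
    rintro y ⟨hyT, hyV, hy⟩
    rw [mem_singleton_iff, ← hx0]
    refine hy.1 fun k _ => ?_
    have huniv := Finset.eq_univ_of_card _
      (le_antisymm (Finset.card_le_univ _) (h3.trans_le (hcardle y hyV hyT)))
    have hk := Finset.mem_univ k
    rw [← huniv] at hk
    exact (Finset.mem_filter.1 hk).2
  · refine ⟨_, hV, ?_⟩
    rintro y ⟨hyT, hyV⟩
    have h1 := hcardle y hyV hyT
    exact absurd (le_antisymm hcard (h1.trans (Finset.card_le_univ _))) h3

/-- At a time at which the surface is generic, the invariant is locally constant. -/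
theorem eventually_St2_eq_of_generic [IsManifold (𝓡 2) ∞ M] [CompactSpace M] [T2Space M]
    (hM : IsOrientedAtlas M) {F : ℝ → M → E3} {a b : ℝ} (hF : IsRegularHomotopy F a b)
    {A : ℝ × E3 → ℚ} (hA : HasSheetJumps F (Ioo a b) A)
    (hinf : ∀ t ∈ Ioo a b, ∀ᶠ x in Bornology.cobounded E3, A (t, x) = -3 / 2)
    {t₁ : ℝ} (ht₁ : t₁ ∈ Ioo a b)
    (hgen : ∀ᶠ t in 𝓝 t₁, t ∈ Ioo a b ∧ IsGenericImmersion (F t)) :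
    (triplePoints (F t₁)).Finite ∧ ∀ᶠ t in 𝓝 t₁, St2 (F t) = St2 (F t₁) := by
  have hg := hgen.self_of_nhds.2
  have hfin : (triplePoints (F t₁)).Finite := finite_triplePoints hg.1.1.continuous
    fun p => exists_nhds_triplePoints_subset hM hF ht₁ (hg.2 p)
  choose L hL using fun p => exists_hasLocalSum_of_isTransverseAt hM hF hA hinf ht₁ (hg.2 p)
  have hev := eventually_St2_eq hF ht₁ le_rfl hfin.toFinset (L := L)
    (fun p _ => (hL p _ le_rfl hgen).1)
    (fun p hp => (hL p _ le_rfl hgen).2 (by simpa using hp))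
  refine ⟨hfin, ?_⟩
  filter_upwards [hev] with t ht
  rw [ht.2, hev.self_of_nhds.2]

theorem sum_sign_sub_sum_sign {d : Fin 4 → ℝ} (hd : ∀ i, d i ≠ 0) (c : ℚ) :
    (∑ i, ((if 0 < 1 * d i then 1 else 0) + c + 3 / 2)) -
      ∑ i, ((if 0 < -1 * d i then 1 else 0) + c + 3 / 2) =
      2 * ({i | 0 < d i}.ncard : ℚ) - 4 := by
  have h1 : ∀ i, (if 0 < -1 * d i then (1 : ℚ) else 0) = 1 - if 0 < d i then 1 else 0 := by
    intro i
    rcases lt_or_gt_of_ne (hd i) with h | h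
    · rw [if_pos (by linarith), if_neg (by linarith)]
      norm_num
    · rw [if_neg (by linarith), if_pos h]
      norm_num
  have h2 : ({i | 0 < d i}.ncard : ℚ) = ∑ i, if 0 < d i then 1 else 0 := by
    rw [Finset.sum_boole, ← ncard_coe_finset]
    simp
  rw [h2, ← Finset.sum_sub_distrib]
  simp only [h1, one_mul, Fin.sum_univ_four]
  ring

theorem ncard_neg_add_ncard_pos {d : Fin 4 → ℝ} (hd : ∀ i, d i ≠ 0) :
    {i | d i < 0}.ncard + {i | 0 < d i}.ncard = 4 := by
  have hc : {i | d i < 0}ᶜ = {i | 0 < d i} := by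
    ext i
    simp only [mem_compl_iff, mem_ofPred_eq, not_lt]
    exact ⟨fun h => lt_of_le_of_ne h (hd i).symm, le_of_lt⟩
  rw [← hc, ncard_add_ncard_compl]
  simp

/-- Before the event the number of outward cooriented faces is the number of sheets crossed by the
opposite vertex in the direction of the coorientation; after it, of those crossed backwards. Each
of the former contributes `1` to the jump of the invariant, each of the latter `-1`. -/
theorem IsQuadrupleEvent.jump [IsManifold (𝓡 2) ∞ M] [CompactSpace M] [T2Space M]
    (hM : IsOrientedAtlas M) {F : ℝ → M → E3} {a b : ℝ} (hF : IsRegularHomotopy F a b)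
    {A : ℝ × E3 → ℚ} (hA : HasSheetJumps F (Ioo a b) A)
    (hinf : ∀ t ∈ Ioo a b, ∀ᶠ x in Bornology.cobounded E3, A (t, x) = -3 / 2)
    {t₀ : ℝ} (ht₀ : t₀ ∈ Ioo a b) {q : Fin 4 → M} (hQ : IsQuadrupleEvent F t₀ q)
    (hgen : ∀ t ∈ Ioo a b, t ≠ t₀ → IsGenericImmersion (F t)) :
    outwardCount F (𝓝[>] t₀) q + outwardCount F (𝓝[<] t₀) q = 4 ∧
    ∃ u v : ℚ, (∀ᶠ t in 𝓝[<] t₀, St2 (F t) = u) ∧ (∀ᶠ t in 𝓝[>] t₀, St2 (F t) = v) ∧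
      v - u = 2 * (outwardCount F (𝓝[<] t₀) q : ℚ) - 4 := by
  classical
  obtain ⟨d, c, hd, hiso, hloc⟩ := hQ.exists_speeds hM hF hA hinf ht₀
  set p₀ := F t₀ (q 0) with hp₀
  have hgen' : ∀ l ≤ 𝓝[≠] t₀, ∀ᶠ t in l, t ∈ Ioo a b ∧ IsGenericImmersion (F t) := by
    intro l hl
    refine Eventually.filter_mono hl ?_
    filter_upwards [self_mem_nhdsWithin, nhdsWithin_le_nhds (isOpen_Ioo.mem_nhds ht₀)]
      with t ht1 ht2 using ⟨ht2, hgen t ht2 ht1⟩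
  have hlt : 𝓝[<] t₀ ≤ 𝓝[≠] t₀ := nhdsWithin_mono _ fun t ht => ne_of_lt ht
  have hgt : 𝓝[>] t₀ ≤ 𝓝[≠] t₀ := nhdsWithin_mono _ fun t ht => ne_of_gt ht
  have hneg := hloc (𝓝[<] t₀) (-1) inferInstance hlt (by
    filter_upwards [self_mem_nhdsWithin] with t ht
    have : t < t₀ := ht
    linarith) (hgen' _ hlt)
  have hpos := hloc (𝓝[>] t₀) 1 inferInstance hgt (by
    filter_upwards [self_mem_nhdsWithin] with t ht
    have : t₀ < t := ht
    linarith) (hgen' _ hgt)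
  have hbefore : outwardCount F (𝓝[<] t₀) q = {i | 0 < d i}.ncard := by
    rw [outwardCount]
    congr 1
    ext i
    rw [mem_ofPred_eq, mem_ofPred_eq, hneg.1 i]
    constructor <;> intro h <;> linarith
  have hafter : outwardCount F (𝓝[>] t₀) q = {i | d i < 0}.ncard := by
    rw [outwardCount]
    congr 1
    ext i
    rw [mem_ofPred_eq, mem_ofPred_eq, hpos.1 i, one_mul]
  have hfin : (triplePoints (F t₀)).Finite := by
    refine finite_triplePoints (hF.2 t₀ ht₀).1.continuous fun p => ?_
    by_cases hp : p = p₀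
    · rw [hp]
      exact hiso
    · exact exists_nhds_triplePoints_subset hM hF ht₀ (hQ.elsewhere p hp)
  -- the quadruple point has four preimages
  have hp₀T : p₀ ∉ triplePoints (F t₀) := by
    intro h
    have h1 : (F t₀ ⁻¹' {p₀}).encard = 3 := h
    rw [hQ.fiber, ← image_univ, hQ.injective.encard_image] at h1
    simp at h1
  have hL : ∀ p, ∃ L, p ≠ p₀ → ∀ l ≤ 𝓝 t₀,
      (∀ᶠ t in l, t ∈ Ioo a b ∧ IsGenericImmersion (F t)) → HasLocalSum F l p L ∧
        (p ∉ triplePoints (F t₀) → ∃ N ∈ 𝓝 p, ∀ᶠ t in l, triplePoints (F t) ∩ N = ∅) := by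
    intro p
    by_cases hp : p = p₀
    · exact ⟨0, fun h => absurd hp h⟩
    · obtain ⟨L, hL⟩ := exists_hasLocalSum_of_isTransverseAt hM hF hA hinf ht₀ (hQ.elsewhere p hp)
      exact ⟨L, fun _ => hL⟩
  choose L hL using hL
  -- the triple points far from the event contribute the same before and after it
  have hsum : ∀ l ≤ 𝓝[≠] t₀, ∀ L₀, HasLocalSum F l p₀ L₀ →
      ∀ᶠ t in l, St2 (F t) = L₀ + ∑ p ∈ hfin.toFinset, L p := by
    intro l hl L₀ hL₀
    have hl' := hl.trans nhdsWithin_le_nhds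
    have hev := eventually_St2_eq hF ht₀ hl' (insert p₀ hfin.toFinset)
      (L := Function.update L p₀ L₀) (fun p _ => by
        by_cases hpp : p = p₀
        · subst hpp
          rwa [Function.update_self]
        · rw [Function.update_of_ne hpp]
          exact (hL p hpp l hl' (hgen' l hl)).1)
      (fun p hp => by
        rw [Finset.mem_insert, not_or, Finite.mem_toFinset] at hp
        exact (hL p hp.1 l hl' (hgen' l hl)).2 hp.2)
    filter_upwards [hev] with t ht
    rw [ht.2, Finset.sum_insert (by simpa using hp₀T), Function.update_self]
    congr 1
    refine Finset.sum_congr rfl fun p hp => Function.update_of_ne ?_ _ _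
    rintro rfl
    exact hp₀T ((Finite.mem_toFinset _).1 hp)
  refine ⟨?_, _, _, hsum _ hlt _ hneg.2, hsum _ hgt _ hpos.2, ?_⟩
  · rw [hbefore, hafter, ncard_neg_add_ncard_pos hd]
  · rw [add_sub_add_right_eq_sub, sum_sign_sub_sum_sign hd, hbefore]

end Surface

end SurfaceStrangeness

end

theorem mainTheorem1 {M : Type*} [TopologicalSpace M] [T2Space M] [CompactSpace M]
    [ChartedSpace SurfaceStrangeness.E2 M] [IsManifold (𝓡 2) ∞ M]
    (hM : SurfaceStrangeness.IsOrientedAtlas M)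
    (F : ℝ → M → SurfaceStrangeness.E3) (a b t₀ : ℝ) (ht₀ : t₀ ∈ Ioo a b)
    (hF : SurfaceStrangeness.IsRegularHomotopy F a b)
    (hgen : ∀ t ∈ Ioo a b, t ≠ t₀ → SurfaceStrangeness.IsGenericImmersion (F t))
    (q : Fin 4 → M) (hQ : SurfaceStrangeness.IsQuadrupleEvent F t₀ q)
    (j : ℕ) (hj : j = SurfaceStrangeness.outwardCount F (𝓝[<] t₀) q) :
    (∀ t ∈ Ioo a b, t ≠ t₀ →
      (∃! A, SurfaceStrangeness.IsAlexanderNumbering (F t) A) ∧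
        (SurfaceStrangeness.triplePoints (F t)).Finite) ∧
    (∀ s ∈ Ioo a t₀, ∀ t ∈ Ioo t₀ b,
      SurfaceStrangeness.St2 (F t) - SurfaceStrangeness.St2 (F s) = 2 * (j : ℚ) - 4) ∧
    (j ≤ 2 → SurfaceStrangeness.quadrupleType F t₀ q = 4 - j) ∧
    (SurfaceStrangeness.quadrupleType F t₀ q = 2 →
      ∀ s ∈ Ioo a t₀, ∀ t ∈ Ioo t₀ b,
        SurfaceStrangeness.St2 (F t) - SurfaceStrangeness.St2 (F s) = 0) := by
  obtain ⟨A, hA, hinf⟩ := SurfaceStrangeness.exists_spacetime_numbering hM hF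
  have hnear : ∀ t ∈ Ioo a b, t ≠ t₀ →
      ∀ᶠ t' in 𝓝 t, t' ∈ Ioo a b ∧ SurfaceStrangeness.IsGenericImmersion (F t') := by
    intro t ht hne
    filter_upwards [isOpen_Ioo.mem_nhds ht, isOpen_ne.mem_nhds hne] with t' h1 h2
      using ⟨h1, hgen t' h1 h2⟩
  have hlc := fun t ht hne =>
    SurfaceStrangeness.eventually_St2_eq_of_generic hM hF hA hinf ht (hnear t ht hne)
  obtain ⟨hcount, u, v, hu, hv, huv⟩ := hQ.jump hM hF hA hinf ht₀ hgen
  have hbefore : ∀ s ∈ Ioo a t₀, SurfaceStrangeness.St2 (F s) = u := by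
    intro s hs
    obtain ⟨s', hs', hs'I⟩ := (hu.and (Ioo_mem_nhdsLT ht₀.1)).exists
    rw [← hs']
    refine SurfaceStrangeness.eq_of_isPreconnected_of_eventually_eq
      (f := fun t => SurfaceStrangeness.St2 (F t)) isPreconnected_Ioo (fun t ht => ?_) hs hs'I
    exact nhdsWithin_le_nhds (hlc t ⟨ht.1, ht.2.trans ht₀.2⟩ ht.2.ne).2
  have hafter : ∀ t ∈ Ioo t₀ b, SurfaceStrangeness.St2 (F t) = v := by
    intro t ht
    obtain ⟨t', ht', ht'I⟩ := (hv.and (Ioo_mem_nhdsGT ht₀.2)).exists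
    rw [← ht']
    refine SurfaceStrangeness.eq_of_isPreconnected_of_eventually_eq
      (f := fun t => SurfaceStrangeness.St2 (F t)) isPreconnected_Ioo (fun t ht => ?_) ht ht'I
    exact nhdsWithin_le_nhds (hlc t ⟨ht₀.1.trans ht.1, ht.2⟩ ht.1.ne').2
  have hjump : ∀ s ∈ Ioo a t₀, ∀ t ∈ Ioo t₀ b,
      SurfaceStrangeness.St2 (F t) - SurfaceStrangeness.St2 (F s) = 2 * (j : ℚ) - 4 := by
    intro s hs t ht
    rw [hbefore s hs, hafter t ht, huv, hj]
  rw [← hj] at hcount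
  refine ⟨fun t ht hne => ⟨?_, (hlc t ht hne).1⟩, hjump, fun hj2 => ?_, fun htype s hs t ht => ?_⟩
  · exact (SurfaceStrangeness.existsUnique_isAlexanderNumbering hA hinf ht (hgen t ht hne)).1
  · rw [SurfaceStrangeness.quadrupleType, ← hj]
    omega
  · rw [SurfaceStrangeness.quadrupleType, ← hj] at htype
    have hj2 : j = 2 := by omega
    rw [hjump s hs t ht, hj2]
    norm_num
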